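/- Let $\mathbb R^2_+=\{x=(x_1,x_2)\in\mathbb R^2: x_2>0\}$ and, for $x\ne y$ in $\mathbb R^2_+$, let $$G(x,y)=\frac1{4\pi}\log\Bigl(1+\frac{4x_2y_2}{|x-y|^2}\Bigr).$$ For an integrable function $\omega$ on $\mathbb R^2_+$ write $\|\omega\|_1=\int_{\mathbb R^2_+}|\omega|\,dx$ (mass) and $\|x_2\omega\|_1=\int_{\mathbb R^2_+}x_2|\omega|\,dx$ (impulse), and $$\mathcal G[\omega](x)=\int_{\mathbb R^2_+}G(x,y)\,\omega(y)\,dy,\qquad E(\omega)=\frac12\int_{\mathbb R^2_+}\mathcal G[\omega](x)\,\omega(x)\,dx .$$ For $M>0$ let $K_M$ be the set of all $\omega\in L^1(\mathbb R^2_+)$ such that $\omega=\mathbf 1_A$ a.e. for some measurable $A\subset\mathbb R^2_+$, $\|x_2\omega\|_1=M$ and $\|\omega\|_1\le 1$, and let $S_M$ be the set of all $\omega\in K_M$ with $E(\omega)=\sup_{K_M}E$. A set $A\subset\mathbb R^2_+$ is called Steiner symmetric if $f=\mathbf 1_A$ satisfies $f(x_1,x_2)=f(-x_1,x_2)$ on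 $\mathbb R^2_+$ and, for each fixed $x_2>0$, $x_1\mapsto f(x_1,x_2)$ is non-increasing on $[0,\infty)$. **Theorem.** For every $M>0$ the following hold. (i) $S_M$ is nonempty. (ii) For each $\omega\in S_M$ there is exactly one pair of constants $W>0$, $\gamma\ge0$ such that $$\omega=\mathbf 1_{\{x\in\mathbb R^2_+\,:\,\mathcal G[\omega](x)-Wx_2-\gamma>0\}}\quad\text{a.e. in }\mathbb R^2_+ .$$ (iii) For each $\omega\in S_M$ there exist $\tau\in\mathbb R$ and a bounded open Steiner symmetric set $A\subset\mathbb R^2_+$ such that $\omega(\cdot+(\tau,0))=\mathbf 1_A$ a.e. in $\mathbb R^2_+$. (iv) If $\omega\in S_M$ and $\|\omega\|_1<1$, then the constant $\gamma$ in (ii) equals $0$. -/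

import Mathlib

open MeasureTheory

noncomputable section

namespace VortexPatch

/-- The open upper half plane. Points of the plane are pairs `x = (x.1, x.2)`, and `volume` on
`ℝ × ℝ` is Lebesgue measure. -/
def halfPlane : Set (ℝ × ℝ) := {x | 0 < x.2}

/-- Green's function of the half plane,
`G(x, y) = (1 / 4π) log (1 + 4 x₂ y₂ / |x - y|²)` with the Euclidean distance `|x - y|`
(the value on the diagonal, a null set, is irrelevant). -/
def green (x y : ℝ × ℝ) : ℝ :=
  1 / (4 * Real.pi) *
    Real.log (1 + 4 * x.2 * y.2 / ((x.1 - y.1) ^ 2 + (x.2 - y.2) ^ 2))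

/-- The stream function `𝒢[ω](x) = ∫_{ℝ²₊} G(x, y) ω(y) dy`. -/
def stream (ω : ℝ × ℝ → ℝ) (x : ℝ × ℝ) : ℝ :=
  ∫ y in halfPlane, green x y * ω y

/-- The kinetic energy `E(ω) = (1/2) ∫_{ℝ²₊} 𝒢[ω](x) ω(x) dx`. -/
def energy (ω : ℝ × ℝ → ℝ) : ℝ :=
  1 / 2 * ∫ x in halfPlane, stream ω x * ω x

/-- The mass `‖ω‖₁` over the half plane. -/
def mass (ω : ℝ × ℝ → ℝ) : ℝ := ∫ x in halfPlane, |ω x|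

/-- The impulse `‖x₂ ω‖₁` over the half plane. -/
def impulse (ω : ℝ × ℝ → ℝ) : ℝ := ∫ x in halfPlane, x.2 * |ω x|

/-- The admissible class `K_M`: integrable functions on the half plane that agree a.e. with the
characteristic function of a measurable set, with impulse exactly `M` and mass at most `1`.
Only the values on the half plane matter. -/
def admissible (M : ℝ) : Set (ℝ × ℝ → ℝ) :=
  {ω | IntegrableOn ω halfPlane ∧
    (∃ A : Set (ℝ × ℝ), MeasurableSet A ∧ A ⊆ halfPlane ∧
      ω =ᵐ[volume.restrict halfPlane] A.indicator 1) ∧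
    IntegrableOn (fun x => x.2 * |ω x|) halfPlane ∧
    impulse ω = M ∧ mass ω ≤ 1}

/-- The set `S_M` of maximizers of the energy over `K_M`. -/
def maximizers (M : ℝ) : Set (ℝ × ℝ → ℝ) :=
  {ω | ω ∈ admissible M ∧ IsMaxOn energy (admissible M) ω}

/-- The region `{x ∈ ℝ²₊ : 𝒢[ω](x) - W x₂ - γ > 0}`. -/
def patchRegion (ω : ℝ × ℝ → ℝ) (W γ : ℝ) : Set (ℝ × ℝ) :=
  {x | x ∈ halfPlane ∧ stream ω x - W * x.2 - γ > 0}

/-- The Steiner symmetry condition about the `x₂`-axis, for a nonnegative measurable function on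
the half plane: even in `x₁`, and nonincreasing in `x₁ ≥ 0` for each fixed `x₂ > 0`. -/
def SteinerSymmetric (f : ℝ × ℝ → ℝ) : Prop :=
  (∀ x ∈ halfPlane, f (x.1, x.2) = f (-x.1, x.2)) ∧
    ∀ b : ℝ, 0 < b → AntitoneOn (fun a : ℝ => f (a, b)) (Set.Ici 0)

end VortexPatch

end

noncomputable section

open Filter Topology

namespace VortexPatch

/-! The constraint set is relaxed to functions 0 ≤ ω ≤ 1 on the half plane with mass at most 1 and
impulse at most M (`Relaxed`). This class is convex, closed under weak limits and under
polarization. Its maximizers turn out to be indicator functions with impulse exactly M, so they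
solve the original problem, and both problems have the same maximal energy.

Bounds. The estimate G(x,y) ≤ x₂ / ‖x - y‖ gives 𝒢[ω](x) ≤ x₂ · `pot ω x`. The potential `pot` is
bounded on the relaxed class, so the impulse controls the energy. Moreover `pot ω x` is small as
soon as ω has little mass near x (`exists_pot_le`).

Symmetry. Polarization across a vertical line keeps mass and impulse and does not lower the energy;
the gain vanishes only if ω is already ordered across the line (`heavy_of_pairing_polar_le`). A
maximizer is therefore ordered across every vertical line. The median of its mass gives an axis x₁ =
τ (`exists_centered`) about which the stream function is even and strictly decreasing in |x₁ - τ|.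
In particular the level sets of 𝒢[ω] - W x₂ - γ are null.

Existence. Compactness can only fail by escape to infinity. Upward escape is excluded by the
impulse. Sideways escape is excluded by maximizing first on half strips, where a maximizer exists
and is ordered by polarization, and then translating its axis to x₁ = 0: ordered functions have
uniformly little mass in distant vertical strips. The energy then passes to weak L² limits
(`exists_max`).

Patch form. A maximizer also maximizes the linearized energy, and Hahn–Banach separation in ℝ³
yields multipliers W, γ ≥ 0 with complementary slackness (`Relaxed.exists_multipliers`). Raising ω
by a small height strictly increases the linearized energy at fixed mass, hence W > 0 and the
impulse is exactly M. The bathtub principle and the null level sets give ω = 1 on the region where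
𝒢[ω] - W x₂ - γ > 0 and ω = 0 elsewhere. Slackness for the mass is (iv). Decay of 𝒢[ω]/x₂ bounds the
patch, and evenness and monotonicity of 𝒢[ω] give the Steiner symmetry. The boundary values of 𝒢[ω]
at two heights determine W and γ. -/

lemma isOpen_halfPlane : IsOpen halfPlane := isOpen_lt continuous_const continuous_snd

lemma measurableSet_halfPlane : MeasurableSet halfPlane := isOpen_halfPlane.measurableSet

/-! ### Pointwise estimates for Green's function -/

lemma measurable_green : Measurable (fun p : (ℝ × ℝ) × (ℝ × ℝ) => green p.1 p.2) := by
  unfold green; fun_prop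

lemma green_comm (x y : ℝ × ℝ) : green x y = green y x := by
  unfold green
  congr 3
  ring

/-- The squared Euclidean distance. -/
def distSq (x y : ℝ × ℝ) : ℝ := (x.1 - y.1) ^ 2 + (x.2 - y.2) ^ 2

lemma green_def (x y : ℝ × ℝ) :
    green x y = 1 / (4 * Real.pi) * Real.log (1 + 4 * x.2 * y.2 / distSq x y) := rfl

lemma distSq_nonneg (x y : ℝ × ℝ) : 0 ≤ distSq x y := by unfold distSq; positivity

lemma distSq_pos {x y : ℝ × ℝ} (h : x ≠ y) : 0 < distSq x y := by
  rcases lt_or_eq_of_le (distSq_nonneg x y) with h0 | h0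
  · exact h0
  · exfalso; apply h
    unfold distSq at h0
    ext
    · nlinarith [sq_nonneg (x.1 - y.1), sq_nonneg (x.2 - y.2)]
    · nlinarith [sq_nonneg (x.1 - y.1), sq_nonneg (x.2 - y.2)]

lemma distSq_self (x : ℝ × ℝ) : distSq x x = 0 := by simp [distSq]

/-- The norm of `ℝ × ℝ` is the sup norm, while `green` uses the Euclidean distance; this comparison
lets the kernel bounds below be stated with ‖x - y‖⁻¹. -/
lemma norm_sub_le_sqrt (x y : ℝ × ℝ) : ‖x - y‖ ≤ √(distSq x y) := by
  apply Real.le_sqrt_of_sq_le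
  rw [Prod.norm_def]
  unfold distSq
  rcases max_cases ‖(x - y).1‖ ‖(x - y).2‖ with h | h <;> rw [h.1] <;>
    simp only [Prod.fst_sub, Prod.snd_sub, Real.norm_eq_abs, sq_abs] <;> nlinarith [sq_nonneg (x.1 - y.1), sq_nonneg (x.2 - y.2)]

lemma green_nonneg {x y : ℝ × ℝ} (hx : x ∈ halfPlane) (hy : y ∈ halfPlane) : 0 ≤ green x y := by
  rw [green_def]
  have hx : 0 < x.2 := hx
  have hy : 0 < y.2 := hy
  have := distSq_nonneg x y
  have h : 1 ≤ 1 + 4 * x.2 * y.2 / distSq x y := by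
    have : 0 ≤ 4 * x.2 * y.2 / distSq x y := by positivity
    linarith
  have := Real.log_nonneg h
  positivity

lemma green_pos {x y : ℝ × ℝ} (hx : x ∈ halfPlane) (hy : y ∈ halfPlane) (h : x ≠ y) :
    0 < green x y := by
  rw [green_def]
  have hx : 0 < x.2 := hx
  have hy : 0 < y.2 := hy
  have := distSq_pos h
  have h : 1 < 1 + 4 * x.2 * y.2 / distSq x y := by
    have : 0 < 4 * x.2 * y.2 / distSq x y := by positivity
    linarith
  have := Real.log_pos h
  positivity

lemma log_one_add_sq_le {t : ℝ} (ht : 0 ≤ t) : Real.log (1 + t ^ 2) ≤ t := by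
  rw [Real.log_le_iff_le_exp (by positivity)]
  have := Real.quadratic_le_exp_of_nonneg ht
  -- The cubic Taylor bound for exp reduces the claim to t (t² - 3t + 6) ≥ 0, and the quadratic
  -- factor is (t - 3/2)² + 15/4.
  rcases le_or_gt t 2 with h | h
  · have := Real.sum_le_exp_of_nonneg ht 4
    simp [Finset.sum_range_succ, Nat.factorial] at this
    nlinarith [mul_nonneg ht (sq_nonneg (t - 3 / 2)), sq_nonneg t, mul_nonneg ht ht]
  · have := Real.sum_le_exp_of_nonneg ht 4
    simp [Finset.sum_range_succ, Nat.factorial] at this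
    nlinarith [mul_nonneg ht (sq_nonneg (t - 3 / 2)), sq_nonneg t, mul_nonneg ht ht]

/-- With r = |x - y| one has y₂ ≤ x₂ + r, and 1 + 4 x₂ (x₂ + r) / r² is the perfect square (1 + 2 x₂
/ r)². This removes y₂ from the bound. -/
lemma log_green_le {x y : ℝ × ℝ} (hx : x ∈ halfPlane) (hy : y ∈ halfPlane) (h : x ≠ y) :
    Real.log (1 + 4 * x.2 * y.2 / distSq x y) ≤ 2 * Real.log (1 + 2 * x.2 / √(distSq x y)) := by
  have hx : 0 < x.2 := hx
  have hy : 0 < y.2 := hy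
  have hq := distSq_pos h
  have hr : 0 < √(distSq x y) := Real.sqrt_pos.2 hq
  have hrq : √(distSq x y) ^ 2 = distSq x y := Real.sq_sqrt hq.le
  have h1 : y.2 - x.2 ≤ √(distSq x y) := by
    apply Real.le_sqrt_of_sq_le
    unfold distSq
    nlinarith [sq_nonneg (x.1 - y.1)]
  generalize √(distSq x y) = r at *
  rw [← hrq]
  rw [show (2:ℝ) * Real.log (1 + 2 * x.2 / r) = Real.log ((1 + 2 * x.2 / r) ^ 2) by
    rw [Real.log_pow]; norm_num]
  apply Real.log_le_log (by positivity)
  have : (1 + 2 * x.2 / r) ^ 2 = 1 + 4 * x.2 * (x.2 + r) / r ^ 2 := by field_simp; ring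
  rw [this]
  gcongr
  linarith

lemma inv_sqrt_distSq_le {x y : ℝ × ℝ} (h : x ≠ y) : (√(distSq x y))⁻¹ ≤ ‖x - y‖⁻¹ := by
  have : 0 < ‖x - y‖ := norm_pos_iff.2 (sub_ne_zero.2 h)
  exact inv_anti₀ this (norm_sub_le_sqrt x y)

/-- From log (1 + t) ≤ t. The factor x₂ is what lets the impulse control the energy. -/
lemma green_le {x y : ℝ × ℝ} (hx : x ∈ halfPlane) (hy : y ∈ halfPlane) :
    green x y ≤ x.2 * ‖x - y‖⁻¹ := by
  by_cases h : x = y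
  · subst h; simp [green_def, distSq_self]
  have h2 : 0 < x.2 := hx
  have hr : 0 < √(distSq x y) := Real.sqrt_pos.2 (distSq_pos h)
  have h1 := log_green_le hx hy h
  have h3 : Real.log (1 + 2 * x.2 / √(distSq x y)) ≤ 2 * x.2 / √(distSq x y) := by
    have := Real.log_le_sub_one_of_pos (x := 1 + 2 * x.2 / √(distSq x y)) (by positivity)
    linarith
  have h4 := inv_sqrt_distSq_le h
  have h5 : green x y ≤ 1 / (4 * Real.pi) * (4 * (x.2 * ‖x - y‖⁻¹)) := by
    rw [green_def]
    gcongr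
    calc _ ≤ 2 * (2 * x.2 / √(distSq x y)) := by linarith
      _ = 4 * (x.2 * (√(distSq x y))⁻¹) := by ring
      _ ≤ _ := by gcongr
  refine h5.trans ?_
  have hp := Real.pi_gt_three
  have : 0 ≤ x.2 * ‖x - y‖⁻¹ := by positivity
  rw [div_mul_eq_mul_div, div_le_iff₀ (by positivity)]
  nlinarith

/-- From log (1 + t²) ≤ t with t² = 2 x₂ / r. It makes G(x, ·) square integrable on bounded sets,
hence a legitimate test function for weak L² convergence. -/
lemma green_sq_le {x y : ℝ × ℝ} (hx : x ∈ halfPlane) (hy : y ∈ halfPlane) :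
    green x y ^ 2 ≤ x.2 * ‖x - y‖⁻¹ := by
  by_cases h : x = y
  · subst h; simp [green_def, distSq_self]
  have h2 : 0 < x.2 := hx
  have hr : 0 < √(distSq x y) := Real.sqrt_pos.2 (distSq_pos h)
  have h1 := log_green_le hx hy h
  have h3 : Real.log (1 + 2 * x.2 / √(distSq x y)) ≤ √(2 * x.2 / √(distSq x y)) := by
    have := log_one_add_sq_le (Real.sqrt_nonneg (2 * x.2 / √(distSq x y)))
    rwa [Real.sq_sqrt (by positivity)] at this
  have h4 := inv_sqrt_distSq_le h
  have hp := Real.pi_gt_three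
  have h0 := green_nonneg hx hy
  have h5 : green x y ≤ √(2 * x.2 / √(distSq x y)) / 6 := by
    rw [green_def]
    have : 1 / (4 * Real.pi) ≤ 1 / 12 := by
      apply one_div_le_one_div_of_le <;> linarith
    calc _ ≤ 1 / (4 * Real.pi) * (2 * √(2 * x.2 / √(distSq x y))) := by gcongr; linarith
      _ ≤ 1 / 12 * (2 * √(2 * x.2 / √(distSq x y))) := by gcongr
      _ = _ := by ring
  calc green x y ^ 2 ≤ (√(2 * x.2 / √(distSq x y)) / 6) ^ 2 := by gcongr
    _ = (2 * x.2 / √(distSq x y)) / 36 := by rw [div_pow, Real.sq_sqrt (by positivity)]; norm_num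
    _ = (x.2 * (√(distSq x y))⁻¹) / 18 := by ring
    _ ≤ (x.2 * (√(distSq x y))⁻¹) := by
      have : 0 < x.2 * (√(distSq x y))⁻¹ := by positivity
      linarith
    _ ≤ _ := by gcongr

lemma abs_log_sub_log_le {a b : ℝ} (ha : 0 < a) (hb : 0 < b) :
    |Real.log a - Real.log b| ≤ |a - b| * (a⁻¹ + b⁻¹) := by
  have key : ∀ {a b : ℝ}, 0 < a → 0 < b → Real.log a - Real.log b ≤ |a - b| * (a⁻¹ + b⁻¹) := by
    intro a b ha hb
    have := Real.log_le_sub_one_of_pos (x := a / b) (by positivity)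
    rw [Real.log_div ha.ne' hb.ne'] at this
    calc _ ≤ a / b - 1 := this
      _ = (a - b) * b⁻¹ := by field_simp
      _ ≤ |a - b| * (a⁻¹ + b⁻¹) := by
        apply mul_le_mul (le_abs_self _) _ (by positivity) (abs_nonneg _)
        have : 0 < a⁻¹ := by positivity
        linarith
  rw [abs_le]
  refine ⟨?_, key ha hb⟩
  have := key hb ha
  rw [abs_sub_comm, add_comm] at this
  linarith

/-- The identification of the plane with `ℂ`. -/
def toC (x : ℝ × ℝ) : ℂ := ⟨x.1, x.2⟩

lemma norm_toC_sub (x y : ℝ × ℝ) : ‖toC x - toC y‖ = √(distSq x y) := by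
  rw [Complex.norm_def, Complex.normSq_apply]
  congr 1
  simp [toC, distSq]; ring

lemma norm_toC_sub_le (x y : ℝ × ℝ) : ‖toC x - toC y‖ ≤ 2 * ‖x - y‖ := by
  rw [norm_toC_sub]
  have h1 : |x.1 - y.1| ≤ ‖x - y‖ := norm_fst_le (x - y)
  have h2 : |x.2 - y.2| ≤ ‖x - y‖ := norm_snd_le (x - y)
  apply Real.sqrt_le_iff.2 ⟨by positivity, ?_⟩
  unfold distSq
  have := sq_le_sq' (by linarith [abs_nonneg (x.1-y.1)]) h1
  have := sq_le_sq' (by linarith [abs_nonneg (x.2-y.2)]) h2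
  rw [sq_abs] at *
  nlinarith [norm_nonneg (x-y)]

lemma abs_log_distSq_sub_le {x x' y : ℝ × ℝ} (h : x ≠ y) (h' : x' ≠ y) :
    |Real.log (distSq x y) - Real.log (distSq x' y)| ≤
      4 * ‖x - x'‖ * ((√(distSq x y))⁻¹ + (√(distSq x' y))⁻¹) := by
  have hr : 0 < √(distSq x y) := Real.sqrt_pos.2 (distSq_pos h)
  have hr' : 0 < √(distSq x' y) := Real.sqrt_pos.2 (distSq_pos h')
  have e : ∀ z : ℝ × ℝ, Real.log (distSq z y) = 2 * Real.log (√(distSq z y)) := by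
    intro z; rw [Real.log_sqrt (distSq_nonneg _ _)]; ring
  rw [e, e, ← mul_sub, abs_mul, abs_two]
  have h1 := abs_log_sub_log_le hr hr'
  have h2 : |√(distSq x y) - √(distSq x' y)| ≤ 2 * ‖x - x'‖ := by
    rw [← norm_toC_sub, ← norm_toC_sub]
    refine (abs_norm_sub_norm_le _ _).trans ?_
    rw [sub_sub_sub_cancel_right]
    exact norm_toC_sub_le x x'
  calc _ ≤ 2 * (|√(distSq x y) - √(distSq x' y)| * ((√(distSq x y))⁻¹ + (√(distSq x' y))⁻¹)) := by
        gcongr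
    _ ≤ 2 * ((2 * ‖x - x'‖) * ((√(distSq x y))⁻¹ + (√(distSq x' y))⁻¹)) := by gcongr
    _ = _ := by ring

/-- The mirror image across the boundary of the half plane. -/
def conjP (y : ℝ × ℝ) : ℝ × ℝ := (y.1, -y.2)

lemma distSq_conjP (x y : ℝ × ℝ) : distSq x (conjP y) = distSq x y + 4 * x.2 * y.2 := by
  simp [distSq, conjP]; ring

lemma green_eq_log_sub {x y : ℝ × ℝ} (hx : x ∈ halfPlane) (hy : y ∈ halfPlane) (h : x ≠ y) :
    green x y = 1 / (4 * Real.pi) * (Real.log (distSq x (conjP y)) - Real.log (distSq x y)) := by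
  have hx : 0 < x.2 := hx
  have hy : 0 < y.2 := hy
  have := distSq_pos h
  rw [green_def, distSq_conjP, ← Real.log_div (by positivity) (by positivity)]
  congr 2
  field_simp

/-- Each of the two logarithms in G is Lipschitz in x away from its pole, and the distance to the
mirror image of y is at least the distance to y, so both are controlled by the same kernel. -/
lemma abs_green_sub_le {x x' y : ℝ × ℝ} (hx : x ∈ halfPlane) (hx' : x' ∈ halfPlane)
    (hy : y ∈ halfPlane) (h : x ≠ y) (h' : x' ≠ y) :
    |green x y - green x' y| ≤ ‖x - x'‖ * (‖x - y‖⁻¹ + ‖x' - y‖⁻¹) := by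
  rw [green_eq_log_sub hx hy h, green_eq_log_sub hx' hy h']
  have hx0 : 0 < x.2 := hx
  have hx0' : 0 < x'.2 := hx'
  have hy0 : 0 < y.2 := hy
  have hc : ∀ z : ℝ × ℝ, 0 < z.2 → z ≠ conjP y := by
    rintro z hz rfl
    simp only [conjP] at hz; linarith
  have hd : ∀ z : ℝ × ℝ, 0 < z.2 → z ≠ y → (√(distSq z (conjP y)))⁻¹ ≤ ‖z - y‖⁻¹ := by
    intro z hz hzy
    refine le_trans ?_ (inv_sqrt_distSq_le hzy)
    apply inv_anti₀ (Real.sqrt_pos.2 (distSq_pos hzy))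
    apply Real.sqrt_le_sqrt
    rw [distSq_conjP]; nlinarith [mul_pos hz hy0]
  have h1 := abs_log_distSq_sub_le (hc x hx0) (hc x' hx0')
  have h2 := abs_log_distSq_sub_le h h'
  have b1 : 4 * ‖x - x'‖ * ((√(distSq x (conjP y)))⁻¹ + (√(distSq x' (conjP y)))⁻¹) ≤
      4 * ‖x - x'‖ * (‖x - y‖⁻¹ + ‖x' - y‖⁻¹) := by
    exact mul_le_mul_of_nonneg_left (add_le_add (hd x hx0 h) (hd x' hx0' h')) (by positivity)
  have b2 : 4 * ‖x - x'‖ * ((√(distSq x y))⁻¹ + (√(distSq x' y))⁻¹) ≤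
      4 * ‖x - x'‖ * (‖x - y‖⁻¹ + ‖x' - y‖⁻¹) := by
    exact mul_le_mul_of_nonneg_left (add_le_add (inv_sqrt_distSq_le h) (inv_sqrt_distSq_le h'))
      (by positivity)
  set P := ‖x - x'‖ * (‖x - y‖⁻¹ + ‖x' - y‖⁻¹)
  have hP : 0 ≤ P := by positivity
  rw [← mul_sub, abs_mul, abs_of_pos (by positivity)]
  have h3 : |Real.log (distSq x (conjP y)) - Real.log (distSq x y) -
      (Real.log (distSq x' (conjP y)) - Real.log (distSq x' y))| ≤ 8 * P := by
    rw [show ∀ a b c d : ℝ, a - b - (c - d) = (a - c) - (b - d) by intros; ring]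
    refine (abs_sub _ _).trans ?_
    have e : 4 * ‖x - x'‖ * (‖x - y‖⁻¹ + ‖x' - y‖⁻¹) = 4 * P := by ring
    linarith
  rw [div_mul_eq_mul_div, div_le_iff₀ (by positivity)]
  nlinarith [Real.pi_gt_three]

/-! ### The potential with kernel 1 / ‖x - y‖ -/

lemma integrableOn_inv_norm (δ : ℝ) :
    IntegrableOn (fun z : ℝ × ℝ => ‖z‖⁻¹) (Metric.ball 0 δ) := by
  rw [integrableOn_fun_norm_addHaar (volume : Measure (ℝ × ℝ)) (f := fun t : ℝ => t⁻¹)]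
  -- In dimension 2 the radial Jacobian r cancels the singularity 1 / r.
  have : IntegrableOn (fun _ : ℝ => (1 : ℝ)) (Set.Ioo 0 δ) := by
    rw [integrableOn_const_iff]; right; simp
  refine this.congr_fun ?_ measurableSet_Ioo
  intro y hy
  have : y ≠ 0 := hy.1.ne'
  simp [this]

lemma exists_integral_inv_norm_le {ε : ℝ} (hε : 0 < ε) :
    ∃ δ > 0, ∫ z in Metric.ball (0 : ℝ × ℝ) δ, ‖z‖⁻¹ ≤ ε := by
  have h : Filter.Tendsto (fun n : ℕ => ∫ z in Metric.ball (0 : ℝ × ℝ) (1 / (n + 1)), ‖z‖⁻¹)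
      Filter.atTop (nhds (∫ z in ⋂ n : ℕ, Metric.ball (0 : ℝ × ℝ) (1 / ((n : ℝ) + 1)), ‖z‖⁻¹)) := by
    apply tendsto_setIntegral_of_antitone
    · intro i; exact measurableSet_ball
    · intro i j hij
      apply Metric.ball_subset_ball
      exact Nat.one_div_le_one_div hij
    · exact ⟨0, integrableOn_inv_norm _⟩
  have h0 : (⋂ n : ℕ, Metric.ball (0 : ℝ × ℝ) (1 / ((n : ℝ) + 1))) = {0} := by
    ext z
    simp only [Set.mem_iInter, Metric.mem_ball, dist_zero_right, Set.mem_singleton_iff]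
    constructor
    · intro hz
      by_contra hne
      obtain ⟨n, hn⟩ := exists_nat_one_div_lt (norm_pos_iff.2 hne)
      exact absurd (hz n) (by linarith)
    · rintro rfl n; simp; positivity
  rw [h0] at h
  simp at h
  obtain ⟨n, hn⟩ := ((tendsto_order.1 h).2 ε hε).exists
  refine ⟨1 / ((n : ℝ) + 1), by positivity, ?_⟩
  simpa using hn.le

/-- The potential of `|f|` with respect to the kernel `1 / ‖x - y‖`. -/
def pot (f : ℝ × ℝ → ℝ) (x : ℝ × ℝ) : ℝ := ∫ y, ‖x - y‖⁻¹ * |f y|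

/-- The mass of the kernel `1 / ‖z‖` on the ball of radius `δ`. -/
def kerMass (δ : ℝ) : ℝ := ∫ z in Metric.ball (0 : ℝ × ℝ) δ, ‖z‖⁻¹

lemma kerMass_nonneg (δ : ℝ) : 0 ≤ kerMass δ := integral_nonneg fun z => by positivity

lemma indicator_ball_sub (x : ℝ × ℝ) (δ : ℝ) :
    (Metric.ball x δ).indicator (fun y => ‖x - y‖⁻¹) =
      fun y => (Metric.ball (0 : ℝ × ℝ) δ).indicator (fun z => ‖z‖⁻¹) (x - y) := by
  ext y
  simp only [Set.indicator, Metric.mem_ball, dist_eq_norm, norm_sub_rev y x, sub_zero]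

lemma integrable_indicator_ball_inv (x : ℝ × ℝ) (δ : ℝ) :
    Integrable ((Metric.ball x δ).indicator (fun y => ‖x - y‖⁻¹)) := by
  rw [indicator_ball_sub]
  exact ((integrableOn_inv_norm δ).integrable_indicator measurableSet_ball).comp_sub_left x

lemma integral_indicator_ball_inv (x : ℝ × ℝ) (δ : ℝ) :
    ∫ y, (Metric.ball x δ).indicator (fun y => ‖x - y‖⁻¹) y = kerMass δ := by
  rw [indicator_ball_sub, integral_sub_left_eq_self (fun y => (Metric.ball (0 : ℝ × ℝ) δ).indicator
    (fun z => ‖z‖⁻¹) y) volume x, integral_indicator measurableSet_ball, kerMass]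

/-- Three regions: within δ of x the values of f are bounded by C; between δ and ρ the kernel is at
most 1/δ; beyond ρ it is at most 1/ρ. -/
lemma pot_pointwise {f : ℝ × ℝ → ℝ} {C δ ρ : ℝ} (hC : ∀ x, |f x| ≤ C) (hδ : 0 < δ) (hρ : 0 < ρ)
    (x y : ℝ × ℝ) :
    ‖x - y‖⁻¹ * |f y| ≤ C * (Metric.ball x δ).indicator (fun y => ‖x - y‖⁻¹) y +
      δ⁻¹ * (Metric.ball x ρ).indicator (fun y => |f y|) y + ρ⁻¹ * |f y| := by
  have hC0 : 0 ≤ C := (abs_nonneg _).trans (hC x)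
  have h0 := abs_nonneg (f y)
  have hn : ‖y - x‖ = ‖x - y‖ := norm_sub_rev _ _
  have i1 : 0 ≤ (Metric.ball x δ).indicator (fun y => ‖x - y‖⁻¹) y :=
    Set.indicator_nonneg (fun _ _ => by positivity) _
  have i2 : 0 ≤ (Metric.ball x ρ).indicator (fun y => |f y|) y :=
    Set.indicator_nonneg (fun _ _ => by positivity) _
  by_cases h1 : y ∈ Metric.ball x δ
  · rw [Set.indicator_of_mem h1]
    have : ‖x - y‖⁻¹ * |f y| ≤ C * ‖x - y‖⁻¹ := by
      rw [mul_comm]; gcongr; exact hC y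
    have : 0 ≤ δ⁻¹ * (Metric.ball x ρ).indicator (fun y => |f y|) y := by positivity
    have : 0 ≤ ρ⁻¹ * |f y| := by positivity
    linarith
  have k1 : 0 ≤ C * (Metric.ball x δ).indicator (fun y => ‖x - y‖⁻¹) y := by positivity
  by_cases h2 : y ∈ Metric.ball x ρ
  · rw [Set.indicator_of_mem h2]
    rw [Metric.mem_ball, dist_eq_norm, hn, not_lt] at h1
    have : ‖x - y‖⁻¹ * |f y| ≤ δ⁻¹ * |f y| := by gcongr
    have : 0 ≤ ρ⁻¹ * |f y| := by positivity
    linarith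
  · rw [Metric.mem_ball, dist_eq_norm, hn, not_lt] at h2
    have : ‖x - y‖⁻¹ * |f y| ≤ ρ⁻¹ * |f y| := by gcongr
    have : 0 ≤ δ⁻¹ * (Metric.ball x ρ).indicator (fun y => |f y|) y := by positivity
    linarith

lemma integrable_pot {f : ℝ × ℝ → ℝ} {C : ℝ} (hm : Measurable f) (hC : ∀ x, |f x| ≤ C)
    (hf : Integrable f) (x : ℝ × ℝ) : Integrable (fun y => ‖x - y‖⁻¹ * |f y|) := by
  refine Integrable.mono' (((integrable_indicator_ball_inv x 1).const_mul C).add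
    ((hf.abs.indicator (measurableSet_ball (x := x) (ε := 1))).const_mul 1⁻¹) |>.add
      (hf.abs.const_mul 1⁻¹)) (by fun_prop) ?_
  refine Filter.Eventually.of_forall fun y => ?_
  rw [Real.norm_of_nonneg (by positivity)]
  exact pot_pointwise hC one_pos one_pos x y

lemma pot_le {f : ℝ × ℝ → ℝ} {C δ ρ : ℝ} (hm : Measurable f) (hC : ∀ x, |f x| ≤ C)
    (hf : Integrable f) (hδ : 0 < δ) (hρ : 0 < ρ) (x : ℝ × ℝ) :
    pot f x ≤ C * kerMass δ + δ⁻¹ * (∫ y in Metric.ball x ρ, |f y|) + ρ⁻¹ * ∫ y, |f y| := by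
  have i1 := (integrable_indicator_ball_inv x δ).const_mul C
  have i2 := (hf.abs.indicator (measurableSet_ball (x := x) (ε := ρ))).const_mul δ⁻¹
  have i3 := hf.abs.const_mul ρ⁻¹
  have h := integral_mono (integrable_pot hm hC hf x) ((i1.add i2).add i3)
    (fun y => pot_pointwise hC hδ hρ x y)
  refine h.trans (le_of_eq ?_)
  rw [integral_add' (i1.add i2) i3, integral_add' i1 i2, integral_const_mul, integral_const_mul,
    integral_const_mul, integral_indicator_ball_inv, integral_indicator measurableSet_ball]

lemma pot_nonneg (f : ℝ × ℝ → ℝ) (x : ℝ × ℝ) : 0 ≤ pot f x :=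
  integral_nonneg fun y => by positivity

/-- A uniform bound for the potential of functions bounded by `C` and of mass at most `m`. -/
lemma pot_le_const {f : ℝ × ℝ → ℝ} {C : ℝ} (hm : Measurable f) (hC : ∀ x, |f x| ≤ C)
    (hf : Integrable f) (x : ℝ × ℝ) : pot f x ≤ C * kerMass 1 + 2 * ∫ y, |f y| := by
  have := pot_le hm hC hf one_pos one_pos x
  have h2 : ∫ y in Metric.ball x 1, |f y| ≤ ∫ y, |f y| :=
    setIntegral_le_integral hf.abs (Filter.Eventually.of_forall fun y => abs_nonneg _)
  linarith

/-! ### The stream function and the energy as a bilinear form -/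

/-- Bounded integrable functions supported in the half plane with finite impulse. -/
structure Nice (f : ℝ × ℝ → ℝ) : Prop where
  meas : Measurable f
  bdd : ∃ C, ∀ x, |f x| ≤ C
  zero : ∀ x, x ∉ halfPlane → f x = 0
  int : Integrable f
  imp : Integrable fun x => x.2 * f x

namespace Nice

variable {f g : ℝ × ℝ → ℝ}

lemma add (hf : Nice f) (hg : Nice g) : Nice (fun x => f x + g x) where
  meas := hf.meas.add hg.meas
  bdd := by
    obtain ⟨C, hC⟩ := hf.bdd
    obtain ⟨D, hD⟩ := hg.bdd
    exact ⟨C + D, fun x => (abs_add_le _ _).trans (add_le_add (hC x) (hD x))⟩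
  zero x hx := by rw [hf.zero x hx, hg.zero x hx, add_zero]
  int := hf.int.add hg.int
  imp := by simp only [mul_add]; exact hf.imp.add hg.imp

lemma const_mul (c : ℝ) (hf : Nice f) : Nice (fun x => c * f x) where
  meas := hf.meas.const_mul c
  bdd := by
    obtain ⟨C, hC⟩ := hf.bdd
    exact ⟨|c| * C, fun x => by rw [abs_mul]; exact mul_le_mul_of_nonneg_left (hC x) (abs_nonneg _)⟩
  zero x hx := by rw [hf.zero x hx, mul_zero]
  int := hf.int.const_mul c
  imp := by
    have := hf.imp.const_mul c
    refine this.congr (Filter.Eventually.of_forall fun x => ?_)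
    simp only; ring

lemma sub (hf : Nice f) (hg : Nice g) : Nice (fun x => f x - g x) := by
  have := hf.add (hg.const_mul (-1))
  simpa [sub_eq_add_neg] using this

lemma mono (hf : Nice f) (hm : Measurable g) (h : ∀ x, |g x| ≤ |f x|) : Nice g where
  meas := hm
  bdd := by
    obtain ⟨C, hC⟩ := hf.bdd
    exact ⟨C, fun x => (h x).trans (hC x)⟩
  zero x hx := by
    have := h x
    rw [hf.zero x hx, abs_zero] at this
    exact abs_eq_zero.1 (le_antisymm this (abs_nonneg _))
  int := hf.int.mono hm.aestronglyMeasurable (Filter.Eventually.of_forall h)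
  imp := hf.imp.mono (by fun_prop) (Filter.Eventually.of_forall fun x => by
    simp only [norm_mul, Real.norm_eq_abs]
    exact mul_le_mul_of_nonneg_left (h x) (abs_nonneg _))

lemma indicator (hf : Nice f) {s : Set (ℝ × ℝ)} (hs : MeasurableSet s) : Nice (s.indicator f) :=
  hf.mono (hf.meas.indicator hs) fun x => by
    by_cases h : x ∈ s <;> simp [h]

lemma integrable_pot (hf : Nice f) (x : ℝ × ℝ) : Integrable (fun y => ‖x - y‖⁻¹ * |f y|) := by
  obtain ⟨C, hC⟩ := hf.bdd
  exact VortexPatch.integrable_pot hf.meas hC hf.int x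

lemma pot_bdd (hf : Nice f) : ∃ K, 0 ≤ K ∧ ∀ x, pot f x ≤ K := by
  obtain ⟨C, hC⟩ := hf.bdd
  have h := pot_le_const hf.meas hC hf.int
  exact ⟨_, (pot_nonneg f 0).trans (h 0), h⟩

lemma abs_green_mul_le (hf : Nice f) {x : ℝ × ℝ} (hx : x ∈ halfPlane) (y : ℝ × ℝ) :
    |green x y * f y| ≤ x.2 * (‖x - y‖⁻¹ * |f y|) := by
  by_cases hy : y ∈ halfPlane
  · rw [abs_mul, abs_of_nonneg (green_nonneg hx hy), ← mul_assoc]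
    exact mul_le_mul_of_nonneg_right (green_le hx hy) (abs_nonneg _)
  · simp [hf.zero y hy]

lemma measurable_green_mul (hf : Nice f) (x : ℝ × ℝ) : Measurable fun y => green x y * f y :=
  (measurable_green.comp (measurable_const.prodMk measurable_id)).mul hf.meas

lemma integrable_green (hf : Nice f) {x : ℝ × ℝ} (hx : x ∈ halfPlane) :
    Integrable (fun y => green x y * f y) :=
  ((hf.integrable_pot x).const_mul x.2).mono' (hf.measurable_green_mul x).aestronglyMeasurable
    (Filter.Eventually.of_forall fun y => hf.abs_green_mul_le hx y)

lemma stream_eq (hf : Nice f) (x : ℝ × ℝ) : stream f x = ∫ y, green x y * f y := by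
  unfold stream
  rw [setIntegral_eq_integral_of_forall_compl_eq_zero]
  intro y hy
  rw [hf.zero y hy, mul_zero]

lemma abs_stream_le (hf : Nice f) {x : ℝ × ℝ} (hx : x ∈ halfPlane) :
    |stream f x| ≤ x.2 * pot f x := by
  rw [hf.stream_eq, pot, ← integral_const_mul]
  exact norm_integral_le_of_norm_le (f := fun y => green x y * f y)
    ((hf.integrable_pot x).const_mul x.2)
    (Filter.Eventually.of_forall fun y => hf.abs_green_mul_le hx y)

lemma measurable_stream (hf : Nice f) : Measurable (stream f) := by
  have : stream f = fun x => ∫ y, green x y * f y := by ext x; exact hf.stream_eq x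
  rw [this]
  exact (StronglyMeasurable.integral_prod_right' (ν := (volume : Measure (ℝ × ℝ)))
    (f := fun p : (ℝ × ℝ) × (ℝ × ℝ) => green p.1 p.2 * f p.2)
    (measurable_green.mul (hf.meas.comp measurable_snd)).stronglyMeasurable).measurable

lemma abs_stream_sub_le (hf : Nice f) {x x' : ℝ × ℝ} (hx : x ∈ halfPlane) (hx' : x' ∈ halfPlane) :
    |stream f x - stream f x'| ≤ ‖x - x'‖ * (pot f x + pot f x') := by
  rw [hf.stream_eq, hf.stream_eq, ← integral_sub (hf.integrable_green hx) (hf.integrable_green hx'),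
    pot, pot, ← integral_add (hf.integrable_pot x) (hf.integrable_pot x'), ← integral_const_mul]
  refine norm_integral_le_of_norm_le (f := fun y => green x y * f y - green x' y * f y)
    (((hf.integrable_pot x).add (hf.integrable_pot x')).const_mul ‖x - x'‖) ?_
  -- On the diagonal `green` has a default value, so the kernel estimate is used only off the two
  -- points x and x'.
  have h1 : ∀ᵐ y : ℝ × ℝ, y ≠ x := by simp [ae_iff]
  have h2 : ∀ᵐ y : ℝ × ℝ, y ≠ x' := by simp [ae_iff]
  filter_upwards [h1, h2] with y h1 h2
  by_cases hy : y ∈ halfPlane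
  · rw [← sub_mul, Real.norm_eq_abs, abs_mul, ← add_mul, ← mul_assoc]
    exact mul_le_mul_of_nonneg_right (abs_green_sub_le hx hx' hy h1.symm h2.symm) (abs_nonneg _)
  · simp [hf.zero y hy]

lemma continuousOn_stream (hf : Nice f) : ContinuousOn (stream f) halfPlane := by
  obtain ⟨K, hK0, hK⟩ := hf.pot_bdd
  have : LipschitzOnWith (Real.toNNReal (2 * K)) (stream f) halfPlane := by
    apply LipschitzOnWith.of_dist_le_mul
    intro x hx y hy
    rw [Real.dist_eq, dist_eq_norm, Real.coe_toNNReal _ (by positivity), mul_comm]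
    refine (hf.abs_stream_sub_le hx hy).trans ?_
    gcongr
    linarith [hK x, hK y]
  exact this.continuousOn

lemma measurable_prod (hf : Nice f) (hg : Nice g) :
    Measurable fun p : (ℝ × ℝ) × (ℝ × ℝ) => green p.1 p.2 * (f p.1 * g p.2) :=
  measurable_green.mul ((hf.meas.comp measurable_fst).mul (hg.meas.comp measurable_snd))

/-- There is no weight x₂ here. This is the dominating function for the upward shifts below. -/
lemma integrable_prod_pot (hf : Nice f) (hg : Nice g) :
    Integrable fun p : (ℝ × ℝ) × (ℝ × ℝ) => |f p.1| * (‖p.1 - p.2‖⁻¹ * |g p.2|) := by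
  have hm : Measurable fun p : (ℝ × ℝ) × (ℝ × ℝ) => |f p.1| * (‖p.1 - p.2‖⁻¹ * |g p.2|) := by
    have := hf.meas
    have := hg.meas
    fun_prop
  rw [Measure.volume_eq_prod, integrable_prod_iff hm.aestronglyMeasurable]
  refine ⟨Filter.Eventually.of_forall fun x => (hg.integrable_pot x).const_mul (|f x|), ?_⟩
  obtain ⟨K, hK0, hK⟩ := hg.pot_bdd
  refine (hf.int.abs.mul_const K).mono' ?_ ?_
  · exact (StronglyMeasurable.integral_prod_right'
      (f := fun p : (ℝ × ℝ) × (ℝ × ℝ) => ‖|f p.1| * (‖p.1 - p.2‖⁻¹ * |g p.2|)‖)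
      hm.norm.stronglyMeasurable).aestronglyMeasurable
  · refine Filter.Eventually.of_forall fun x => ?_
    rw [Real.norm_of_nonneg (integral_nonneg fun y => norm_nonneg _)]
    have : ∀ y, ‖|f x| * (‖x - y‖⁻¹ * |g y|)‖ = |f x| * (‖x - y‖⁻¹ * |g y|) := fun y =>
      Real.norm_of_nonneg (by positivity)
    simp only [this]
    rw [integral_const_mul]
    exact mul_le_mul_of_nonneg_left (hK x) (abs_nonneg _)

/-- The weight `x₂ f` is integrable, which dominates the kernel. -/
lemma integrable_prod (hf : Nice f) (hg : Nice g) :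
    Integrable fun p : (ℝ × ℝ) × (ℝ × ℝ) => green p.1 p.2 * (f p.1 * g p.2) := by
  rw [Measure.volume_eq_prod, integrable_prod_iff (hf.measurable_prod hg).aestronglyMeasurable]
  constructor
  · refine Filter.Eventually.of_forall fun x => ?_
    by_cases hx : x ∈ halfPlane
    · refine ((hg.integrable_green hx).const_mul (f x)).congr (Filter.Eventually.of_forall fun y => ?_)
      simp only; ring
    · simp [hf.zero x hx]
  obtain ⟨K, hK0, hK⟩ := hg.pot_bdd
  refine (hf.imp.abs.mul_const K).mono' ?_ ?_
  · exact (StronglyMeasurable.integral_prod_right'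
      (f := fun p : (ℝ × ℝ) × (ℝ × ℝ) => ‖green p.1 p.2 * (f p.1 * g p.2)‖)
      (hf.measurable_prod hg).norm.stronglyMeasurable).aestronglyMeasurable
  · refine Filter.Eventually.of_forall fun x => ?_
    rw [Real.norm_of_nonneg (integral_nonneg fun y => norm_nonneg _)]
    by_cases hx : x ∈ halfPlane
    · have hx0 : 0 < x.2 := hx
      calc ∫ y, ‖green x y * (f x * g y)‖ ≤ ∫ y, |f x| * (x.2 * (‖x - y‖⁻¹ * |g y|)) := by
            apply integral_mono_of_nonneg (Filter.Eventually.of_forall fun y => norm_nonneg _)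
              (((hg.integrable_pot x).const_mul _).const_mul _)
            refine Filter.Eventually.of_forall fun y => ?_
            simp only
            rw [show green x y * (f x * g y) = f x * (green x y * g y) by ring, norm_mul]
            exact mul_le_mul_of_nonneg_left (hg.abs_green_mul_le hx y) (abs_nonneg _)
        _ = |x.2 * f x| * pot g x := by
            rw [integral_const_mul, integral_const_mul, abs_mul, abs_of_pos hx0, pot]; ring
        _ ≤ _ := mul_le_mul_of_nonneg_left (hK x) (abs_nonneg _)
    · simp [hf.zero x hx]

end Nice

/-- The symmetric bilinear form of the energy. -/
def pairing (f g : ℝ × ℝ → ℝ) : ℝ :=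
  ∫ p : (ℝ × ℝ) × (ℝ × ℝ), green p.1 p.2 * (f p.1 * g p.2)

section

variable {f g h : ℝ × ℝ → ℝ}

lemma pairing_comm (f g : ℝ × ℝ → ℝ) : pairing f g = pairing g f := by
  unfold pairing
  rw [Measure.volume_eq_prod, ← integral_prod_swap]
  congr 1
  ext p
  simp only [Prod.fst_swap, Prod.snd_swap]
  rw [green_comm]; ring

lemma pairing_add_left (hf : Nice f) (hg : Nice g) (hh : Nice h) :
    pairing (fun x => f x + g x) h = pairing f h + pairing g h := by
  unfold pairing
  rw [← integral_add (hf.integrable_prod hh) (hg.integrable_prod hh)]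
  congr 1; ext p; ring

lemma pairing_const_mul_left (c : ℝ) (f g : ℝ × ℝ → ℝ) :
    pairing (fun x => c * f x) g = c * pairing f g := by
  unfold pairing
  rw [← integral_const_mul]
  congr 1; ext p; ring

lemma pairing_add_right (hf : Nice f) (hg : Nice g) (hh : Nice h) :
    pairing h (fun x => f x + g x) = pairing h f + pairing h g := by
  rw [pairing_comm, pairing_add_left hf hg hh, pairing_comm f, pairing_comm g]

lemma pairing_const_mul_right (c : ℝ) (f g : ℝ × ℝ → ℝ) :
    pairing f (fun x => c * g x) = c * pairing f g := by
  rw [pairing_comm, pairing_const_mul_left, pairing_comm]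

lemma pairing_eq_integral (hf : Nice f) (hg : Nice g) :
    pairing f g = ∫ x, stream g x * f x := by
  unfold pairing
  rw [Measure.volume_eq_prod, integral_prod _ (hf.integrable_prod hg)]
  congr 1; ext x
  rw [hg.stream_eq, ← integral_mul_const]
  congr 1; ext y; ring

lemma Nice.integrable_stream_mul (hf : Nice f) (hg : Nice g) :
    Integrable (fun x => stream g x * f x) := by
  have := (hf.integrable_prod hg).integral_prod_left
  refine this.congr (Filter.Eventually.of_forall fun x => ?_)
  simp only
  rw [hg.stream_eq, ← integral_mul_const]
  congr 1; ext y; ring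

lemma energy_eq (hf : Nice f) : energy f = 1 / 2 * pairing f f := by
  unfold energy
  rw [pairing_eq_integral hf hf, setIntegral_eq_integral_of_forall_compl_eq_zero]
  intro y hy
  rw [hf.zero y hy, mul_zero]

lemma green_mul_nonneg (hf : Nice f) (hg : Nice g) (hf0 : ∀ x, 0 ≤ f x) (hg0 : ∀ x, 0 ≤ g x)
    (x y : ℝ × ℝ) : 0 ≤ green x y * (f x * g y) := by
  by_cases hx : x ∈ halfPlane
  · by_cases hy : y ∈ halfPlane
    · exact mul_nonneg (green_nonneg hx hy) (mul_nonneg (hf0 x) (hg0 y))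
    · simp [hg.zero y hy]
  · simp [hf.zero x hx]

lemma pairing_nonneg (hf : Nice f) (hg : Nice g) (hf0 : ∀ x, 0 ≤ f x) (hg0 : ∀ x, 0 ≤ g x) :
    0 ≤ pairing f g :=
  integral_nonneg fun p => green_mul_nonneg hf hg hf0 hg0 p.1 p.2

end

/-! ### The relaxed variational problem -/

/-- The relaxed admissible class: functions with values in `[0, 1]` supported in `S`, of mass at
most `1` and impulse at most `M`. -/
structure Relaxed (S : Set (ℝ × ℝ)) (M : ℝ) (ω : ℝ × ℝ → ℝ) : Prop where
  meas : Measurable ω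
  nonneg : ∀ x, 0 ≤ ω x
  le_one : ∀ x, ω x ≤ 1
  zero : ∀ x, x ∉ S → ω x = 0
  int : Integrable ω
  mass_le : ∫ x, ω x ≤ 1
  imp : Integrable fun x => x.2 * ω x
  imp_le : ∫ x, x.2 * ω x ≤ M

lemma Relaxed.mono {S T : Set (ℝ × ℝ)} {M : ℝ} {ω : ℝ × ℝ → ℝ} (h : Relaxed S M ω) (hST : S ⊆ T) :
    Relaxed T M ω :=
  { h with zero := fun x hx => h.zero x fun h' => hx (hST h') }

lemma Relaxed.abs_le_one {S : Set (ℝ × ℝ)} {M : ℝ} {ω : ℝ × ℝ → ℝ} (h : Relaxed S M ω) (x : ℝ × ℝ) :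
    |ω x| ≤ 1 := by
  rw [abs_of_nonneg (h.nonneg x)]; exact h.le_one x

lemma Relaxed.nice {S : Set (ℝ × ℝ)} {M : ℝ} {ω : ℝ × ℝ → ℝ} (h : Relaxed S M ω)
    (hS : S ⊆ halfPlane) : Nice ω where
  meas := h.meas
  bdd := ⟨1, h.abs_le_one⟩
  zero x hx := h.zero x fun h' => hx (hS h')
  int := h.int
  imp := h.imp

lemma Relaxed.pot_le {S : Set (ℝ × ℝ)} {M : ℝ} {ω : ℝ × ℝ → ℝ} (h : Relaxed S M ω) (x : ℝ × ℝ) :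
    pot ω x ≤ kerMass 1 + 2 := by
  have := pot_le_const h.meas h.abs_le_one h.int x
  have e : ∫ y, |ω y| = ∫ y, ω y := by congr 1; ext y; exact abs_of_nonneg (h.nonneg y)
  rw [e] at this
  linarith [h.mass_le]

lemma Relaxed.pot_le_of_ball {S : Set (ℝ × ℝ)} {M : ℝ} {ω : ℝ × ℝ → ℝ} (h : Relaxed S M ω)
    {δ ρ : ℝ} (hδ : 0 < δ) (hρ : 0 < ρ) (x : ℝ × ℝ) :
    pot ω x ≤ kerMass δ + δ⁻¹ * (∫ y in Metric.ball x ρ, ω y) + ρ⁻¹ := by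
  have := VortexPatch.pot_le h.meas h.abs_le_one h.int hδ hρ x
  have e : ∀ y, |ω y| = ω y := fun y => abs_of_nonneg (h.nonneg y)
  simp only [e, one_mul] at this
  have h2 : ρ⁻¹ * ∫ y, ω y ≤ ρ⁻¹ * 1 := by have := h.mass_le; gcongr
  linarith

lemma Relaxed.imp_nonneg {S : Set (ℝ × ℝ)} {M : ℝ} {ω : ℝ × ℝ → ℝ} (h : Relaxed S M ω)
    (hS : S ⊆ halfPlane) (x : ℝ × ℝ) : 0 ≤ x.2 * ω x := by
  by_cases hx : x ∈ S
  · exact mul_nonneg (le_of_lt (hS hx)) (h.nonneg x)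
  · rw [h.zero x hx, mul_zero]

/-- The stream function is at most x₂ times a potential bounded by `kerMass 1 + 2`; integrating
against ω leaves the impulse. -/
lemma Relaxed.energy_le {S : Set (ℝ × ℝ)} {M : ℝ} {ω : ℝ × ℝ → ℝ} (h : Relaxed S M ω)
    (hS : S ⊆ halfPlane) : pairing ω ω ≤ (kerMass 1 + 2) * M := by
  have hn := h.nice hS
  rw [pairing_eq_integral hn hn]
  have hk : 0 ≤ kerMass 1 + 2 := by linarith [kerMass_nonneg 1]
  calc ∫ x, stream ω x * ω x ≤ ∫ x, (kerMass 1 + 2) * (x.2 * ω x) := by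
        apply integral_mono (hn.integrable_stream_mul hn) (h.imp.const_mul _)
        intro x
        by_cases hx : x ∈ halfPlane
        · have := (le_abs_self _).trans (hn.abs_stream_le hx)
          have hx0 : 0 < x.2 := hx
          simp only
          rw [← mul_assoc]
          refine mul_le_mul_of_nonneg_right (this.trans ?_) (h.nonneg x)
          rw [mul_comm]
          exact mul_le_mul_of_nonneg_right (h.pot_le x) hx0.le
        · simp [hn.zero x hx]
    _ = (kerMass 1 + 2) * ∫ x, x.2 * ω x := integral_const_mul _ _
    _ ≤ _ := mul_le_mul_of_nonneg_left h.imp_le hk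

/-! ### Reflection and polarization across vertical lines -/

/-- Reflection across the vertical line `x₁ = l`. -/
def refl (l : ℝ) (x : ℝ × ℝ) : ℝ × ℝ := (2 * l - x.1, x.2)

@[simp] lemma refl_fst (l : ℝ) (x : ℝ × ℝ) : (refl l x).1 = 2 * l - x.1 := rfl
@[simp] lemma refl_snd (l : ℝ) (x : ℝ × ℝ) : (refl l x).2 = x.2 := rfl

@[simp] lemma refl_refl (l : ℝ) (x : ℝ × ℝ) : refl l (refl l x) = x := by
  ext <;> simp

lemma refl_eq_self {l : ℝ} {x : ℝ × ℝ} (h : x.1 = l) : refl l x = x := by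
  ext <;> simp; linarith

@[fun_prop] lemma measurable_refl (l : ℝ) : Measurable (refl l) := by unfold refl; fun_prop

@[simp] lemma refl_mem_halfPlane {l : ℝ} {x : ℝ × ℝ} : refl l x ∈ halfPlane ↔ x ∈ halfPlane := Iff.rfl

/-- The reflection as a measurable equivalence. -/
def reflEquiv (l : ℝ) : (ℝ × ℝ) ≃ᵐ (ℝ × ℝ) where
  toFun := refl l
  invFun := refl l
  left_inv := refl_refl l
  right_inv := refl_refl l
  measurable_toFun := measurable_refl l
  measurable_invFun := measurable_refl l

lemma measurePreserving_refl (l : ℝ) : MeasurePreserving (refl l) := by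
  have := (Measure.measurePreserving_sub_left (volume : Measure ℝ) (2 * l)).prod
    (MeasurePreserving.id (volume : Measure ℝ))
  exact this

lemma measurableEmbedding_refl (l : ℝ) : MeasurableEmbedding (refl l) :=
  (reflEquiv l).measurableEmbedding

lemma integral_refl (l : ℝ) (f : ℝ × ℝ → ℝ) : ∫ x, f (refl l x) = ∫ x, f x :=
  (measurePreserving_refl l).integral_comp (measurableEmbedding_refl l) f

lemma integral_snd_mul_refl (l : ℝ) (f : ℝ × ℝ → ℝ) :
    ∫ x, x.2 * f (refl l x) = ∫ x, x.2 * f x := integral_refl l fun x => x.2 * f x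

lemma integrable_refl {l : ℝ} {f : ℝ × ℝ → ℝ} (h : Integrable f) :
    Integrable (fun x => f (refl l x)) :=
  (measurePreserving_refl l).integrable_comp_of_integrable h

lemma integral_refl_snd (l : ℝ) (F : (ℝ × ℝ) × (ℝ × ℝ) → ℝ) :
    ∫ p : (ℝ × ℝ) × (ℝ × ℝ), F (p.1, refl l p.2) = ∫ p, F p := by
  have h := (MeasurePreserving.id (volume : Measure (ℝ × ℝ))).prod (measurePreserving_refl l)
  exact h.integral_comp ((MeasurableEquiv.refl _).prodCongr (reflEquiv l)).measurableEmbedding F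

lemma integrable_refl_snd {l : ℝ} {F : (ℝ × ℝ) × (ℝ × ℝ) → ℝ} (hF : Integrable F) :
    Integrable fun p : (ℝ × ℝ) × (ℝ × ℝ) => F (p.1, refl l p.2) := by
  have h := (MeasurePreserving.id (volume : Measure (ℝ × ℝ))).prod (measurePreserving_refl l)
  exact h.integrable_comp_of_integrable hF

lemma integral_refl_prod (l : ℝ) (F : (ℝ × ℝ) × (ℝ × ℝ) → ℝ) :
    ∫ p : (ℝ × ℝ) × (ℝ × ℝ), F (refl l p.1, refl l p.2) = ∫ p, F p := by
  have h := (measurePreserving_refl l).prod (measurePreserving_refl l)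
  exact h.integral_comp ((reflEquiv l).prodCongr (reflEquiv l)).measurableEmbedding F

lemma green_refl_refl (l : ℝ) (x y : ℝ × ℝ) : green (refl l x) (refl l y) = green x y := by
  simp only [green, refl]; congr 5; ring

lemma distSq_refl (l : ℝ) (x y : ℝ × ℝ) :
    distSq x (refl l y) = distSq x y + 4 * ((x.1 - l) * (y.1 - l)) := by
  simp only [distSq, refl]; ring

lemma green_lt_green {x y y' : ℝ × ℝ} (hx : x ∈ halfPlane) (hy : y ∈ halfPlane) (h2 : y'.2 = y.2)
    (h : x ≠ y) (hd : distSq x y < distSq x y') : green x y' < green x y := by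
  have hx : 0 < x.2 := hx
  have hy : 0 < y.2 := hy
  have h0 := distSq_pos h
  have h1 : 0 < distSq x y' := h0.trans hd
  rw [green_def, green_def, h2]
  have hp : 0 < 1 / (4 * Real.pi) := by positivity
  apply mul_lt_mul_of_pos_left _ hp
  apply Real.log_lt_log (by positivity)
  gcongr

lemma green_refl_lt {l : ℝ} {x y : ℝ × ℝ} (hx : x ∈ halfPlane) (hy : y ∈ halfPlane) (h : x ≠ y)
    (hs : 0 < (x.1 - l) * (y.1 - l)) : green x (refl l y) < green x y := by
  refine green_lt_green hx hy (refl_snd l y) h ?_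
  rw [distSq_refl]; linarith

lemma lt_green_refl {l : ℝ} {x y : ℝ × ℝ} (hx : x ∈ halfPlane) (hy : y ∈ halfPlane)
    (h : x ≠ refl l y) (hs : (x.1 - l) * (y.1 - l) < 0) : green x y < green x (refl l y) := by
  refine green_lt_green hx (refl_mem_halfPlane.2 hy) (refl_snd l y).symm h ?_
  rw [distSq_refl]; linarith

lemma Nice.refl {f : ℝ × ℝ → ℝ} (hf : Nice f) (l : ℝ) : Nice (fun x => f (refl l x)) where
  meas := hf.meas.comp (measurable_refl l)
  bdd := by obtain ⟨C, hC⟩ := hf.bdd; exact ⟨C, fun x => hC _⟩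
  zero x hx := hf.zero _ hx
  int := integrable_refl hf.int
  imp := integrable_refl (f := fun x => x.2 * f x) hf.imp

lemma pairing_refl (l : ℝ) (f g : ℝ × ℝ → ℝ) :
    pairing (fun x => f (refl l x)) (fun x => g (refl l x)) = pairing f g := by
  unfold pairing
  rw [← integral_refl_prod l (fun p => green p.1 p.2 * (f p.1 * g p.2))]
  simp only [green_refl_refl]

lemma pairing_even_odd {l : ℝ} {v u : ℝ × ℝ → ℝ} (hv : ∀ x, v (refl l x) = v x)
    (hu : ∀ x, u (refl l x) = -u x) : pairing v u = 0 := by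
  have h := pairing_refl l v u
  have h1 : (fun x => v (refl l x)) = v := funext hv
  have h2 : (fun x => u (refl l x)) = fun x => (-1) * u x := by ext x; rw [hu]; ring
  rw [h1, h2, pairing_const_mul_right] at h
  linarith

/-- Polarization across `x₁ = l`, moving the larger values to the right. -/
def polar (l : ℝ) (ω : ℝ × ℝ → ℝ) (x : ℝ × ℝ) : ℝ :=
  if l < x.1 then max (ω x) (ω (refl l x)) else min (ω x) (ω (refl l x))

/-- The side of the line `x₁ = l`. -/
def side (l : ℝ) (x : ℝ × ℝ) : ℝ := if l < x.1 then 1 else -1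

lemma measurable_side (l : ℝ) : Measurable (side l) :=
  Measurable.ite (measurableSet_lt measurable_const measurable_fst) measurable_const measurable_const

lemma side_mul_self (l : ℝ) (x : ℝ × ℝ) : side l x * side l x = 1 := by
  unfold side; split_ifs <;> norm_num

lemma abs_side (l : ℝ) (x : ℝ × ℝ) : |side l x| = 1 := by
  unfold side; split_ifs <;> norm_num

lemma side_refl {l : ℝ} {x : ℝ × ℝ} (h : x.1 ≠ l) : side l (refl l x) = -side l x := by
  unfold side
  rcases lt_or_gt_of_ne h with h | h
  · rw [if_pos (by simp; linarith), if_neg (by linarith)]; norm_num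
  · rw [if_neg (by simp; linarith), if_pos h]

/-- The odd part (doubled) of `ω` with respect to the reflection. -/
def asym (l : ℝ) (ω : ℝ × ℝ → ℝ) (x : ℝ × ℝ) : ℝ := ω x - ω (refl l x)

/-- The even part (doubled) of `ω` with respect to the reflection. -/
def symm (l : ℝ) (ω : ℝ × ℝ → ℝ) (x : ℝ × ℝ) : ℝ := ω x + ω (refl l x)

/-- The odd part (doubled) of the polarization of `ω`. -/
def polAsym (l : ℝ) (ω : ℝ × ℝ → ℝ) (x : ℝ × ℝ) : ℝ := side l x * |asym l ω x|

section

variable {l : ℝ} {ω : ℝ × ℝ → ℝ}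

lemma asym_refl (x : ℝ × ℝ) : asym l ω (refl l x) = -asym l ω x := by simp [asym]

lemma symm_refl (x : ℝ × ℝ) : symm l ω (refl l x) = symm l ω x := by simp [symm, add_comm]

lemma asym_eq_zero {x : ℝ × ℝ} (h : x.1 = l) : asym l ω x = 0 := by
  rw [asym, refl_eq_self h, sub_self]

lemma polAsym_refl (x : ℝ × ℝ) : polAsym l ω (refl l x) = -polAsym l ω x := by
  unfold polAsym
  by_cases h : x.1 = l
  · rw [refl_eq_self h, asym_eq_zero h]; simp
  · rw [side_refl h, asym_refl, abs_neg]; ring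

lemma polar_eq (x : ℝ × ℝ) : polar l ω x = 1 / 2 * (symm l ω x + polAsym l ω x) := by
  unfold polar polAsym side symm asym
  split_ifs with h
  · rw [max_def]
    split_ifs with h2
    · rw [abs_of_nonpos (by linarith)]; ring
    · rw [abs_of_nonneg (by linarith)]; ring
  · rw [min_def]
    split_ifs with h2
    · rw [abs_of_nonpos (by linarith)]; ring
    · rw [abs_of_nonneg (by linarith)]; ring

lemma self_eq_symm_add_asym (x : ℝ × ℝ) : ω x = 1 / 2 * (symm l ω x + asym l ω x) := by
  unfold symm asym; ring

lemma Nice.asym (h : Nice ω) (l : ℝ) : Nice (asym l ω) := h.sub (h.refl l)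

lemma Nice.symm (h : Nice ω) (l : ℝ) : Nice (symm l ω) := h.add (h.refl l)

lemma Nice.polAsym (h : Nice ω) (l : ℝ) : Nice (polAsym l ω) :=
  (h.asym l).mono ((measurable_side l).mul (h.asym l).meas.abs) fun x => by
    rw [VortexPatch.polAsym, abs_mul, abs_side, one_mul, abs_abs]

lemma Nice.polar (h : Nice ω) (l : ℝ) : Nice (polar l ω) := by
  have : VortexPatch.polar l ω = fun x => 1 / 2 * (VortexPatch.symm l ω x + VortexPatch.polAsym l ω x) :=
    funext polar_eq
  rw [this]
  exact ((h.symm l).add (h.polAsym l)).const_mul _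

lemma integral_odd {f : ℝ × ℝ → ℝ} (hf : ∀ x, f (refl l x) = -f x) : ∫ x, f x = 0 := by
  have := integral_refl l f
  simp only [hf, integral_neg] at this
  linarith

lemma integral_polar (h : Nice ω) : ∫ x, polar l ω x = ∫ x, ω x := by
  simp only [polar_eq]
  rw [integral_const_mul, integral_add (h.symm l).int (h.polAsym l).int,
    integral_odd (l := l) polAsym_refl]
  simp only [symm]
  rw [integral_add h.int (integrable_refl h.int), integral_refl]; ring

lemma integral_snd_mul_polar (h : Nice ω) : ∫ x, x.2 * polar l ω x = ∫ x, x.2 * ω x := by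
  have e : ∀ x, x.2 * polar l ω x = 1 / 2 * (x.2 * symm l ω x + x.2 * polAsym l ω x) := by
    intro x; rw [polar_eq]; ring
  simp only [e]
  rw [integral_const_mul, integral_add (h.symm l).imp (h.polAsym l).imp,
    integral_odd (l := l) (f := fun x => x.2 * polAsym l ω x) (fun x => by simp [polAsym_refl])]
  simp only [symm, mul_add]
  rw [integral_add h.imp (h.refl l).imp, integral_snd_mul_refl]; ring

lemma pairing_half_add {v u : ℝ × ℝ → ℝ} (hv : Nice v) (hu : Nice u)
    (hv' : ∀ x, v (refl l x) = v x) (hu' : ∀ x, u (refl l x) = -u x) :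
    pairing (fun x => 1 / 2 * (v x + u x)) (fun x => 1 / 2 * (v x + u x)) =
      1 / 4 * (pairing v v + pairing u u) := by
  rw [pairing_const_mul_left, pairing_const_mul_right, pairing_add_left hv hu (hv.add hu),
    pairing_add_right hv hu hv, pairing_add_right hv hu hu, pairing_comm u v,
    pairing_even_odd hv' hu']
  ring

/-- Polarization keeps the even part and replaces the odd part `asym` by `polAsym`; even and odd
parts are orthogonal for the energy form, so only the odd parts contribute. -/
lemma pairing_polar_sub (h : Nice ω) :
    pairing (polar l ω) (polar l ω) - pairing ω ω =
      1 / 4 * (pairing (polAsym l ω) (polAsym l ω) - pairing (asym l ω) (asym l ω)) := by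
  have h1 := pairing_half_add (h.symm l) (h.polAsym l) symm_refl polAsym_refl
  have h2 := pairing_half_add (h.symm l) (h.asym l) symm_refl asym_refl
  rw [← (funext polar_eq : polar l ω = _)] at h1
  rw [← (funext self_eq_symm_add_asym : ω = _)] at h2
  rw [h1, h2]; ring

/-- The integrand of the energy gain under polarization. -/
def polGain (l : ℝ) (ω : ℝ × ℝ → ℝ) (p : (ℝ × ℝ) × (ℝ × ℝ)) : ℝ :=
  polAsym l ω p.1 * polAsym l ω p.2 - asym l ω p.1 * asym l ω p.2

lemma integrable_green_polGain (h : Nice ω) :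
    Integrable fun p : (ℝ × ℝ) × (ℝ × ℝ) => green p.1 p.2 * polGain l ω p := by
  simp only [polGain, mul_sub]
  exact ((h.polAsym l).integrable_prod (h.polAsym l)).sub ((h.asym l).integrable_prod (h.asym l))

lemma polGain_refl (p : (ℝ × ℝ) × (ℝ × ℝ)) : polGain l ω (p.1, refl l p.2) = -polGain l ω p := by
  simp only [polGain, polAsym_refl, asym_refl]; ring

lemma integrable_green_refl_polGain (h : Nice ω) :
    Integrable fun p : (ℝ × ℝ) × (ℝ × ℝ) => green p.1 (refl l p.2) * polGain l ω p := by
  have := (integrable_refl_snd (l := l) (integrable_green_polGain (l := l) h)).neg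
  refine this.congr (Filter.Eventually.of_forall fun p => ?_)
  simp [polGain_refl]

/-- `polGain` is odd under reflection of the second point, so averaging with the reflected integral
replaces G(x,y) by the difference G(x,y) - G(x,Ry), whose sign is known from the sides of x and y.
-/
lemma pairing_polAsym_sub (h : Nice ω) :
    pairing (polAsym l ω) (polAsym l ω) - pairing (asym l ω) (asym l ω) =
      1 / 2 * ∫ p : (ℝ × ℝ) × (ℝ × ℝ), (green p.1 p.2 - green p.1 (refl l p.2)) * polGain l ω p := by
  have h1 : pairing (polAsym l ω) (polAsym l ω) - pairing (asym l ω) (asym l ω) =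
      ∫ p : (ℝ × ℝ) × (ℝ × ℝ), green p.1 p.2 * polGain l ω p := by
    unfold pairing
    rw [← integral_sub ((h.polAsym l).integrable_prod (h.polAsym l))
      ((h.asym l).integrable_prod (h.asym l))]
    congr 1; ext p; simp only [polGain]; ring
  have h2 := integral_refl_snd l (fun p => green p.1 p.2 * polGain l ω p)
  simp only [polGain_refl, mul_neg, integral_neg] at h2
  simp only [sub_mul]
  rw [integral_sub (integrable_green_polGain h) (integrable_green_refl_polGain h), h1]
  linarith

lemma polGain_same {x y : ℝ × ℝ} (hs : 0 < (x.1 - l) * (y.1 - l)) :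
    polGain l ω (x, y) = |asym l ω x| * |asym l ω y| - asym l ω x * asym l ω y := by
  have : side l x * side l y = 1 := by
    unfold side
    rcases pos_and_pos_or_neg_and_neg_of_mul_pos hs with ⟨h1, h2⟩ | ⟨h1, h2⟩
    · rw [if_pos (by linarith), if_pos (by linarith)]; norm_num
    · rw [if_neg (by linarith), if_neg (by linarith)]; norm_num
  simp only [polGain, polAsym]
  linear_combination (|asym l ω x| * |asym l ω y|) * this

lemma polGain_opp {x y : ℝ × ℝ} (hs : (x.1 - l) * (y.1 - l) < 0) :
    polGain l ω (x, y) = -(|asym l ω x| * |asym l ω y|) - asym l ω x * asym l ω y := by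
  have : side l x * side l y = -1 := by
    unfold side
    rcases mul_neg_iff.1 hs with ⟨h1, h2⟩ | ⟨h1, h2⟩
    · rw [if_pos (by linarith), if_neg (by linarith)]; norm_num
    · rw [if_neg (by linarith), if_pos (by linarith)]; norm_num
  simp only [polGain, polAsym]
  linear_combination (|asym l ω x| * |asym l ω y|) * this

lemma polGain_zero {x y : ℝ × ℝ} (hs : (x.1 - l) * (y.1 - l) = 0) : polGain l ω (x, y) = 0 := by
  simp only [polGain, polAsym]
  rcases mul_eq_zero.1 hs with h | h
  · rw [asym_eq_zero (x := x) (by linarith)]; simp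
  · rw [asym_eq_zero (x := y) (by linarith)]; simp

/-- For points on the same side, G(x,y) > G(x,Ry) and the gain is |a||b| - ab ≥ 0, where a and b are
the values of `asym`. On opposite sides both signs are reversed. At x = y or x = Ry the kernel has a
default value, but there the gain itself vanishes. -/
lemma polGain_cases (h : Nice ω) (x y : ℝ × ℝ) :
    polGain l ω (x, y) = 0 ∨
      0 < (green x y - green x (refl l y)) * polGain l ω (x, y) := by
  by_cases hx : x ∈ halfPlane; swap
  · left; simp [polGain, polAsym, (h.asym l).zero x hx]
  by_cases hy : y ∈ halfPlane; swap
  · left; simp [polGain, polAsym, (h.asym l).zero y hy]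
  have key := abs_mul (asym l ω x) (asym l ω y)
  rcases lt_trichotomy ((x.1 - l) * (y.1 - l)) 0 with hs | hs | hs
  · by_cases hxy : x = refl l y
    · left
      rw [polGain_opp hs, hxy, asym_refl, abs_neg, abs_mul_abs_self]; ring
    have h1 := lt_green_refl hx hy hxy hs
    have h2 := neg_abs_le (asym l ω x * asym l ω y)
    rw [polGain_opp hs]
    rcases eq_or_lt_of_le h2 with h3 | h3
    · left; linarith
    · right; apply mul_pos_of_neg_of_neg <;> linarith
  · left; exact polGain_zero hs
  · by_cases hxy : x = y
    · left
      rw [polGain_same hs, hxy, abs_mul_abs_self, sub_self]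
    have h1 := green_refl_lt hx hy hxy hs
    have h2 := le_abs_self (asym l ω x * asym l ω y)
    rw [polGain_same hs]
    rcases eq_or_lt_of_le h2 with h3 | h3
    · left; linarith
    · right; apply mul_pos <;> linarith

/-- `ω` is heavier to the right of the line `x₁ = l`. -/
def HeavyRight (l : ℝ) (ω : ℝ × ℝ → ℝ) : Prop := ∀ᵐ x : ℝ × ℝ, l < x.1 → ω (refl l x) ≤ ω x

/-- `ω` is heavier to the left of the line `x₁ = l`. -/
def HeavyLeft (l : ℝ) (ω : ℝ × ℝ → ℝ) : Prop := ∀ᵐ x : ℝ × ℝ, l < x.1 → ω x ≤ ω (refl l x)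

/-- If polarization does not increase the energy then `ω` is ordered across the line. -/
lemma heavy_of_pairing_polar_le (h : Nice ω)
    (hle : pairing (polar l ω) (polar l ω) ≤ pairing ω ω) : HeavyRight l ω ∨ HeavyLeft l ω := by
  have h1 := pairing_polar_sub (l := l) h
  rw [pairing_polAsym_sub h] at h1
  have hnn : ∀ p : (ℝ × ℝ) × (ℝ × ℝ),
      0 ≤ (green p.1 p.2 - green p.1 (refl l p.2)) * polGain l ω p := by
    rintro ⟨x, y⟩
    rcases polGain_cases (l := l) h x y with h2 | h2
    · rw [h2, mul_zero]
    · exact h2.le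
  have h0 : ∫ p : (ℝ × ℝ) × (ℝ × ℝ), (green p.1 p.2 - green p.1 (refl l p.2)) * polGain l ω p = 0 :=
    le_antisymm (by linarith) (integral_nonneg hnn)
  rw [integral_eq_zero_iff_of_nonneg hnn (by
    simp only [sub_mul]
    exact (integrable_green_polGain h).sub (integrable_green_refl_polGain h))] at h0
  have h2 : ∀ᵐ p : (ℝ × ℝ) × (ℝ × ℝ), polGain l ω p = 0 := by
    filter_upwards [h0] with p hp
    rcases polGain_cases (l := l) h p.1 p.2 with h3 | h3
    · exact h3
    · exact absurd hp h3.ne'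
  -- In terms of t, vanishing gain reads |t(x)||t(y)| = t(x) t(y) a.e. Integration gives (∫|t|)² =
  -- (∫t)², so ∫t = ±∫|t| and t has constant sign a.e.
  set t : ℝ × ℝ → ℝ := fun x => side l x * asym l ω x with ht
  have hti : Integrable t := by
    refine (h.asym l).int.mono ((measurable_side l).mul (h.asym l).meas).aestronglyMeasurable
      (Filter.Eventually.of_forall fun x => ?_)
    simp [ht, abs_side]
  have habs : ∀ x, |t x| = |asym l ω x| := fun x => by simp [ht, abs_mul, abs_side]
  have h3 : ∫ p : (ℝ × ℝ) × (ℝ × ℝ), |t p.1| * |t p.2| = ∫ p : (ℝ × ℝ) × (ℝ × ℝ), t p.1 * t p.2 := by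
    apply integral_congr_ae
    filter_upwards [h2] with p hp
    rw [habs, habs]
    simp only [ht]
    simp only [polGain, polAsym] at hp
    have s1 := side_mul_self l p.1
    have s2 := side_mul_self l p.2
    linear_combination (side l p.1 * side l p.2) * hp -
      (|asym l ω p.1| * |asym l ω p.2|) * (side l p.2 * side l p.2 * s1 + s2)
  rw [Measure.volume_eq_prod, integral_prod_mul (fun x => |t x|) (fun x => |t x|),
    integral_prod_mul t t] at h3
  rcases mul_self_eq_mul_self_iff.1 h3 with h4 | h4
  · left
    have h5 : ∫ x, (|t x| - t x) = 0 := by rw [integral_sub hti.abs hti]; linarith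
    rw [integral_eq_zero_iff_of_nonneg (fun x => sub_nonneg.2 (le_abs_self _)) (hti.abs.sub hti)] at h5
    filter_upwards [h5] with x hx hl
    simp only [Pi.zero_apply] at hx
    have h6 : 0 ≤ t x := by rw [← sub_eq_zero.1 hx]; exact abs_nonneg _
    simp only [ht, side, if_pos hl, asym] at h6
    linarith
  · right
    have hn : Integrable fun x => -t x := hti.neg
    have h5 : ∫ x, (|t x| - -t x) = 0 := by
      rw [integral_sub hti.abs hn, integral_neg]; linarith
    rw [integral_eq_zero_iff_of_nonneg (fun x => sub_nonneg.2 (neg_le_abs _))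
      (hti.abs.sub hn)] at h5
    filter_upwards [h5] with x hx hl
    simp only [Pi.zero_apply] at hx
    have h6 : t x ≤ 0 := by linarith [abs_nonneg (t x)]
    simp only [ht, side, if_pos hl, asym] at h6
    linarith

end

/-- Supports that are stable under one of the two polarizations across each vertical line. -/
def PolarStable (S : Set (ℝ × ℝ)) : Prop :=
  ∀ l, (∀ x, x ∉ S → refl l x ∈ S → x.1 ≤ l) ∨ (∀ x, x ∉ S → refl l x ∈ S → l ≤ x.1)

section

variable {S : Set (ℝ × ℝ)} {M l : ℝ} {ω : ℝ × ℝ → ℝ}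

lemma polar_mem_Icc (h : Relaxed S M ω) (x : ℝ × ℝ) : 0 ≤ polar l ω x ∧ polar l ω x ≤ 1 := by
  unfold polar
  split_ifs
  · exact ⟨le_max_of_le_left (h.nonneg _), max_le (h.le_one _) (h.le_one _)⟩
  · exact ⟨le_min (h.nonneg _) (h.nonneg _), min_le_of_left_le (h.le_one _)⟩

lemma Relaxed.polar (h : Relaxed S M ω) (hS : S ⊆ halfPlane)
    (hl : ∀ x, x ∉ S → refl l x ∈ S → x.1 ≤ l) : Relaxed S M (polar l ω) where
  meas := ((h.nice hS).polar l).meas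
  nonneg x := (polar_mem_Icc h x).1
  le_one x := (polar_mem_Icc h x).2
  zero x hx := by
    unfold VortexPatch.polar
    split_ifs with hlx
    · have : VortexPatch.refl l x ∉ S := fun h' => absurd (hl x hx h') (not_le.2 hlx)
      rw [h.zero x hx, h.zero _ this, max_self]
    · rw [h.zero x hx, min_eq_left (h.nonneg _)]
  int := ((h.nice hS).polar l).int
  mass_le := by rw [integral_polar (h.nice hS)]; exact h.mass_le
  imp := ((h.nice hS).polar l).imp
  imp_le := by rw [integral_snd_mul_polar (h.nice hS)]; exact h.imp_le

lemma Relaxed.polar_refl (h : Relaxed S M ω) (hS : S ⊆ halfPlane)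
    (hl : ∀ x, x ∉ S → refl l x ∈ S → l ≤ x.1) :
    Relaxed S M (fun x => VortexPatch.polar l ω (refl l x)) where
  meas := (((h.nice hS).polar l).refl l).meas
  nonneg x := (polar_mem_Icc h _).1
  le_one x := (polar_mem_Icc h _).2
  zero x hx := by
    unfold VortexPatch.polar
    rw [refl_refl]
    split_ifs with hlx
    · have : VortexPatch.refl l x ∉ S := fun h' => by
        have := hl x hx h'
        simp only [refl_fst] at hlx
        linarith
      rw [h.zero x hx, h.zero _ this, max_self]
    · rw [h.zero x hx, min_eq_right (h.nonneg _)]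
  int := (((h.nice hS).polar l).refl l).int
  mass_le := by rw [integral_refl l, integral_polar (h.nice hS)]; exact h.mass_le
  imp := (((h.nice hS).polar l).refl l).imp
  imp_le := by
    rw [integral_snd_mul_refl, integral_snd_mul_polar (h.nice hS)]
    exact h.imp_le

/-- Maximizers over a polarization stable class are ordered across every vertical line. -/
lemma Relaxed.heavy_of_max (h : Relaxed S M ω) (hS : S ⊆ halfPlane) (hP : PolarStable S)
    (hmax : ∀ η, Relaxed S M η → pairing η η ≤ pairing ω ω) (l : ℝ) :
    HeavyRight l ω ∨ HeavyLeft l ω := by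
  apply heavy_of_pairing_polar_le (h.nice hS)
  rcases hP l with hl | hl
  · exact hmax _ (h.polar hS hl)
  · rw [← pairing_refl l]
    exact hmax _ (h.polar_refl hS hl)

lemma polarStable_halfPlane : PolarStable halfPlane := fun _ =>
  Or.inl fun _ hx hx' => absurd (refl_mem_halfPlane.1 hx') hx

/-- The half strip `|x₁| ≤ L`, `x₂ > 0`. -/
def halfStrip (L : ℝ) : Set (ℝ × ℝ) := {x | x ∈ halfPlane ∧ |x.1| ≤ L}

lemma halfStrip_subset (L : ℝ) : halfStrip L ⊆ halfPlane := fun _ h => h.1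

lemma measurableSet_halfStrip (L : ℝ) : MeasurableSet (halfStrip L) :=
  measurableSet_halfPlane.inter (measurableSet_le measurable_fst.abs measurable_const)

/-- Polarizing towards the side that contains the axis x₁ = 0 only moves values to points no farther
from the axis, hence stays inside the strip. -/
lemma polarStable_halfStrip (L : ℝ) : PolarStable (halfStrip L) := by
  intro l
  rcases le_total l 0 with hl | hl
  · left
    rintro x hx ⟨h1, h2⟩
    by_contra hlt
    refine hx ⟨h1, ?_⟩
    simp only [refl_fst, abs_le] at h2 ⊢
    constructor <;> linarith
  · right
    rintro x hx ⟨h1, h2⟩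
    by_contra hlt
    refine hx ⟨h1, ?_⟩
    simp only [refl_fst, abs_le] at h2 ⊢
    constructor <;> linarith

end

/-! ### The axis of symmetry and monotonicity of the stream function -/

section

variable {ω : ℝ × ℝ → ℝ} {l τ : ℝ}

/-- The mass of `ω` to the right of the line `x₁ = l`. -/
def massRight (ω : ℝ × ℝ → ℝ) (l : ℝ) : ℝ := ∫ x in {x : ℝ × ℝ | l < x.1}, ω x

lemma measurableSet_right (l : ℝ) : MeasurableSet {x : ℝ × ℝ | l < x.1} :=
  measurableSet_lt measurable_const measurable_fst

lemma ae_fst_ne (l : ℝ) : ∀ᵐ x : ℝ × ℝ, x.1 ≠ l := by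
  have : {x : ℝ × ℝ | ¬ x.1 ≠ l} = {l} ×ˢ Set.univ := by ext x; simp
  rw [ae_iff, this, Measure.volume_eq_prod, Measure.prod_prod]
  simp

lemma massRight_refl (h : Integrable ω) (l : ℝ) :
    ∫ x in {x : ℝ × ℝ | l < x.1}, ω (refl l x) = (∫ x, ω x) - massRight ω l := by
  have h1 : massRight ω l + ∫ x in {x : ℝ × ℝ | l < x.1}ᶜ, ω x = ∫ x, ω x :=
    integral_add_compl (measurableSet_right l) h
  have h2 : ∫ x in {x : ℝ × ℝ | l < x.1}, ω (refl l x) = ∫ x in {x : ℝ × ℝ | l < x.1}ᶜ, ω x := by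
    rw [← integral_indicator (measurableSet_right l),
      ← integral_indicator (measurableSet_right l).compl, ← integral_refl l]
    apply integral_congr_ae
    filter_upwards [ae_fst_ne l] with x hx
    simp only [Set.indicator, Set.mem_compl_iff, Set.mem_ofPred_eq, refl_fst, refl_refl]
    have : l < 2 * l - x.1 ↔ ¬ l < x.1 := by
      rw [not_lt]
      constructor
      · intro h; linarith
      · intro h; have := lt_of_le_of_ne h hx; linarith
    simp [this]
  linarith

lemma HeavyRight.le (hr : HeavyRight l ω) (h : Integrable ω) : ∫ x, ω x ≤ 2 * massRight ω l := by
  have h1 := massRight_refl h l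
  have h2 : ∫ x in {x : ℝ × ℝ | l < x.1}, ω (refl l x) ≤ massRight ω l := by
    apply setIntegral_mono_on_ae (integrable_refl h).integrableOn h.integrableOn
      (measurableSet_right l)
    exact hr
  linarith

lemma HeavyLeft.le (hr : HeavyLeft l ω) (h : Integrable ω) : 2 * massRight ω l ≤ ∫ x, ω x := by
  have h1 := massRight_refl h l
  have h2 : massRight ω l ≤ ∫ x in {x : ℝ × ℝ | l < x.1}, ω (refl l x) := by
    apply setIntegral_mono_on_ae h.integrableOn (integrable_refl h).integrableOn
      (measurableSet_right l)
    exact hr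
  linarith

/-- If the line halves the mass, the nonnegative difference ω(Rx) - ω(x) has zero integral over the
right side and so vanishes a.e. -/
lemma HeavyLeft.heavyRight (hr : HeavyLeft l ω) (h : Integrable ω)
    (he : 2 * massRight ω l = ∫ x, ω x) : HeavyRight l ω := by
  have h1 := massRight_refl h l
  have h2 : ∫ x in {x : ℝ × ℝ | l < x.1}, (ω (refl l x) - ω x) = 0 := by
    rw [integral_sub (integrable_refl h).integrableOn h.integrableOn, h1]
    change _ - massRight ω l = 0
    linarith
  have hnn : 0 ≤ᵐ[volume.restrict {x : ℝ × ℝ | l < x.1}] fun x => ω (refl l x) - ω x := by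
    rw [Filter.EventuallyLE, ae_restrict_iff' (measurableSet_right l)]
    filter_upwards [hr] with x hx hlx
    exact sub_nonneg.2 (hx hlx)
  rw [integral_eq_zero_iff_of_nonneg_ae hnn
    ((integrable_refl h).integrableOn.sub h.integrableOn)] at h2
  rw [Filter.EventuallyEq, ae_restrict_iff' (measurableSet_right l)] at h2
  filter_upwards [h2] with x hx hlx
  exact (sub_eq_zero.1 (hx hlx)).le

lemma massRight_antitone (h : Integrable ω) (h0 : ∀ x, 0 ≤ ω x) : Antitone (massRight ω) := by
  intro a b hab
  apply setIntegral_mono_set h.integrableOn (Filter.Eventually.of_forall h0)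
  apply Filter.Eventually.of_forall
  intro x (hx : b < x.1)
  exact lt_of_le_of_lt hab hx

lemma tendsto_massRight_neg (h : Integrable ω) :
    Filter.Tendsto (fun n : ℕ => massRight ω (-(n : ℝ))) Filter.atTop (nhds (∫ x, ω x)) := by
  have e : (⋃ n : ℕ, {x : ℝ × ℝ | -(n : ℝ) < x.1}) = Set.univ := by
    ext x
    obtain ⟨n, hn⟩ := exists_nat_gt (-x.1)
    simp only [Set.mem_iUnion, Set.mem_ofPred_eq, Set.mem_univ, iff_true]
    exact ⟨n, by linarith⟩
  have := tendsto_setIntegral_of_monotone (μ := volume) (f := ω)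
    (s := fun n : ℕ => {x : ℝ × ℝ | -(n : ℝ) < x.1})
    (fun n => measurableSet_right _) (fun m n hmn x (hx : -(m : ℝ) < x.1) => by
      have : (m : ℝ) ≤ n := by exact_mod_cast hmn
      show -(n : ℝ) < x.1
      linarith) h.integrableOn
  rw [e, setIntegral_univ] at this
  exact this

lemma tendsto_massRight (h : Integrable ω) :
    Filter.Tendsto (fun n : ℕ => massRight ω (n : ℝ)) Filter.atTop (nhds 0) := by
  have e : (⋂ n : ℕ, {x : ℝ × ℝ | (n : ℝ) < x.1}) = ∅ := by
    ext x
    obtain ⟨n, hn⟩ := exists_nat_gt x.1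
    simp only [Set.mem_iInter, Set.mem_ofPred_eq, Set.mem_empty_iff_false, iff_false, not_forall]
    exact ⟨n, by linarith⟩
  have := tendsto_setIntegral_of_antitone (μ := volume) (f := ω)
    (s := fun n : ℕ => {x : ℝ × ℝ | (n : ℝ) < x.1})
    (fun n => measurableSet_right _) (fun m n hmn x (hx : (n : ℝ) < x.1) => by
      have : (m : ℝ) ≤ n := by exact_mod_cast hmn
      show (m : ℝ) < x.1
      linarith) ⟨0, h.integrableOn⟩
  rw [e, setIntegral_empty] at this
  exact this

/-- `ω` is ordered across all vertical lines, in the direction of the line `x₁ = τ`. -/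
structure Centered (τ : ℝ) (ω : ℝ × ℝ → ℝ) : Prop where
  right : ∀ l < τ, HeavyRight l ω
  left : ∀ l > τ, HeavyLeft l ω
  strict : ∀ l > τ, ¬ HeavyRight l ω

/-- The axis is a median: τ is the supremum of the l with at least half of the mass to the right of
x₁ = l. `HeavyRight` at l puts l in this set, so it fails beyond τ. To the left of τ, `HeavyLeft` is
possible only if the line halves the mass, and then `HeavyRight` holds as well. -/
lemma exists_centered (h : Integrable ω) (h0 : ∀ x, 0 ≤ ω x) (hpos : 0 < ∫ x, ω x)
    (hl : ∀ l, HeavyRight l ω ∨ HeavyLeft l ω) : ∃ τ, Centered τ ω := by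
  set s : Set ℝ := {l | ∫ x, ω x ≤ 2 * massRight ω l} with hs
  have hne : s.Nonempty := by
    obtain ⟨n, hn⟩ := ((tendsto_order.1 (tendsto_massRight_neg h)).1 ((∫ x, ω x) / 2)
      (by linarith)).exists
    exact ⟨-(n : ℝ), by simp only [hs, Set.mem_ofPred_eq]; linarith⟩
  have hanti := massRight_antitone h h0
  have hbd : BddAbove s := by
    obtain ⟨n, hn⟩ := ((tendsto_order.1 (tendsto_massRight h)).2 ((∫ x, ω x) / 2)
      (by linarith)).exists
    refine ⟨n, fun l hls => ?_⟩
    by_contra hlt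
    have hls : ∫ x, ω x ≤ 2 * massRight ω l := hls
    have := hanti (not_le.1 hlt).le
    linarith
  have hstrict : ∀ l > sSup s, ¬ HeavyRight l ω := fun l hlt hr =>
    absurd (le_csSup hbd (hr.le h)) (not_le.2 hlt)
  refine ⟨sSup s, fun l hlt => ?_, fun l hlt => ?_, hstrict⟩
  · obtain ⟨l', hl', hll'⟩ := exists_lt_of_lt_csSup hne hlt
    rcases hl l with h1 | h1
    · exact h1
    · apply h1.heavyRight h
      have := hanti hll'.le
      have h2 := h1.le h
      have h3 : ∫ x, ω x ≤ 2 * massRight ω l' := hl'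
      linarith
  · exact (hl l).resolve_left (hstrict l hlt)

lemma stream_refl (h : Nice ω) (l : ℝ) (x : ℝ × ℝ) :
    stream ω (refl l x) = stream (fun y => ω (refl l y)) x := by
  rw [h.stream_eq, (h.refl l).stream_eq, ← integral_refl l]
  simp only [green_refl_refl]

/-- Averaging over y and its reflection exposes a kernel whose sign is determined by the sides of x
and y. -/
lemma stream_sub_refl (h : Nice ω) (l : ℝ) {x : ℝ × ℝ} (hx : x ∈ halfPlane) :
    Integrable (fun y => (green x y - green x (refl l y)) * asym l ω y) ∧
    stream ω x - stream ω (refl l x) =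
      1 / 2 * ∫ y, (green x y - green x (refl l y)) * asym l ω y := by
  have i1 := (h.asym l).integrable_green hx
  have i2 : Integrable fun y => green x (refl l y) * asym l ω y := by
    refine (integrable_refl (l := l) i1).neg.congr (Filter.Eventually.of_forall fun y => ?_)
    simp [asym_refl]
  have h1 : stream ω x - stream ω (refl l x) = ∫ y, green x y * asym l ω y := by
    rw [stream_refl h, h.stream_eq, (h.refl l).stream_eq,
      ← integral_sub (h.integrable_green hx) ((h.refl l).integrable_green hx)]
    congr 1; ext y; simp only [asym]; ring
  have h2 := integral_refl l (fun y => green x y * asym l ω y)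
  simp only [asym_refl, mul_neg, integral_neg] at h2
  simp only [sub_mul]
  refine ⟨i1.sub i2, ?_⟩
  rw [integral_sub i1 i2, h1]
  linarith

lemma ae_refl {p : ℝ × ℝ → Prop} (h : ∀ᵐ x : ℝ × ℝ, p x) (l : ℝ) : ∀ᵐ x : ℝ × ℝ, p (refl l x) :=
  (measurePreserving_refl l).quasiMeasurePreserving.ae h

lemma ae_ne (x : ℝ × ℝ) : ∀ᵐ y : ℝ × ℝ, y ≠ x := by simp [ae_iff]

/-- In `stream_sub_refl` the kernel and `asym` have opposite signs on each side of the line, so the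
integrand is nonpositive. In the equality case it vanishes a.e.; the kernel is nonzero a.e. in the
half plane, hence `asym` is zero. -/
lemma HeavyLeft.stream_le (hl : HeavyLeft l ω) (h : Nice ω) {x : ℝ × ℝ} (hx : x ∈ halfPlane)
    (hlx : l < x.1) : stream ω x ≤ stream ω (refl l x) ∧
      (stream ω x = stream ω (refl l x) → HeavyRight l ω) := by
  obtain ⟨hi, he⟩ := stream_sub_refl h l hx
  have hlx0 : 0 < x.1 - l := by linarith
  have key : ∀ᵐ y : ℝ × ℝ, (green x y - green x (refl l y)) * asym l ω y ≤ 0 ∧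
      ((green x y - green x (refl l y)) * asym l ω y = 0 → asym l ω y = 0) := by
    filter_upwards [ae_ne x, ae_ne (refl l x), ae_fst_ne l, hl, ae_refl hl l] with y h1 h2 h3 h4 h5
    by_cases hy : y ∈ halfPlane; swap
    · simp [(h.asym l).zero y hy]
    rcases lt_or_gt_of_ne h3 with h6 | h6
    · have hg := lt_green_refl (l := l) hx hy (fun h' => h2 (by rw [h', refl_refl]))
        (mul_neg_of_pos_of_neg hlx0 (by linarith))
      have h7 := h5 (by simp; linarith)
      rw [refl_refl] at h7
      refine ⟨mul_nonpos_of_nonpos_of_nonneg (by linarith) (by simp only [asym]; linarith), ?_⟩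
      intro h8
      exact (mul_eq_zero.1 h8).resolve_left (by linarith)
    · have hg := green_refl_lt (l := l) hx hy (fun h' => h1 h'.symm)
        (mul_pos hlx0 (by linarith))
      have h7 := h4 h6
      refine ⟨mul_nonpos_of_nonneg_of_nonpos (by linarith) (by simp only [asym]; linarith), ?_⟩
      intro h8
      exact (mul_eq_zero.1 h8).resolve_left (by linarith)
  constructor
  · have : ∫ y, (green x y - green x (refl l y)) * asym l ω y ≤ 0 :=
      integral_nonpos_of_ae (key.mono fun y hy => hy.1)
    linarith
  · intro heq
    have h0 : ∫ y, -((green x y - green x (refl l y)) * asym l ω y) = 0 := by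
      rw [integral_neg]; linarith
    rw [integral_eq_zero_iff_of_nonneg_ae (key.mono fun y hy => neg_nonneg.2 hy.1) hi.neg] at h0
    filter_upwards [h0, key] with y h1 h2 _
    have := h2.2 (neg_eq_zero.1 h1)
    simp only [asym] at this
    linarith

lemma HeavyRight.refl_heavyLeft (hr : HeavyRight l ω) :
    HeavyLeft l (fun x => ω (refl l x)) := by
  filter_upwards [hr] with x hx hlx
  simpa using hx hlx

lemma HeavyRight.stream_le (hr : HeavyRight l ω) (h : Nice ω) {x : ℝ × ℝ} (hx : x ∈ halfPlane)
    (hlx : l < x.1) : stream ω (refl l x) ≤ stream ω x := by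
  have := (hr.refl_heavyLeft.stream_le (h.refl l) hx hlx).1
  rw [← stream_refl h, ← stream_refl h, refl_refl] at this
  exact this

lemma tendsto_stream_refl (h : Nice ω) {x : ℝ × ℝ} (hx : x ∈ halfPlane) (τ : ℝ) :
    Filter.Tendsto (fun l => stream ω (refl l x)) (nhds τ) (nhds (stream ω (refl τ x))) := by
  have hc : ContinuousAt (stream ω) (refl τ x) :=
    h.continuousOn_stream.continuousAt (isOpen_halfPlane.mem_nhds (refl_mem_halfPlane.2 hx))
  have : Continuous fun l => refl l x := by unfold refl; fun_prop
  exact hc.tendsto.comp this.continuousAt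

/-- Nothing is assumed about ordering across the axis itself. The two inequalities are limits of
those for l < τ and for l > τ, by continuity of the stream function. -/
lemma Centered.stream_even (hc : Centered τ ω) (h : Nice ω) {x : ℝ × ℝ} (hx : x ∈ halfPlane) :
    stream ω (refl τ x) = stream ω x := by
  have key : ∀ x : ℝ × ℝ, x ∈ halfPlane → τ < x.1 → stream ω (refl τ x) = stream ω x := by
    intro x hx hτ
    have ht := tendsto_stream_refl h hx τ
    apply le_antisymm
    · apply le_of_tendsto (ht.mono_left nhdsWithin_le_nhds : Filter.Tendsto _ (nhdsWithin τ (Set.Iio τ)) _)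
      filter_upwards [self_mem_nhdsWithin] with l (hl : l < τ)
      exact (hc.right l hl).stream_le h hx (hl.trans hτ)
    · apply ge_of_tendsto (ht.mono_left nhdsWithin_le_nhds : Filter.Tendsto _ (nhdsWithin τ (Set.Ioi τ)) _)
      filter_upwards [Ioo_mem_nhdsGT hτ] with l hl
      exact ((hc.left l hl.1).stream_le h hx hl.2).1
  rcases lt_trichotomy x.1 τ with hlt | heq | hgt
  · have := key (refl τ x) (refl_mem_halfPlane.2 hx) (by simp; linarith)
    rw [refl_refl] at this
    exact this.symm
  · rw [refl_eq_self heq]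
  · exact key x hx hgt

/-- Compare across the vertical line halfway between the two points. It lies to the right of τ,
where `strict` excludes equality. -/
lemma Centered.stream_lt (hc : Centered τ ω) (h : Nice ω) {a b t : ℝ} (ht : 0 < t) (ha : τ ≤ a)
    (hab : a < b) : stream ω (b, t) < stream ω (a, t) := by
  have hl : (a + b) / 2 > τ := by linarith
  have h1 := (hc.left _ hl).stream_le h (x := (b, t)) ht (by simp only; linarith)
  have e : refl ((a + b) / 2) (b, t) = (a, t) := by ext <;> simp; ring
  rw [e] at h1
  exact lt_of_le_of_ne h1.1 fun heq => hc.strict _ hl (h1.2 heq)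

lemma Centered.stream_abs (hc : Centered τ ω) (h : Nice ω) {a t : ℝ} (ht : 0 < t) :
    stream ω (τ + |a - τ|, t) = stream ω (a, t) := by
  rcases le_total τ a with h1 | h1
  · rw [abs_of_nonneg (by linarith)]; congr 2; ring
  · rw [abs_of_nonpos (by linarith), ← hc.stream_even h (x := (a, t)) ht]
    congr 1
    ext <;> simp; ring

lemma Centered.stream_lt_of_abs_lt (hc : Centered τ ω) (h : Nice ω) {a b t : ℝ} (ht : 0 < t)
    (hab : |a - τ| < |b - τ|) : stream ω (b, t) < stream ω (a, t) := by
  rw [← hc.stream_abs h (a := a) ht, ← hc.stream_abs h (a := b) ht]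
  apply hc.stream_lt h ht <;> linarith [abs_nonneg (a - τ)]

/-- The level sets of the stream function of a centered function are null, even after subtracting
a function of `x₂`. -/
lemma Centered.volume_level (hc : Centered τ ω) (h : Nice ω) (W γ : ℝ) :
    volume {x : ℝ × ℝ | x ∈ halfPlane ∧ stream ω x - W * x.2 - γ = 0} = 0 := by
  have hm : MeasurableSet {x : ℝ × ℝ | x ∈ halfPlane ∧ stream ω x - W * x.2 - γ = 0} := by
    apply measurableSet_halfPlane.inter
    have := h.measurable_stream
    exact measurableSet_eq_fun (by fun_prop) measurable_const
  rw [Measure.volume_eq_prod, Measure.prod_apply_symm hm]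
  simp only [lintegral_eq_zero_iff (measurable_measure_prodMk_right hm)]
  refine Filter.Eventually.of_forall fun t => ?_
  by_cases hne : ∃ a : ℝ, (a, t) ∈ {x : ℝ × ℝ | x ∈ halfPlane ∧ stream ω x - W * x.2 - γ = 0}
  · obtain ⟨a, ha, hae⟩ := hne
    have ht : 0 < t := ha
    -- Strict monotonicity in |x₁ - τ| leaves at most two points of the level set on each horizontal
    -- line.
    have hsub : (fun b : ℝ => (b, t)) ⁻¹' {x : ℝ × ℝ | x ∈ halfPlane ∧ stream ω x - W * x.2 - γ = 0}
        ⊆ {a, 2 * τ - a} := by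
      rintro b ⟨_, hbe⟩
      simp only at hae hbe
      have habs : |b - τ| = |a - τ| := by
        rcases lt_trichotomy |b - τ| |a - τ| with h1 | h1 | h1
        · have := hc.stream_lt_of_abs_lt h ht h1; linarith
        · exact h1
        · have := hc.stream_lt_of_abs_lt h ht h1; linarith
      rcases abs_eq_abs.1 habs with h2 | h2
      · left; linarith
      · right; rw [Set.mem_singleton_iff]; linarith
    exact measure_mono_null hsub (Set.Finite.measure_zero (by simp) _)
  · have : (fun b : ℝ => (b, t)) ⁻¹' {x : ℝ × ℝ | x ∈ halfPlane ∧ stream ω x - W * x.2 - γ = 0} = ∅ := by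
      ext b
      simp only [Set.mem_preimage, Set.mem_empty_iff_false, iff_false]
      exact fun hb => hne ⟨b, hb⟩
    simp only [this, measure_empty, Pi.zero_apply]

end

/-! ### Weak compactness and continuity of the energy -/

section

variable {S : Set (ℝ × ℝ)} {M : ℝ}

lemma Relaxed.integrable_sq {f : ℝ × ℝ → ℝ} (hf : Relaxed S M f) : Integrable fun x => f x ^ 2 := by
  refine hf.int.mono' (hf.meas.pow_const 2).aestronglyMeasurable (Eventually.of_forall fun x => ?_)
  rw [Real.norm_of_nonneg (sq_nonneg _)]
  nlinarith [hf.nonneg x, hf.le_one x]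

lemma Relaxed.memLp {f : ℝ × ℝ → ℝ} (hf : Relaxed S M f) : MemLp f 2 :=
  (memLp_two_iff_integrable_sq hf.meas.aestronglyMeasurable).2 hf.integrable_sq

lemma inner_toLp {f g : ℝ × ℝ → ℝ} (hf : MemLp f 2) (hg : MemLp g 2) :
    inner ℝ (hf.toLp f) (hg.toLp g) = ∫ x, g x * f x := by
  rw [L2.inner_def]
  apply integral_congr_ae
  filter_upwards [hf.coeFn_toLp, hg.coeFn_toLp] with x h1 h2
  rw [h1, h2]; rfl

/-- Since 0 ≤ f ≤ 1, f² ≤ f, and the mass bound gives the L² bound. -/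
lemma Relaxed.norm_toLp_le {f : ℝ × ℝ → ℝ} (hf : Relaxed S M f) : ‖hf.memLp.toLp f‖ ≤ 1 := by
  have h : ‖hf.memLp.toLp f‖ ^ 2 ≤ 1 := by
    rw [← real_inner_self_eq_norm_sq, inner_toLp]
    calc ∫ x, f x * f x ≤ ∫ x, f x := by
          apply integral_mono _ hf.int
          · intro x; simp only; nlinarith [hf.nonneg x, hf.le_one x]
          · simpa only [sq] using hf.integrable_sq
      _ ≤ 1 := hf.mass_le
  nlinarith [norm_nonneg (hf.memLp.toLp f)]

/-- Sequential weak compactness in `L²` for the relaxed class. -/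
lemma exists_weak_limit_Lp (f : ℕ → ℝ × ℝ → ℝ) (hf : ∀ n, Relaxed S M (f n)) :
    ∃ φ : ℕ → ℕ, StrictMono φ ∧ ∃ f₀ : ℝ × ℝ → ℝ, Measurable f₀ ∧ MemLp f₀ 2 ∧
      ∀ g : ℝ × ℝ → ℝ, MemLp g 2 →
        Tendsto (fun n => ∫ x, g x * f (φ n) x) atTop (𝓝 (∫ x, g x * f₀ x)) := by
  set E := Lp ℝ 2 (volume : Measure (ℝ × ℝ))
  have : Fact ((2 : ENNReal) ≠ ⊤) := ⟨by simp⟩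
  have hc := WeakDual.isSeqCompact_closedBall ℝ E 0 1
  set F : ℕ → E := fun n => (hf n).memLp.toLp (f n)
  set T : ℕ → WeakDual ℝ E := fun n => StrongDual.toWeakDual (InnerProductSpace.toDual ℝ E (F n))
  obtain ⟨Λ, -, φ, hφ, hlim⟩ := hc (x := T) (fun n => by
    simp only [Set.mem_preimage, mem_closedBall_zero_iff]
    change ‖InnerProductSpace.toDual ℝ E (F n)‖ ≤ 1
    rw [LinearIsometryEquiv.norm_map]
    exact (hf n).norm_toLp_le)
  set G : E := (InnerProductSpace.toDual ℝ E).symm (WeakDual.toStrongDual Λ)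
  refine ⟨φ, hφ, G, (Lp.stronglyMeasurable G).measurable, Lp.memLp G, fun g hg => ?_⟩
  have h1 : Tendsto (fun n => T (φ n) (hg.toLp g)) atTop (𝓝 (Λ (hg.toLp g))) :=
    ((WeakDual.eval_continuous (hg.toLp g)).tendsto Λ).comp hlim
  have h2 : ∀ n, T n (hg.toLp g) = ∫ x, g x * f n x := fun n => by
    rw [← inner_toLp (hf n).memLp hg]; rfl
  have h3 : Λ (hg.toLp g) = ∫ x, g x * G x := by
    have : Λ (hg.toLp g) = inner ℝ G (hg.toLp g) := by
      have h4 : InnerProductSpace.toDual ℝ E G = WeakDual.toStrongDual Λ := by simp [G]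
      rw [← InnerProductSpace.toDual_apply_apply, h4]; rfl
    rw [this, ← inner_toLp (Lp.memLp G) hg, Lp.toLp_coeFn]
  simp only [h2, h3] at h1
  exact h1

lemma memLp_indicator_of_bound {s : Set (ℝ × ℝ)} (hs : MeasurableSet s) (hsf : volume s < ⊤)
    {g : ℝ × ℝ → ℝ} (hg : Measurable g) {C : ℝ} (hC : ∀ x ∈ s, |g x| ≤ C) :
    MemLp (s.indicator g) 2 := by
  rw [memLp_indicator_iff_restrict hs]
  have : IsFiniteMeasure (volume.restrict s) := ⟨by simpa using hsf⟩
  apply MemLp.of_bound hg.aestronglyMeasurable C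
  rw [ae_restrict_iff' hs]
  exact Eventually.of_forall hC

/-- A Fatou property of weak limits: k is bounded on balls, so its restriction to a ball may be
tested, and the radius is then sent to infinity. It is applied to k = 1 for the mass and to k = x₂
for the impulse. -/
lemma integrable_and_integral_le {k ω : ℝ × ℝ → ℝ} {m : ℝ} (hk : Continuous k)
    (hω : Measurable ω) (hω0 : ∀ x, 0 ≤ ω x) (hω1 : ∀ x, ω x ≤ 1) (hnn : ∀ x, 0 ≤ k x * ω x)
    {f : ℕ → ℝ × ℝ → ℝ} (hfi : ∀ n, Integrable fun x => k x * f n x) (hf : ∀ n x, 0 ≤ k x * f n x)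
    (hfm : ∀ n, ∫ x, k x * f n x ≤ m)
    (hw : ∀ g : ℝ × ℝ → ℝ, MemLp g 2 →
      Tendsto (fun n => ∫ x, g x * f n x) atTop (𝓝 (∫ x, g x * ω x))) :
    Integrable (fun x => k x * ω x) ∧ ∫ x, k x * ω x ≤ m := by
  have hcov : AECover (volume : Measure (ℝ × ℝ)) atTop fun n : ℕ => Metric.closedBall 0 (n : ℝ) :=
    aecover_closedBall tendsto_natCast_atTop_atTop
  have hbd : ∀ n : ℕ, ∃ C, ∀ x ∈ Metric.closedBall (0 : ℝ × ℝ) (n : ℝ), |k x| ≤ C := fun n =>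
    (isCompact_closedBall (0 : ℝ × ℝ) (n : ℝ)).exists_bound_of_continuousOn hk.continuousOn
  have hle : ∀ n : ℕ, ∫ x in Metric.closedBall 0 (n : ℝ), k x * ω x ≤ m := by
    intro n
    obtain ⟨C, hC⟩ := hbd n
    have h1 := hw _ (memLp_indicator_of_bound measurableSet_closedBall measure_closedBall_lt_top
      hk.measurable hC)
    have e : ∀ g : ℝ × ℝ → ℝ, ∫ x, (Metric.closedBall (0 : ℝ × ℝ) (n : ℝ)).indicator k x * g x =
        ∫ x in Metric.closedBall 0 (n : ℝ), k x * g x := by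
      intro g
      rw [← integral_indicator measurableSet_closedBall]
      congr 1; ext x
      exact (Set.indicator_mul_left _ _ _).symm
    simp only [e] at h1
    refine le_of_tendsto h1 (Eventually.of_forall fun i => ?_)
    exact (setIntegral_le_integral (hfi i) (Eventually.of_forall (hf i))).trans (hfm i)
  have hint : ∀ n : ℕ, IntegrableOn (fun x => k x * ω x) (Metric.closedBall 0 (n : ℝ)) := by
    intro n
    obtain ⟨C, hC⟩ := hbd n
    refine IntegrableOn.of_bound measure_closedBall_lt_top
      (hk.measurable.mul hω).aestronglyMeasurable C ?_
    rw [ae_restrict_iff' measurableSet_closedBall]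
    refine Eventually.of_forall fun x hx => ?_
    rw [norm_mul, Real.norm_eq_abs, Real.norm_of_nonneg (hω0 x)]
    nlinarith [hC x hx, abs_nonneg (k x), hω1 x, hω0 x]
  have hi : Integrable fun x => k x * ω x :=
    hcov.integrable_of_integral_bounded_of_nonneg_ae m hint (Eventually.of_forall hnn)
      (Eventually.of_forall hle)
  exact ⟨hi, le_of_tendsto (hcov.integral_tendsto_of_countably_generated hi)
    (Eventually.of_forall hle)⟩

/-- Testing against indicators of sets of finite measure gives 0 ≤ f₀ ≤ 1_S a.e. for the L² limit; a
change on a null set makes the bounds hold everywhere, as `Relaxed` demands. -/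
lemma exists_weak_limit (hS : S ⊆ halfPlane) (hSm : MeasurableSet S) (f : ℕ → ℝ × ℝ → ℝ)
    (hf : ∀ n, Relaxed S M (f n)) :
    ∃ φ : ℕ → ℕ, StrictMono φ ∧ ∃ ω : ℝ × ℝ → ℝ, Relaxed S M ω ∧
      ∀ g : ℝ × ℝ → ℝ, MemLp g 2 →
        Tendsto (fun n => ∫ x, g x * f (φ n) x) atTop (𝓝 (∫ x, g x * ω x)) := by
  obtain ⟨φ, hφ, f₀, hm₀, hL₀, hw⟩ := exists_weak_limit_Lp f hf
  have hset : ∀ s : Set (ℝ × ℝ), MeasurableSet s → volume s < ⊤ →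
      IntegrableOn f₀ s ∧ Tendsto (fun n => ∫ x in s, f (φ n) x) atTop (𝓝 (∫ x in s, f₀ x)) := by
    intro s hs hsf
    have : IsFiniteMeasure (volume.restrict s) := ⟨by simpa using hsf⟩
    refine ⟨(hL₀.restrict s).integrable one_le_two, ?_⟩
    have h1 := hw _ (memLp_indicator_of_bound hs hsf (measurable_const (a := (1 : ℝ))) (C := 1)
      (by simp))
    have e : ∀ g : ℝ × ℝ → ℝ, ∫ x, s.indicator (fun _ => (1 : ℝ)) x * g x = ∫ x in s, g x := by
      intro g
      rw [← integral_indicator hs]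
      congr 1; ext x
      by_cases hx : x ∈ s <;> simp [hx]
    simpa only [e] using h1
  have hlow : ∀ᵐ x : ℝ × ℝ, 0 ≤ f₀ x := by
    apply ae_nonneg_of_forall_setIntegral_nonneg_of_sigmaFinite (fun s hs hsf => (hset s hs hsf).1)
    intro s hs hsf
    exact ge_of_tendsto (hset s hs hsf).2
      (Eventually.of_forall fun n => integral_nonneg fun x => (hf _).nonneg x)
  have hup : ∀ᵐ x : ℝ × ℝ, 0 ≤ S.indicator (fun _ => (1 : ℝ)) x - f₀ x := by
    have hi : ∀ s : Set (ℝ × ℝ), volume s < ⊤ → IntegrableOn (S.indicator fun _ => (1 : ℝ)) s := by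
      intro s hsf
      have : IsFiniteMeasure (volume.restrict s) := ⟨by simpa using hsf⟩
      exact (integrable_const (1 : ℝ)).indicator hSm
    apply ae_nonneg_of_forall_setIntegral_nonneg_of_sigmaFinite
      (fun s hs hsf => (hi s hsf).sub (hset s hs hsf).1)
    intro s hs hsf
    rw [integral_sub' (hi s hsf) (hset s hs hsf).1, sub_nonneg]
    refine le_of_tendsto (hset s hs hsf).2 (Eventually.of_forall fun n => ?_)
    apply integral_mono (hf _).int.integrableOn (hi s hsf)
    intro x
    by_cases hx : x ∈ S
    · simpa [hx] using (hf _).le_one x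
    · simp [hx, (hf (φ n)).zero x hx]
  set ω : ℝ × ℝ → ℝ := S.indicator fun x => max 0 (min 1 (f₀ x)) with hωdef
  have hωae : ω =ᵐ[volume] f₀ := by
    filter_upwards [hlow, hup] with x h1 h2
    by_cases hx : x ∈ S
    · simp only [hx, Set.indicator_of_mem] at h2
      simp only [hωdef, hx, Set.indicator_of_mem]
      rw [min_eq_right (by linarith), max_eq_right h1]
    · simp only [hx, not_false_eq_true, Set.indicator_of_notMem] at h2
      simp only [hωdef, hx, not_false_eq_true, Set.indicator_of_notMem]
      linarith
  have hωm : Measurable ω := (measurable_const.max (measurable_const.min hm₀)).indicator hSm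
  have hω0 : ∀ x, 0 ≤ ω x := fun x => Set.indicator_nonneg (fun _ _ => le_max_left _ _) x
  have hω1 : ∀ x, ω x ≤ 1 := fun x => by
    by_cases hx : x ∈ S
    · simp [hωdef, hx]
    · simp [hωdef, hx]
  have hωz : ∀ x, x ∉ S → ω x = 0 := fun x hx => by simp [hωdef, hx]
  have hw' : ∀ g : ℝ × ℝ → ℝ, MemLp g 2 →
      Tendsto (fun n => ∫ x, g x * f (φ n) x) atTop (𝓝 (∫ x, g x * ω x)) := by
    intro g hg
    have : ∫ x, g x * ω x = ∫ x, g x * f₀ x := by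
      apply integral_congr_ae
      filter_upwards [hωae] with x hx
      rw [hx]
    rw [this]; exact hw g hg
  have h1 := integrable_and_integral_le (k := fun _ => 1) (m := 1) continuous_const hωm hω0 hω1
    (fun x => by rw [one_mul]; exact hω0 x) (f := fun n => f (φ n))
    (fun n => by simpa only [one_mul] using (hf (φ n)).int)
    (fun n x => by rw [one_mul]; exact (hf _).nonneg x)
    (fun n => by simpa only [one_mul] using (hf (φ n)).mass_le) hw'
  have h2 := integrable_and_integral_le (k := fun x => x.2) (m := M) continuous_snd hωm hω0 hω1
    (fun x => by
      by_cases hx : x ∈ S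
      · exact mul_nonneg (le_of_lt (hS hx)) (hω0 x)
      · rw [hωz x hx, mul_zero]) (f := fun n => f (φ n))
    (fun n => (hf (φ n)).imp) (fun n x => (hf _).imp_nonneg hS x) (fun n => (hf (φ n)).imp_le) hw'
  simp only [one_mul] at h1
  exact ⟨φ, hφ, ω, ⟨hωm, hω0, hω1, hωz, h1.1, h1.2, h2.1, h2.2⟩, hw'⟩

lemma pairing_mono {f f' g g' : ℝ × ℝ → ℝ} (hf : Nice f) (hf' : Nice f') (hg : Nice g)
    (hg' : Nice g') (hf0 : ∀ x, 0 ≤ f x) (hg0 : ∀ x, 0 ≤ g x) (hff : ∀ x, f x ≤ f' x)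
    (hgg : ∀ x, g x ≤ g' x) : pairing f g ≤ pairing f' g' := by
  apply integral_mono (hf.integrable_prod hg) (hf'.integrable_prod hg')
  rintro ⟨x, y⟩
  simp only
  by_cases hx : x ∈ halfPlane
  · by_cases hy : y ∈ halfPlane
    · exact mul_le_mul_of_nonneg_left (mul_le_mul (hff x) (hgg y) (hg0 y) ((hf0 x).trans (hff x)))
        (green_nonneg hx hy)
    · simp [hg.zero y hy, hg'.zero y hy]
  · simp [hf.zero x hx, hf'.zero x hx]

/-- If the potential is small outside a set, cutting off to that set changes the energy little. -/
lemma Relaxed.pairing_le_cutoff {f : ℝ × ℝ → ℝ} (hf : Relaxed S M f) (hS : S ⊆ halfPlane)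
    {D : Set (ℝ × ℝ)} (hD : MeasurableSet D) {ε : ℝ} (hε : 0 ≤ ε)
    (h : ∀ x ∈ S, x ∉ D → pot f x ≤ ε) :
    pairing f f ≤ pairing (D.indicator f) (D.indicator f) + 2 * (ε * M) := by
  have hn := hf.nice hS
  set a := D.indicator f
  set b := Dᶜ.indicator f
  have ha : Nice a := hn.indicator hD
  have hb : Nice b := hn.indicator hD.compl
  have hab : f = fun x => a x + b x := by
    ext x
    by_cases hx : x ∈ D <;> simp [a, b, hx]
  have hb0 : ∀ x, 0 ≤ b x := fun x => Set.indicator_nonneg (fun x _ => hf.nonneg x) x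
  have hbf : ∀ x, b x ≤ f x := fun x => Set.indicator_le_self' (fun x _ => hf.nonneg x) x
  -- With f = a + b, writing the cross terms as 2⟨b,f⟩ - ⟨b,b⟩ leaves a term of favourable sign to
  -- discard, and only the stream function of f on the support of b needs to be small.
  have h1 : pairing f f = pairing a a + 2 * pairing b f - pairing b b := by
    have e1 : pairing f f = pairing a f + pairing b f := by
      conv_lhs => rw [show pairing f f = pairing (fun x => a x + b x) f by rw [← hab]]
      exact pairing_add_left ha hb hn
    have e2 : pairing a f = pairing a a + pairing a b := by
      conv_lhs => rw [hab]
      exact pairing_add_right ha hb ha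
    have e3 : pairing b f = pairing b a + pairing b b := by
      conv_lhs => rw [hab]
      exact pairing_add_right ha hb hb
    rw [pairing_comm b a] at e3
    linarith
  have h2 := pairing_nonneg hb hb hb0 hb0
  have h3 : pairing b f ≤ ε * M := by
    rw [pairing_eq_integral hb hn]
    calc ∫ x, stream f x * b x ≤ ∫ x, ε * (x.2 * f x) := by
          apply integral_mono (hb.integrable_stream_mul hn) (hf.imp.const_mul _)
          intro x
          simp only
          have h0 : 0 ≤ ε * (x.2 * f x) := mul_nonneg hε (hf.imp_nonneg hS x)
          by_cases hx : x ∈ D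
          · have : b x = 0 := by simp [b, hx]
            rw [this, mul_zero]; exact h0
          by_cases hxS : x ∈ S
          · have hxH := hS hxS
            have hx0 : 0 < x.2 := hxH
            calc stream f x * b x ≤ (x.2 * ε) * b x := by
                  apply mul_le_mul_of_nonneg_right _ (hb0 x)
                  exact ((le_abs_self _).trans (hn.abs_stream_le hxH)).trans
                    (mul_le_mul_of_nonneg_left (h x hxS hx) hx0.le)
              _ ≤ (x.2 * ε) * f x := mul_le_mul_of_nonneg_left (hbf x) (by positivity)
              _ = _ := by ring
          · have : b x = 0 := by simp [b, hf.zero x hxS]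
            rw [this, mul_zero]; exact h0
      _ = ε * ∫ x, x.2 * f x := integral_const_mul _ _
      _ ≤ _ := mul_le_mul_of_nonneg_left hf.imp_le hε
  linarith

lemma memLp_green {D : Set (ℝ × ℝ)} (hD : Nice (D.indicator fun _ => (1 : ℝ))) (hDm : MeasurableSet D)
    {x : ℝ × ℝ} (hx : x ∈ halfPlane) : MemLp (D.indicator (green x)) 2 := by
  have hm : Measurable (D.indicator (green x)) :=
    (measurable_green.comp (measurable_const.prodMk measurable_id)).indicator hDm
  rw [memLp_two_iff_integrable_sq hm.aestronglyMeasurable]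
  refine ((hD.integrable_pot x).const_mul x.2).mono' (hm.pow_const 2).aestronglyMeasurable
    (Eventually.of_forall fun y => ?_)
  rw [Real.norm_of_nonneg (sq_nonneg _)]
  by_cases hy : y ∈ D
  · have hyH : y ∈ halfPlane := by
      by_contra h
      have := hD.zero y h
      simp [hy] at this
    simpa [hy] using green_sq_le hx hyH
  · simp [hy]

lemma nice_indicator_one {D : Set (ℝ × ℝ)} (hD : MeasurableSet D) (hDf : volume D < ⊤)
    (hDH : D ⊆ halfPlane) {R : ℝ} (hR : ∀ x ∈ D, x.2 ≤ R) : Nice (D.indicator fun _ => (1 : ℝ)) where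
  meas := measurable_const.indicator hD
  bdd := ⟨1, fun x => by by_cases hx : x ∈ D <;> simp [hx]⟩
  zero x hx := Set.indicator_of_notMem (fun h => hx (hDH h)) _
  int := (integrableOn_const hDf.ne).integrable_indicator hD
  imp := by
    have : (fun x : ℝ × ℝ => x.2 * D.indicator (fun _ => (1 : ℝ)) x) = D.indicator fun x => x.2 := by
      ext x; by_cases hx : x ∈ D <;> simp [hx]
    rw [this]
    refine IntegrableOn.integrable_indicator ?_ hD
    refine IntegrableOn.of_bound hDf measurable_snd.aestronglyMeasurable R ?_
    rw [ae_restrict_iff' hD]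
    refine Eventually.of_forall fun x hx => ?_
    rw [Real.norm_of_nonneg (le_of_lt (hDH hx))]
    exact hR x hx

/-- The energy is weakly continuous on the relaxed class, after a cutoff to a bounded set. -/
lemma tendsto_pairing_cutoff (hS : S ⊆ halfPlane) {f : ℕ → ℝ × ℝ → ℝ} (hf : ∀ n, Relaxed S M (f n))
    {ω : ℝ × ℝ → ℝ} (hω : Relaxed S M ω)
    (hw : ∀ g : ℝ × ℝ → ℝ, MemLp g 2 →
      Tendsto (fun n => ∫ x, g x * f n x) atTop (𝓝 (∫ x, g x * ω x)))
    {D : Set (ℝ × ℝ)} (hDm : MeasurableSet D) (hDf : volume D < ⊤)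
    (hDH : D ⊆ halfPlane) {R : ℝ} (hR : ∀ x ∈ D, x.2 ≤ R) :
    Tendsto (fun n => pairing (D.indicator (f n)) (D.indicator (f n))) atTop
      (𝓝 (pairing (D.indicator ω) (D.indicator ω))) := by
  have hD := nice_indicator_one hDm hDf hDH hR
  have hfn : ∀ n, Nice (D.indicator (f n)) := fun n => ((hf n).nice hS).indicator hDm
  have hωn : Nice (D.indicator ω) := (hω.nice hS).indicator hDm
  set a : ℕ → ℝ × ℝ → ℝ := fun n => stream (D.indicator (f n))
  set b : ℝ × ℝ → ℝ := stream (D.indicator ω)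
  have hconv : ∀ x ∈ halfPlane, Tendsto (fun n => a n x) atTop (𝓝 (b x)) := by
    intro x hx
    have h1 := hw _ (memLp_green hD hDm hx)
    have e : ∀ g : ℝ × ℝ → ℝ, Nice (D.indicator g) →
        stream (D.indicator g) x = ∫ y, D.indicator (green x) y * g y := by
      intro g hg
      rw [hg.stream_eq]
      congr 1; ext y
      by_cases hy : y ∈ D <;> simp [hy]
    simp only [a, b, e _ (hfn _), e _ hωn]
    exact h1
  set K := kerMass 1 + 2
  have hK : 0 ≤ K := by have := kerMass_nonneg 1; positivity
  have hpot : ∀ g : ℝ × ℝ → ℝ, Relaxed S M g → ∀ x ∈ halfPlane, |stream (D.indicator g) x| ≤ x.2 * K := by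
    intro g hg x hx
    refine (((hg.nice hS).indicator hDm).abs_stream_le hx).trans ?_
    apply mul_le_mul_of_nonneg_left _ (le_of_lt hx)
    refine le_trans ?_ (hg.pot_le x)
    apply integral_mono (((hg.nice hS).indicator hDm).integrable_pot x) ((hg.nice hS).integrable_pot x)
    intro y
    apply mul_le_mul_of_nonneg_left _ (by positivity)
    by_cases hy : y ∈ D <;> simp [hy]
  -- The product of two weakly convergent factors is split as (aₙ - b) fₙ + b fₙ. The first term
  -- tends to 0 by dominated convergence, since aₙ → b pointwise; the second is a weak limit against
  -- the bounded test function b on D.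
  have hdiff : Tendsto (fun n => ∫ x, (a n x - b x) * D.indicator (f n) x) atTop (𝓝 0) := by
    have h0 : (0 : ℝ) = ∫ x : ℝ × ℝ, (0 : ℝ) := by simp
    rw [h0]
    apply tendsto_integral_of_dominated_convergence
      (fun x => 2 * K * (x.2 * D.indicator (fun _ => (1 : ℝ)) x))
    · intro n
      exact (((hfn n).measurable_stream.sub hωn.measurable_stream).mul
        (hfn n).meas).aestronglyMeasurable
    · exact hD.imp.const_mul _
    · intro n
      refine Eventually.of_forall fun x => ?_
      by_cases hx : x ∈ D
      · have hxH := hDH hx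
        have hx0 : 0 < x.2 := hxH
        have h1 := hpot _ (hf n) x hxH
        have h2 := hpot _ hω x hxH
        have h3 := (hf n).abs_le_one x
        simp only [hx, Set.indicator_of_mem, norm_mul, Real.norm_eq_abs, mul_one]
        calc |a n x - b x| * |f n x| ≤ |a n x - b x| * 1 :=
              mul_le_mul_of_nonneg_left h3 (abs_nonneg _)
          _ ≤ |a n x| + |b x| := by rw [mul_one]; exact abs_sub _ _
          _ ≤ _ := by simp only [a, b]; linarith
      · simp [hx]
    · refine Eventually.of_forall fun x => ?_
      by_cases hx : x ∈ D
      · have h1 := (hconv x (hDH hx)).sub_const (b x)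
        rw [sub_self] at h1
        refine squeeze_zero_norm (fun n => ?_) (by simpa using h1.abs)
        rw [norm_mul, Real.norm_eq_abs, Real.norm_eq_abs]
        refine mul_le_of_le_one_right (abs_nonneg _) ?_
        simpa [hx] using (hf n).abs_le_one x
      · simp [hx]
  have hlin : Tendsto (fun n => ∫ x, b x * D.indicator (f n) x) atTop
      (𝓝 (∫ x, b x * D.indicator ω x)) := by
    have h1 := hw (D.indicator b) (memLp_indicator_of_bound hDm hDf hωn.measurable_stream (C := R * K)
      fun x hx => (hpot _ hω x (hDH hx)).trans (mul_le_mul_of_nonneg_right (hR x hx) hK))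
    have e : ∀ g : ℝ × ℝ → ℝ, ∀ x, D.indicator b x * g x = b x * D.indicator g x := by
      intro g x
      by_cases hx : x ∈ D <;> simp [hx]
    simpa only [e] using h1
  have hsum := hdiff.add hlin
  rw [zero_add] at hsum
  rw [pairing_eq_integral hωn hωn]
  refine hsum.congr fun n => ?_
  have hi := (hfn n).integrable_stream_mul (hfn n)
  have hi2 := (hfn n).integrable_stream_mul hωn
  rw [pairing_eq_integral (hfn n) (hfn n)]
  simp only [sub_mul]
  rw [integral_sub hi hi2, sub_add_cancel]

/-- Compactness: a sequence in the relaxed class with uniformly decaying potentials has a weak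
limit point whose energy is at least the limiting energy. -/
lemma exists_limit (hS : S ⊆ halfPlane) (hSm : MeasurableSet S) {f : ℕ → ℝ × ℝ → ℝ}
    (hf : ∀ n, Relaxed S M (f n))
    (htight : ∀ ε > 0, ∃ R, ∀ n, ∀ x ∈ S, R < ‖x‖ → pot (f n) x ≤ ε) :
    ∃ ω, Relaxed S M ω ∧ ∀ c, (∀ᶠ n in atTop, c ≤ pairing (f n) (f n)) → c ≤ pairing ω ω := by
  obtain ⟨φ, hφ, ω, hω, hw⟩ := exists_weak_limit hS hSm f hf
  refine ⟨ω, hω, fun c hc => ?_⟩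
  have hM : 0 ≤ M := (integral_nonneg fun x => hω.imp_nonneg hS x).trans hω.imp_le
  have key : ∀ ε > 0, c ≤ pairing ω ω + 2 * (ε * M) := by
    intro ε hε
    obtain ⟨R, hR⟩ := htight ε hε
    set D := halfPlane ∩ Metric.closedBall (0 : ℝ × ℝ) R
    have hDm : MeasurableSet D := measurableSet_halfPlane.inter measurableSet_closedBall
    have hDf : volume D < ⊤ :=
      (measure_mono Set.inter_subset_right).trans_lt measure_closedBall_lt_top
    have hDR : ∀ x ∈ D, x.2 ≤ R := fun x hx =>
      (le_abs_self _).trans ((norm_snd_le x).trans (mem_closedBall_zero_iff.1 hx.2))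
    have h1 := tendsto_pairing_cutoff hS (fun n => hf (φ n)) hω hw hDm hDf Set.inter_subset_left hDR
    have h2 : ∀ᶠ n in atTop, c - 2 * (ε * M) ≤
        pairing (D.indicator (f (φ n))) (D.indicator (f (φ n))) := by
      filter_upwards [hφ.tendsto_atTop.eventually hc] with n hn
      have := (hf (φ n)).pairing_le_cutoff hS hDm hε.le fun x hx hxD => hR (φ n) x hx (by
        by_contra h
        exact hxD ⟨hS hx, mem_closedBall_zero_iff.2 (not_lt.1 h)⟩)
      linarith
    have h3 := ge_of_tendsto h1 h2
    have hn := hω.nice hS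
    have h0 : ∀ x, 0 ≤ D.indicator ω x := fun x => Set.indicator_nonneg (fun x _ => hω.nonneg x) x
    have hle : ∀ x, D.indicator ω x ≤ ω x := fun x => Set.indicator_le_self' (fun x _ => hω.nonneg x) x
    have h4 := pairing_mono (hn.indicator hDm) hn (hn.indicator hDm) hn h0 h0 hle hle
    linarith
  rcases eq_or_lt_of_le hM with h0 | h0
  · have := key 1 one_pos
    rw [← h0] at this; linarith
  · apply le_of_forall_pos_le_add
    intro δ hδ
    have := key (δ / (2 * M)) (by positivity)
    have e : 2 * (δ / (2 * M) * M) = δ := by field_simp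
    linarith

end

/-! ### Decay of potentials and existence of a maximizer -/

section

variable {S : Set (ℝ × ℝ)} {M : ℝ} {ω : ℝ × ℝ → ℝ}

/-- The potential at `x` is small as soon as the mass near `x` is small. -/
lemma exists_pot_le {ε : ℝ} (hε : 0 < ε) :
    ∃ ρ > 0, ∃ m > 0, ∀ (S : Set (ℝ × ℝ)) (M : ℝ) (ω : ℝ × ℝ → ℝ), Relaxed S M ω → ∀ x,
      ∫ y in Metric.ball x ρ, ω y ≤ m → pot ω x ≤ ε := by
  obtain ⟨δ, hδ, hk⟩ := exists_integral_inv_norm_le (ε := ε / 3) (by positivity)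
  -- The constants make each of the three regions in `Relaxed.pot_le_of_ball` contribute at most ε /
  -- 3.
  refine ⟨3 / ε, by positivity, δ * (ε / 3), by positivity, fun S M ω hω x hx => ?_⟩
  have h1 := hω.pot_le_of_ball hδ (ρ := 3 / ε) (by positivity) x
  have h2 : δ⁻¹ * ∫ y in Metric.ball x (3 / ε), ω y ≤ δ⁻¹ * (δ * (ε / 3)) := by gcongr
  have h3 : δ⁻¹ * (δ * (ε / 3)) = ε / 3 := by field_simp
  have h4 : (3 / ε)⁻¹ = ε / 3 := by field_simp
  have h5 : kerMass δ ≤ ε / 3 := hk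
  linarith

/-- Chebyshev's inequality for the impulse: every point of the ball has height at least T. -/
lemma Relaxed.mass_ball_le (hω : Relaxed S M ω) (hS : S ⊆ halfPlane) {x : ℝ × ℝ} {ρ T : ℝ}
    (hT : 0 < T) (hx : ρ + T ≤ x.2) : ∫ y in Metric.ball x ρ, ω y ≤ M / T := by
  have h1 : ∫ y in Metric.ball x ρ, ω y ≤ ∫ y in Metric.ball x ρ, T⁻¹ * (y.2 * ω y) := by
    apply setIntegral_mono_on hω.int.integrableOn (hω.imp.const_mul _).integrableOn
      measurableSet_ball
    intro y hy
    rw [Metric.mem_ball, dist_eq_norm] at hy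
    have h2 : |y.2 - x.2| ≤ ‖y - x‖ := norm_snd_le (y - x)
    have h3 : T ≤ y.2 := by have := (abs_le.1 h2).1; linarith
    have h4 := hω.nonneg y
    calc ω y = T⁻¹ * (T * ω y) := by field_simp
      _ ≤ _ := by gcongr
  have h2 : ∫ y in Metric.ball x ρ, T⁻¹ * (y.2 * ω y) ≤ ∫ y, T⁻¹ * (y.2 * ω y) :=
    setIntegral_le_integral (hω.imp.const_mul _) (Eventually.of_forall fun y =>
      mul_nonneg (by positivity) (hω.imp_nonneg hS y))
  have e : ∫ y, T⁻¹ * (y.2 * ω y) = T⁻¹ * ∫ y, y.2 * ω y := integral_const_mul _ _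
  rw [e] at h2
  have h3 : T⁻¹ * ∫ y, y.2 * ω y ≤ T⁻¹ * M := mul_le_mul_of_nonneg_left hω.imp_le (by positivity)
  rw [div_eq_inv_mul]
  linarith

/-- The mass of `ω` in a vertical strip. -/
def stripMass (ω : ℝ × ℝ → ℝ) (ρ c : ℝ) : ℝ := ∫ y in {y : ℝ × ℝ | |y.1 - c| < ρ}, ω y

lemma measurableSet_strip (ρ c : ℝ) : MeasurableSet {y : ℝ × ℝ | |y.1 - c| < ρ} :=
  measurableSet_lt (by fun_prop) measurable_const

lemma stripMass_refl (ω : ℝ × ℝ → ℝ) (ρ c l : ℝ) :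
    ∫ y in {y : ℝ × ℝ | |y.1 - c| < ρ}, ω (refl l y) = stripMass ω ρ (2 * l - c) := by
  rw [stripMass, ← integral_indicator (measurableSet_strip _ _),
    ← integral_indicator (measurableSet_strip _ _),
    ← integral_refl l]
  congr 1; ext y
  simp only [Set.indicator, Set.mem_ofPred_eq, refl_fst, refl_refl]
  rw [show 2 * l - y.1 - c = -(y.1 - (2 * l - c)) by ring, abs_neg]

lemma HeavyLeft.stripMass_le {l ρ c : ℝ} (hl : HeavyLeft l ω) (h : Integrable ω) (hc : ρ ≤ c - l) :
    stripMass ω ρ c ≤ stripMass ω ρ (2 * l - c) := by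
  rw [← stripMass_refl]
  apply setIntegral_mono_on_ae h.integrableOn (integrable_refl h).integrableOn
    (measurableSet_strip _ _)
  filter_upwards [hl] with y hy hy2
  apply hy
  have := (abs_lt.1 (show |y.1 - c| < ρ from hy2)).1
  linarith

lemma HeavyRight.stripMass_le {l ρ c : ℝ} (hl : HeavyRight l ω) (h : Integrable ω)
    (hc : ρ ≤ c - l) : stripMass ω ρ (2 * l - c) ≤ stripMass ω ρ c := by
  rw [← stripMass_refl]
  apply setIntegral_mono_on_ae (integrable_refl h).integrableOn h.integrableOn
    (measurableSet_strip _ _)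
  filter_upwards [hl] with y hy hy2
  apply hy
  have := (abs_lt.1 (show |y.1 - c| < ρ from hy2)).1
  linarith

/-- The k strips are pairwise disjoint, their centres being 2ρ apart, and the total mass is at most
1. -/
lemma Relaxed.mul_le_one_of_strips (hω : Relaxed S M ω) {ρ m a s : ℝ} (hs : |s| = 1) (k : ℕ)
    (h : ∀ j < k, m ≤ stripMass ω ρ (a + s * (2 * ρ * (j + 1)))) : k * m ≤ 1 := by
  have hdisj : Set.Pairwise (↑(Finset.range k)) (Function.onFun Disjoint fun j : ℕ =>
      {y : ℝ × ℝ | |y.1 - (a + s * (2 * ρ * ((j : ℝ) + 1)))| < ρ}) := by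
    intro i _ j _ hij
    rw [Function.onFun, Set.disjoint_left]
    intro y hi hj
    simp only [Set.mem_ofPred_eq] at hi hj
    have hρ : 0 < ρ := (abs_nonneg _).trans_lt hi
    have h1 : |s * (2 * ρ * ((i : ℝ) - j))| < 2 * ρ := by
      have e : s * (2 * ρ * ((i : ℝ) - j)) = (y.1 - (a + s * (2 * ρ * ((j : ℝ) + 1)))) -
        (y.1 - (a + s * (2 * ρ * ((i : ℝ) + 1)))) := by ring
      rw [e]
      refine (abs_sub _ _).trans_lt ?_
      linarith
    rw [abs_mul, hs, one_mul, abs_mul, abs_of_pos (by positivity : 0 < 2 * ρ)] at h1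
    have h2 : |(i : ℝ) - j| < 1 := by
      by_contra h3
      have := mul_le_mul_of_nonneg_left (not_lt.1 h3) (by positivity : 0 ≤ 2 * ρ)
      linarith
    have h3 : |(i : ℤ) - j| < 1 := by exact_mod_cast h2
    rw [Int.abs_lt_one_iff] at h3
    apply hij; omega
  have h1 := integral_biUnion_finset (μ := volume) (f := ω) (Finset.range k)
    (fun j _ => measurableSet_strip ρ (a + s * (2 * ρ * ((j : ℝ) + 1)))) hdisj
    (fun j _ => hω.int.integrableOn)
  have h2 := setIntegral_le_integral (s := ⋃ j ∈ Finset.range k,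
    {y : ℝ × ℝ | |y.1 - (a + s * (2 * ρ * ((j : ℝ) + 1)))| < ρ}) hω.int
    (Eventually.of_forall hω.nonneg)
  have h3 : ∑ j ∈ Finset.range k, m ≤ ∑ j ∈ Finset.range k,
      ∫ y in {y : ℝ × ℝ | |y.1 - (a + s * (2 * ρ * ((j : ℝ) + 1)))| < ρ}, ω y :=
    Finset.sum_le_sum fun j hj => h j (Finset.mem_range.1 hj)
  rw [Finset.sum_const, Finset.card_range, nsmul_eq_mul] at h3
  linarith [hω.mass_le]

/-- Decay of the mass in strips away from the axis of symmetry. -/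
lemma Relaxed.strip_le (hω : Relaxed S M ω) (hr : ∀ l < 0, HeavyRight l ω)
    (hl : ∀ l > 0, HeavyLeft l ω) {ρ a : ℝ} (hρ : 0 < ρ) {k : ℕ} (ha : k * ρ < |a|) :
    k * stripMass ω ρ a ≤ 1 := by
  rcases le_total 0 a with h0 | h0
  · rw [abs_of_nonneg h0] at ha
    apply hω.mul_le_one_of_strips (ρ := ρ) (a := a) (s := -1) (by norm_num)
    intro j hj
    have hj' : (j : ℝ) + 1 ≤ k := by exact_mod_cast hj
    have hjk : ((j : ℝ) + 1) * ρ ≤ k * ρ := by gcongr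
    have hj0 : (0 : ℝ) ≤ j * ρ := by positivity
    -- Reflecting the strip at a across the line at distance (j + 1)ρ on the side of the axis does
    -- not lower its mass. Since kρ < |a|, all k lines lie strictly on the same side of the axis as
    -- a, so k disjoint strips are at least as heavy.
    have := (hl (a - ((j : ℝ) + 1) * ρ) (by linarith)).stripMass_le hω.int (ρ := ρ) (c := a)
      (by linarith)
    refine this.trans (le_of_eq ?_)
    congr 1; ring
  · rw [abs_of_nonpos h0] at ha
    apply hω.mul_le_one_of_strips (ρ := ρ) (a := a) (s := 1) (by norm_num)
    intro j hj
    have hj' : (j : ℝ) + 1 ≤ k := by exact_mod_cast hj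
    have hjk : ((j : ℝ) + 1) * ρ ≤ k * ρ := by gcongr
    have hj0 : (0 : ℝ) ≤ j * ρ := by positivity
    have := (hr (a + ((j : ℝ) + 1) * ρ) (by linarith)).stripMass_le hω.int (ρ := ρ)
      (c := a + 1 * (2 * ρ * (j + 1))) (by linarith)
    refine le_trans (le_of_eq ?_) this
    congr 1; ring

lemma mass_ball_le_strip (hω : Relaxed S M ω) (x : ℝ × ℝ) (ρ : ℝ) :
    ∫ y in Metric.ball x ρ, ω y ≤ stripMass ω ρ x.1 := by
  apply setIntegral_mono_set hω.int.integrableOn (Eventually.of_forall hω.nonneg)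
  apply Eventually.of_forall
  intro y (hy : y ∈ Metric.ball x ρ)
  rw [Metric.mem_ball, dist_eq_norm] at hy
  exact (norm_fst_le (y - x)).trans_lt hy

/-- Uniform decay of the potentials in the vertical direction. -/
lemma exists_high_pot_le (M : ℝ) {ε : ℝ} (hε : 0 < ε) : ∃ R, ∀ (S : Set (ℝ × ℝ)) (ω : ℝ × ℝ → ℝ),
    S ⊆ halfPlane → Relaxed S M ω → ∀ x : ℝ × ℝ, R < x.2 → pot ω x ≤ ε := by
  obtain ⟨ρ, hρ, m, hm, h⟩ := exists_pot_le hε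
  refine ⟨ρ + (|M| / m + 1), fun S ω hS hω x hx => h S M ω hω x ?_⟩
  have hT : 0 < |M| / m + 1 := by positivity
  refine (hω.mass_ball_le hS hT hx.le).trans ?_
  rw [div_le_iff₀ hT]
  have : m * (|M| / m + 1) = |M| + m := by field_simp
  rw [this]
  linarith [le_abs_self M]

/-- Uniform decay of the potentials in the horizontal direction, for symmetric functions. -/
lemma exists_wide_pot_le {ε : ℝ} (hε : 0 < ε) : ∃ R, ∀ (S : Set (ℝ × ℝ)) (M : ℝ) (ω : ℝ × ℝ → ℝ),
    Relaxed S M ω → (∀ l < 0, HeavyRight l ω) → (∀ l > 0, HeavyLeft l ω) →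
    ∀ x : ℝ × ℝ, R < |x.1| → pot ω x ≤ ε := by
  obtain ⟨ρ, hρ, m, hm, h⟩ := exists_pot_le hε
  obtain ⟨k, hk⟩ := exists_nat_gt (1 / m)
  refine ⟨k * ρ, fun S M ω hω hr hl x hx => h S M ω hω x ?_⟩
  refine (mass_ball_le_strip hω x ρ).trans ?_
  have h1 := hω.strip_le hr hl hρ hx
  have hk0 : (0 : ℝ) < k := (by positivity : 0 < 1 / m).trans hk
  rw [div_lt_iff₀ hm] at hk
  by_contra h2
  have := mul_lt_mul_of_pos_left (not_le.1 h2) hk0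
  linarith

lemma Nice.stream_pos (h : Nice ω) (h0 : ∀ x, 0 ≤ ω x) (hpos : 0 < ∫ x, ω x) {x : ℝ × ℝ}
    (hx : x ∈ halfPlane) : 0 < stream ω x := by
  rw [h.stream_eq]
  have hnn : ∀ y, 0 ≤ green x y * ω y := by
    intro y
    by_cases hy : y ∈ halfPlane
    · exact mul_nonneg (green_nonneg hx hy) (h0 y)
    · simp [h.zero y hy]
  refine lt_of_le_of_ne (integral_nonneg hnn) fun he => ?_
  rw [eq_comm, integral_eq_zero_iff_of_nonneg hnn (h.integrable_green hx)] at he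
  have : ∫ y, ω y = ∫ y : ℝ × ℝ, (0 : ℝ) := by
    apply integral_congr_ae
    filter_upwards [he, ae_ne x] with y h1 h2
    by_cases hy : y ∈ halfPlane
    · exact (mul_eq_zero.1 h1).resolve_left (green_pos hx hy h2.symm).ne'
    · exact h.zero y hy
  rw [this] at hpos
  simp at hpos

lemma Nice.pairing_pos (h : Nice ω) (h0 : ∀ x, 0 ≤ ω x) (hpos : 0 < ∫ x, ω x) :
    0 < pairing ω ω := by
  have hnn : ∀ x, 0 ≤ stream ω x * ω x := by
    intro x
    by_cases hx : x ∈ halfPlane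
    · exact mul_nonneg (h.stream_pos h0 hpos hx).le (h0 x)
    · simp [h.zero x hx]
  rw [pairing_eq_integral h h]
  refine lt_of_le_of_ne (integral_nonneg hnn) fun he => ?_
  rw [eq_comm, integral_eq_zero_iff_of_nonneg hnn (h.integrable_stream_mul h)] at he
  have : ∫ y, ω y = ∫ y : ℝ × ℝ, (0 : ℝ) := by
    apply integral_congr_ae
    filter_upwards [he] with y h1
    by_cases hy : y ∈ halfPlane
    · exact (mul_eq_zero.1 h1).resolve_left (h.stream_pos h0 hpos hy).ne'
    · exact h.zero y hy
  rw [this] at hpos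
  simp at hpos

lemma pairing_zero_of_integral (h : Nice ω) (h0 : ∀ x, 0 ≤ ω x) (hz : ∫ x, ω x = 0) :
    pairing ω ω = 0 := by
  rw [integral_eq_zero_iff_of_nonneg h0 h.int] at hz
  rw [pairing_eq_integral h h, integral_eq_zero_of_ae]
  filter_upwards [hz] with x hx
  simp only [Pi.zero_apply] at hx ⊢
  rw [hx, mul_zero]

/-- The relaxed class contains functions of positive energy. -/
lemma exists_relaxed_pos (hM : 0 < M) {L : ℝ} (hL : 1 ≤ L) :
    ∃ η, Relaxed (halfStrip L) M η ∧ 0 < pairing η η := by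
  -- The test function is the indicator of [0,s] × [s,2s], of mass s² ≤ 1 and impulse at most 2s³ ≤
  -- M.
  set s : ℝ := min (1 / 2) (M / 2)
  have hs0 : 0 < s := by positivity
  have hs1 : s ≤ 1 / 2 := min_le_left _ _
  have hs2 : s ≤ M / 2 := min_le_right _ _
  set Q : Set (ℝ × ℝ) := Set.Icc 0 s ×ˢ Set.Icc s (2 * s)
  have hQm : MeasurableSet Q := measurableSet_Icc.prod measurableSet_Icc
  have hQv : volume Q = ENNReal.ofReal (s * s) := by
    rw [Measure.volume_eq_prod, Measure.prod_prod, Real.volume_Icc, Real.volume_Icc,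
      ← ENNReal.ofReal_mul (by linarith)]
    congr 1; ring
  have hQH : Q ⊆ halfPlane := fun x hx => by
    have := hx.2.1
    exact lt_of_lt_of_le hs0 this
  have hn : Nice (Q.indicator fun _ => (1 : ℝ)) :=
    nice_indicator_one hQm (by rw [hQv]; exact ENNReal.ofReal_lt_top) hQH (R := 2 * s)
      fun x hx => hx.2.2
  have hmass : ∫ x, Q.indicator (fun _ => (1 : ℝ)) x = s * s := by
    rw [integral_indicator hQm]
    simp [Measure.real, hQv, hs0.le]
  have h0 : ∀ x, 0 ≤ Q.indicator (fun _ => (1 : ℝ)) x := fun x =>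
    Set.indicator_nonneg (fun _ _ => zero_le_one) x
  refine ⟨_, ⟨hn.meas, h0, fun x => ?_, fun x hx => ?_, hn.int, ?_, hn.imp, ?_⟩,
    hn.pairing_pos h0 ?_⟩
  · by_cases hx : x ∈ Q <;> simp [hx]
  · apply Set.indicator_of_notMem
    intro hxQ
    apply hx
    refine ⟨hQH hxQ, ?_⟩
    rw [abs_le]
    have h1 := hxQ.1.1
    have h2 := hxQ.1.2
    constructor <;> linarith
  · rw [hmass]; nlinarith
  · calc ∫ x : ℝ × ℝ, x.2 * Q.indicator (fun _ => (1 : ℝ)) x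
        ≤ ∫ x : ℝ × ℝ, 2 * s * Q.indicator (fun _ => (1 : ℝ)) x := by
          apply integral_mono hn.imp (hn.int.const_mul _)
          intro x
          by_cases hx : x ∈ Q
          · simpa [hx] using hx.2.2
          · simp [hx]
      _ = 2 * s * (s * s) := by rw [integral_const_mul, hmass]
      _ ≤ M := by nlinarith [mul_pos hs0 hs0]
  · rw [hmass]; positivity

/-- A maximizer over the relaxed class on a half strip. -/
lemma exists_max_halfStrip (hM : 0 < M) {L : ℝ} (hL : 1 ≤ L) :
    ∃ ω, Relaxed (halfStrip L) M ω ∧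
      ∀ η, Relaxed (halfStrip L) M η → pairing η η ≤ pairing ω ω := by
  set E : Set ℝ := {e | ∃ η, Relaxed (halfStrip L) M η ∧ pairing η η = e}
  have hne : E.Nonempty := by
    obtain ⟨η, hη, -⟩ := exists_relaxed_pos hM hL
    exact ⟨_, η, hη, rfl⟩
  have hbd : BddAbove E := by
    refine ⟨(kerMass 1 + 2) * M, ?_⟩
    rintro e ⟨η, hη, rfl⟩
    exact hη.energy_le (halfStrip_subset L)
  have hseq : ∀ n : ℕ, ∃ η, Relaxed (halfStrip L) M η ∧ sSup E - 1 / (n + 1) < pairing η η := by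
    intro n
    have hpos : (0 : ℝ) < 1 / (n + 1) := by positivity
    obtain ⟨e, ⟨η, hη, rfl⟩, he⟩ := exists_lt_of_lt_csSup hne (sub_lt_self (sSup E) hpos)
    exact ⟨η, hη, he⟩
  choose f hf hfe using hseq
  -- In a half strip a distant point must be high, so vertical decay alone gives the tightness.
  obtain ⟨ω, hω, hlim⟩ := exists_limit (halfStrip_subset L) (measurableSet_halfStrip L) hf (by
    intro ε hε
    obtain ⟨R, hR⟩ := exists_high_pot_le M hε
    refine ⟨max L R, fun n x hx hxR => hR _ _ (halfStrip_subset L) (hf n) x ?_⟩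
    rw [Prod.norm_def, lt_max_iff] at hxR
    rcases hxR with h | h
    · exact absurd (lt_of_le_of_lt (le_max_left _ _) h) (not_lt.2 hx.2)
    · rw [Real.norm_of_nonneg (le_of_lt hx.1)] at h
      exact lt_of_le_of_lt (le_max_right _ _) h)
  refine ⟨ω, hω, fun η hη => ?_⟩
  apply le_of_forall_lt_imp_le_of_dense
  intro c hc
  apply hlim
  have hlt : c < sSup E := lt_of_lt_of_le hc (le_csSup hbd ⟨η, hη, rfl⟩)
  obtain ⟨N, hN⟩ := exists_nat_one_div_lt (sub_pos.2 hlt)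
  filter_upwards [eventually_ge_atTop N] with n hn
  have := hfe n
  have h2 : (1 : ℝ) / (n + 1) ≤ 1 / (N + 1) := Nat.one_div_le_one_div hn
  linarith

/-- Horizontal translation. -/
def shift (τ : ℝ) (x : ℝ × ℝ) : ℝ × ℝ := (x.1 + τ, x.2)

@[simp] lemma shift_fst (τ : ℝ) (x : ℝ × ℝ) : (shift τ x).1 = x.1 + τ := rfl
@[simp] lemma shift_snd (τ : ℝ) (x : ℝ × ℝ) : (shift τ x).2 = x.2 := rfl

lemma shift_eq_add (τ : ℝ) : shift τ = fun x => x + (τ, 0) := by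
  ext x <;> simp [shift]

lemma measurePreserving_shift (τ : ℝ) : MeasurePreserving (shift τ) := by
  rw [shift_eq_add]; exact measurePreserving_add_right _ _

lemma measurable_shift (τ : ℝ) : Measurable (shift τ) := (measurePreserving_shift τ).measurable

lemma integral_shift (τ : ℝ) (f : ℝ × ℝ → ℝ) : ∫ x, f (shift τ x) = ∫ x, f x := by
  rw [shift_eq_add]; exact integral_add_right_eq_self f _

lemma integrable_shift {τ : ℝ} {f : ℝ × ℝ → ℝ} (h : Integrable f) :
    Integrable fun x => f (shift τ x) := (measurePreserving_shift τ).integrable_comp_of_integrable h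

lemma ae_shift {p : ℝ × ℝ → Prop} (h : ∀ᵐ x : ℝ × ℝ, p x) (τ : ℝ) : ∀ᵐ x : ℝ × ℝ, p (shift τ x) :=
  (measurePreserving_shift τ).quasiMeasurePreserving.ae h

lemma green_shift (τ : ℝ) (x y : ℝ × ℝ) : green (shift τ x) (shift τ y) = green x y := by
  simp [green]

lemma Nice.shift (h : Nice ω) (τ : ℝ) : Nice fun x => ω (shift τ x) where
  meas := h.meas.comp (measurable_shift τ)
  bdd := by obtain ⟨C, hC⟩ := h.bdd; exact ⟨C, fun x => hC _⟩
  zero x hx := h.zero _ hx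
  int := integrable_shift h.int
  imp := integrable_shift (f := fun x => x.2 * ω x) h.imp

lemma Relaxed.shift (h : Relaxed halfPlane M ω) (τ : ℝ) :
    Relaxed halfPlane M fun x => ω (shift τ x) where
  meas := ((h.nice subset_rfl).shift τ).meas
  nonneg x := h.nonneg _
  le_one x := h.le_one _
  zero x hx := h.zero _ hx
  int := ((h.nice subset_rfl).shift τ).int
  mass_le := by rw [integral_shift]; exact h.mass_le
  imp := ((h.nice subset_rfl).shift τ).imp
  imp_le := by
    have := integral_shift τ fun x => x.2 * ω x
    simp only [shift_snd] at this
    rw [this]; exact h.imp_le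

lemma stream_shift (h : Nice ω) (τ : ℝ) (x : ℝ × ℝ) :
    stream (fun y => ω (shift τ y)) x = stream ω (shift τ x) := by
  rw [h.stream_eq, (h.shift τ).stream_eq,
    ← integral_shift τ (fun y => green (VortexPatch.shift τ x) y * ω y)]
  simp only [green_shift]

lemma pairing_shift (h : Nice ω) (τ : ℝ) :
    pairing (fun x => ω (shift τ x)) (fun x => ω (shift τ x)) = pairing ω ω := by
  rw [pairing_eq_integral (h.shift τ) (h.shift τ), pairing_eq_integral h h,
    ← integral_shift τ (fun x => stream ω x * ω x)]
  simp only [stream_shift h]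

lemma shift_refl (τ l : ℝ) (x : ℝ × ℝ) : shift τ (refl l x) = refl (l + τ) (shift τ x) := by
  ext <;> simp; ring

lemma HeavyRight.shift {l τ : ℝ} (h : HeavyRight (l + τ) ω) :
    HeavyRight l fun x => ω (shift τ x) := by
  filter_upwards [ae_shift h τ] with x hx hl
  rw [shift_refl]
  exact hx (by simpa using hl)

lemma HeavyLeft.shift {l τ : ℝ} (h : HeavyLeft (l + τ) ω) :
    HeavyLeft l fun x => ω (shift τ x) := by
  filter_upwards [ae_shift h τ] with x hx hl
  rw [shift_refl]
  exact hx (by simpa using hl)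

lemma tendsto_pairing_halfStrip (h : Nice ω) :
    Tendsto (fun n : ℕ => pairing ((halfStrip (n + 1)).indicator ω) ((halfStrip (n + 1)).indicator ω))
      atTop (𝓝 (pairing ω ω)) := by
  apply tendsto_integral_of_dominated_convergence
    (fun p : (ℝ × ℝ) × (ℝ × ℝ) => |green p.1 p.2 * (ω p.1 * ω p.2)|)
  · intro n
    exact ((h.indicator (measurableSet_halfStrip _)).measurable_prod
      (h.indicator (measurableSet_halfStrip _))).aestronglyMeasurable
  · exact (h.integrable_prod h).abs
  · intro n
    refine Eventually.of_forall fun p => ?_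
    simp only [Real.norm_eq_abs]
    by_cases h1 : p.1 ∈ halfStrip (n + 1)
    · by_cases h2 : p.2 ∈ halfStrip (n + 1)
      · simp [h1, h2]
      · simp only [h2, not_false_eq_true, Set.indicator_of_notMem, mul_zero, abs_zero]; positivity
    · simp only [h1, not_false_eq_true, Set.indicator_of_notMem, mul_zero, zero_mul, abs_zero]
      positivity
  · refine Eventually.of_forall fun p => ?_
    apply tendsto_const_nhds.congr'
    obtain ⟨N, hN⟩ := exists_nat_gt (max |p.1.1| |p.2.1|)
    filter_upwards [eventually_ge_atTop N] with n hn
    have hn' : (N : ℝ) ≤ n := by exact_mod_cast hn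
    have e : ∀ x : ℝ × ℝ, |x.1| < N → (halfStrip (n + 1)).indicator ω x = ω x := by
      intro x hx
      by_cases hxH : x ∈ halfPlane
      · have hmem : x ∈ halfStrip (n + 1) := ⟨hxH, by linarith⟩
        exact Set.indicator_of_mem hmem _
      · rw [h.zero x hxH, Set.indicator_of_notMem fun hx' => hxH hx'.1]
    rw [e _ (lt_of_le_of_lt (le_max_left _ _) hN), e _ (lt_of_le_of_lt (le_max_right _ _) hN)]

lemma Relaxed.indicator (h : Relaxed halfPlane M ω) {T : Set (ℝ × ℝ)} (hT : MeasurableSet T) :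
    Relaxed T M (T.indicator ω) := by
  have hn := h.nice subset_rfl
  have hle : ∀ x, T.indicator ω x ≤ ω x := fun x => Set.indicator_le_self' (fun x _ => h.nonneg x) x
  refine ⟨h.meas.indicator hT, fun x => Set.indicator_nonneg (fun x _ => h.nonneg x) x,
    fun x => (hle x).trans (h.le_one x), fun x hx => Set.indicator_of_notMem hx _,
    h.int.indicator hT, ?_, (hn.indicator hT).imp, ?_⟩
  · exact (integral_mono (h.int.indicator hT) h.int hle).trans h.mass_le
  · refine (integral_mono (hn.indicator hT).imp h.imp fun x => ?_).trans h.imp_le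
    by_cases hx : x ∈ T
    · simp [hx]
    · simpa [hx] using h.imp_nonneg subset_rfl x

/-- Existence of a maximizer over the relaxed class on the half plane. -/
theorem exists_max (hM : 0 < M) : ∃ ω, Relaxed halfPlane M ω ∧
    ∀ η, Relaxed halfPlane M η → pairing η η ≤ pairing ω ω := by
  -- The maximizers on growing half strips, translated so that their axis is x₁ = 0. The translate
  -- may leave its strip but stays in the half plane, and its ordering gives the uniform horizontal
  -- decay.
  have hseq : ∀ n : ℕ, ∃ f, Relaxed halfPlane M f ∧ (∀ l < 0, HeavyRight l f) ∧
      (∀ l > 0, HeavyLeft l f) ∧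
      ∀ η, Relaxed (halfStrip (n + 1)) M η → pairing η η ≤ pairing f f := by
    intro n
    have hL : (1 : ℝ) ≤ n + 1 := by simp
    obtain ⟨ω, hω, hmax⟩ := exists_max_halfStrip hM hL
    have hn := hω.nice (halfStrip_subset _)
    have hpos : 0 < ∫ x, ω x := by
      refine lt_of_le_of_ne (integral_nonneg hω.nonneg) fun he => ?_
      obtain ⟨η, hη, hη0⟩ := exists_relaxed_pos hM hL
      have := hmax η hη
      rw [pairing_zero_of_integral hn hω.nonneg he.symm] at this
      linarith
    obtain ⟨τ, hτ⟩ := exists_centered hω.int hω.nonneg hpos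
      (hω.heavy_of_max (halfStrip_subset _) (polarStable_halfStrip _) hmax)
    refine ⟨fun x => ω (shift τ x), (hω.mono (halfStrip_subset _)).shift τ,
      fun l hl => (hτ.right (l + τ) (by linarith)).shift,
      fun l hl => (hτ.left (l + τ) (by linarith)).shift, fun η hη => ?_⟩
    rw [pairing_shift hn]
    exact hmax η hη
  choose f hf hr hl hmax using hseq
  obtain ⟨ω, hω, hlim⟩ := exists_limit subset_rfl measurableSet_halfPlane hf (by
    intro ε hε
    obtain ⟨R₁, hR₁⟩ := exists_high_pot_le M hε
    obtain ⟨R₂, hR₂⟩ := exists_wide_pot_le hε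
    refine ⟨max R₁ R₂, fun n x hx hxR => ?_⟩
    rw [Prod.norm_def, lt_max_iff] at hxR
    rcases hxR with h | h
    · exact hR₂ _ _ _ (hf n) (hr n) (hl n) x (lt_of_le_of_lt (le_max_right _ _) h)
    · rw [Real.norm_of_nonneg (le_of_lt hx)] at h
      exact hR₁ _ _ subset_rfl (hf n) x (lt_of_le_of_lt (le_max_left _ _) h))
  refine ⟨ω, hω, fun η hη => ?_⟩
  apply le_of_forall_lt_imp_le_of_dense
  intro c hc
  apply hlim
  -- The energy of any competitor is the limit of the energies of its restrictions to the half
  -- strips, which the strip maximizers dominate.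
  filter_upwards [(tendsto_order.1 (tendsto_pairing_halfStrip (hη.nice subset_rfl))).1 c hc] with n hn
  exact hn.le.trans (hmax n _ (hη.indicator (measurableSet_halfStrip _)))

end

/-! ### Lagrange multipliers and the bathtub principle -/

section

variable {M : ℝ} {ω : ℝ × ℝ → ℝ}

/-- Functions with values in `[0, 1]`, without constraints on mass and impulse. -/
structure UnitNice (η : ℝ × ℝ → ℝ) : Prop where
  nice : Nice η
  nonneg : ∀ x, 0 ≤ η x
  le_one : ∀ x, η x ≤ 1

lemma Relaxed.unitNice {S : Set (ℝ × ℝ)} (h : Relaxed S M ω) (hS : S ⊆ halfPlane) : UnitNice ω :=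
  ⟨h.nice hS, h.nonneg, h.le_one⟩

lemma UnitNice.relaxed {η : ℝ × ℝ → ℝ} (h : UnitNice η) (h1 : ∫ x, η x ≤ 1)
    (h2 : ∫ x, x.2 * η x ≤ M) : Relaxed halfPlane M η :=
  ⟨h.nice.meas, h.nonneg, h.le_one, h.nice.zero, h.nice.int, h1, h.nice.imp, h2⟩

lemma UnitNice.combo {η ζ : ℝ × ℝ → ℝ} (h : UnitNice η) (h' : UnitNice ζ) {a b : ℝ} (ha : 0 ≤ a)
    (hb : 0 ≤ b) (hab : a + b = 1) : UnitNice fun x => a * η x + b * ζ x where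
  nice := (h.nice.const_mul a).add (h'.nice.const_mul b)
  nonneg x := by have := h.nonneg x; have := h'.nonneg x; positivity
  le_one x := by
    have := mul_le_mul_of_nonneg_left (h.le_one x) ha
    have := mul_le_mul_of_nonneg_left (h'.le_one x) hb
    linarith

lemma integral_combo {η ζ : ℝ × ℝ → ℝ} (h : Nice η) (h' : Nice ζ) (a b : ℝ) :
    ∫ x, (a * η x + b * ζ x) = a * (∫ x, η x) + b * ∫ x, ζ x := by
  rw [integral_add (h.const_mul a).int (h'.const_mul b).int, integral_const_mul, integral_const_mul]

lemma integral_snd_combo {η ζ : ℝ × ℝ → ℝ} (h : Nice η) (h' : Nice ζ) (a b : ℝ) :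
    ∫ x : ℝ × ℝ, x.2 * (a * η x + b * ζ x) =
      a * (∫ x : ℝ × ℝ, x.2 * η x) + b * ∫ x : ℝ × ℝ, x.2 * ζ x := by
  simp only [mul_add]
  rw [integral_add (h.const_mul a).imp (h'.const_mul b).imp, ← integral_const_mul,
    ← integral_const_mul]
  congr 1 <;> (congr 1; ext x; ring)

lemma pairing_combo {η ζ θ : ℝ × ℝ → ℝ} (h : Nice η) (h' : Nice ζ) (hθ : Nice θ) (a b : ℝ) :
    pairing (fun x => a * η x + b * ζ x) θ = a * pairing η θ + b * pairing ζ θ := by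
  rw [pairing_add_left (h.const_mul a) (h'.const_mul b) hθ, pairing_const_mul_left,
    pairing_const_mul_left]

/-- The first order condition for maximizers. -/
lemma Relaxed.pairing_le_of_max (h : Relaxed halfPlane M ω)
    (hmax : ∀ η, Relaxed halfPlane M η → pairing η η ≤ pairing ω ω) {η : ℝ × ℝ → ℝ}
    (hη : Relaxed halfPlane M η) : pairing η ω ≤ pairing ω ω := by
  have hn := h.nice subset_rfl
  have hηn := hη.nice subset_rfl
  set b := pairing η ω - pairing ω ω with hb
  set c := pairing ω ω - 2 * pairing η ω + pairing η η with hc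
  have key : ∀ t : ℝ, 0 < t → t ≤ 1 → 2 * b + t * c ≤ 0 := by
    intro t ht ht1
    have hU := (h.unitNice subset_rfl).combo (hη.unitNice subset_rfl) (sub_nonneg.2 ht1) ht.le
      (by ring)
    have hR : Relaxed halfPlane M fun x => (1 - t) * ω x + t * η x := by
      refine hU.relaxed ?_ ?_
      · rw [integral_combo hn hηn]
        nlinarith [h.mass_le, hη.mass_le]
      · rw [integral_snd_combo hn hηn]
        nlinarith [h.imp_le, hη.imp_le]
    have h1 := hmax _ hR
    rw [pairing_combo hn hηn hU.nice, pairing_comm ω, pairing_comm η, pairing_combo hn hηn hn,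
      pairing_combo hn hηn hηn, pairing_comm ω η] at h1
    have h2 : t * (2 * b + t * c) ≤ 0 := by rw [hb, hc]; nlinarith
    by_contra h3
    have := mul_pos ht (not_le.1 h3)
    linarith
  by_contra hlt
  have hb0 : 0 < b := by rw [hb]; linarith
  -- The energy of (1 - t) ω + t η exceeds that of ω by t (2b + tc); this t makes t|c| < b, so the
  -- gain would be positive.
  set t := min 1 (b / (|c| + 1))
  have ht0 : 0 < t := by positivity
  have h1 := key t ht0 (min_le_left _ _)
  have h2 : t * (|c| + 1) ≤ b := by
    have := min_le_right 1 (b / (|c| + 1))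
    rwa [le_div_iff₀ (by positivity)] at this
  have h3 : -(t * |c|) ≤ t * c := by
    rw [← mul_neg]; exact mul_le_mul_of_nonneg_left (neg_abs_le c) ht0.le
  nlinarith

lemma nonneg_of_forall_sub_lt {a c u : ℝ} (h : ∀ t ≥ 0, c - t * a < u) : 0 ≤ a := by
  by_contra ha
  have ha := not_le.1 ha
  have h0 := h 0 le_rfl
  have := h ((u - c) / (-a)) (div_nonneg (by linarith) (by linarith))
  have e : (u - c) / (-a) * a = -(u - c) := by have := ha.ne; field_simp
  linarith

lemma le_of_forall_sub_mul_lt {L k u : ℝ} (h : ∀ ε > 0, L - ε * k < u) : L ≤ u := by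
  have ht : Tendsto (fun ε : ℝ => L - ε * k) (𝓝[>] 0) (𝓝 L) := by
    have : Continuous fun ε : ℝ => L - ε * k := by fun_prop
    simpa using (this.tendsto 0).mono_left nhdsWithin_le_nhds
  apply le_of_tendsto ht
  filter_upwards [self_mem_nhdsWithin] with ε hε
  exact (h ε hε).le

/-- Lagrange multipliers for the mass and the impulse constraint. -/
lemma Relaxed.exists_multipliers (hM : 0 < M) (h : Relaxed halfPlane M ω)
    (hmax : ∀ η, Relaxed halfPlane M η → pairing η η ≤ pairing ω ω) :
    ∃ W γ : ℝ, 0 ≤ W ∧ 0 ≤ γ ∧ γ * (1 - ∫ x, ω x) = 0 ∧ W * (M - ∫ x, x.2 * ω x) = 0 ∧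
      ∀ η, UnitNice η → pairing η ω - W * (∫ x, x.2 * η x) - γ * ∫ x, η x ≤
        pairing ω ω - W * (∫ x, x.2 * ω x) - γ * ∫ x, ω x := by
  have hn := h.nice subset_rfl
  set e := pairing ω ω
  -- `C` collects the attainable triples (mass, impulse, linearized energy), with slack; `D`
  -- consists of triples strictly better than ω within strict constraints. The first order condition
  -- makes them disjoint.
  set C : Set (ℝ × ℝ × ℝ) := {z | ∃ η, UnitNice η ∧ ∫ x, η x ≤ z.1 ∧ ∫ x, x.2 * η x ≤ z.2.1 ∧
    z.2.2 ≤ pairing η ω}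
  set D : Set (ℝ × ℝ × ℝ) := Set.Iio 1 ×ˢ Set.Iio M ×ˢ Set.Ioi e
  have hDo : IsOpen D := isOpen_Iio.prod (isOpen_Iio.prod isOpen_Ioi)
  have hDc : Convex ℝ D := (convex_Iio 1).prod ((convex_Iio M).prod (convex_Ioi e))
  have hCc : Convex ℝ C := by
    rintro z ⟨η, hη, h1, h2, h3⟩ z' ⟨η', hη', h1', h2', h3'⟩ a b ha hb hab
    refine ⟨_, hη.combo hη' ha hb hab, ?_, ?_, ?_⟩
    · rw [integral_combo hη.nice hη'.nice]
      simp only [Prod.fst_add, Prod.smul_fst, smul_eq_mul]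
      gcongr
    · rw [integral_snd_combo hη.nice hη'.nice]
      simp only [Prod.fst_add, Prod.smul_fst, Prod.snd_add, Prod.smul_snd, smul_eq_mul]
      gcongr
    · rw [pairing_combo hη.nice hη'.nice hn]
      simp only [Prod.snd_add, Prod.smul_snd, smul_eq_mul]
      gcongr
  have hdisj : Disjoint D C := by
    rw [Set.disjoint_left]
    rintro z ⟨hz1, hz2, hz3⟩ ⟨η, hη, h1, h2, h3⟩
    have hz1 : z.1 < 1 := hz1
    have hz2 : z.2.1 < M := hz2
    have hz3 : e < z.2.2 := hz3
    have := h.pairing_le_of_max hmax (hη.relaxed (h1.trans hz1.le) (h2.trans hz2.le))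
    linarith
  obtain ⟨f, u, hfD, hfC⟩ := geometric_hahn_banach_open hDc hDo hCc hdisj
  set α := f (1, 0, 0)
  set β := f (0, 1, 0)
  set ζ := f (0, 0, 1)
  have hf : ∀ a b c : ℝ, f (a, b, c) = a * α + b * β + c * ζ := by
    intro a b c
    have : ((a, b, c) : ℝ × ℝ × ℝ) = a • (1, 0, 0) + b • (0, 1, 0) + c • (0, 0, 1) := by simp
    rw [this, map_add, map_add, map_smul, map_smul, map_smul]
    simp only [smul_eq_mul, α, β, ζ]
  have hD : ∀ a b c : ℝ, a < 1 → b < M → e < c → a * α + b * β + c * ζ < u := by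
    intro a b c ha hb hc
    rw [← hf]
    exact hfD _ ⟨ha, hb, hc⟩
  have hC : ∀ η, UnitNice η →
      u ≤ (∫ x, η x) * α + (∫ x, x.2 * η x) * β + pairing η ω * ζ := by
    intro η hη
    rw [← hf]
    exact hfC _ ⟨η, hη, le_rfl, le_rfl, le_rfl⟩
  -- `D` is unbounded in the directions of decreasing mass, decreasing impulse and increasing
  -- energy, and the functional is bounded above on `D`; this fixes the signs of its three
  -- coefficients.
  have hα : 0 ≤ α := nonneg_of_forall_sub_lt (c := (e + 1) * ζ) (u := u) fun t ht => by
    have := hD (-t) 0 (e + 1) (by linarith) hM (by linarith)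
    linarith
  have hβ : 0 ≤ β := nonneg_of_forall_sub_lt (c := (e + 1) * ζ) (u := u) fun t ht => by
    have := hD 0 (-t) (e + 1) one_pos (by linarith) (by linarith)
    linarith
  have hζ : 0 ≤ -ζ := nonneg_of_forall_sub_lt (c := (e + 1) * ζ) (u := u) fun t ht => by
    have := hD 0 0 (e + 1 + t) one_pos hM (by linarith)
    linarith
  have hcl : α + M * β + e * ζ ≤ u := le_of_forall_sub_mul_lt (k := α + β - ζ) fun ε hε => by
    have := hD (1 - ε) (M - ε) (e + ε) (by linarith) (by linarith) (by linarith)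
    linarith
  -- Slater's condition: if ζ = 0, the competitor η = 0 in `C` gives u ≤ 0, whereas the point (0, 0,
  -- e + 1) of `D` gives 0 < u.
  have hζ0 : 0 < -ζ := by
    refine lt_of_le_of_ne hζ fun h0 => ?_
    have hz : ζ = 0 := by linarith
    have h0 : UnitNice fun _ => (0 : ℝ) :=
      ⟨⟨measurable_const, ⟨0, by simp⟩, fun _ _ => rfl, integrable_zero _ _ _, by simp⟩,
        fun _ => le_rfl, fun _ => zero_le_one⟩
    have h1 := hC _ h0
    simp only [integral_zero, mul_zero, zero_mul, hz, add_zero] at h1 hcl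
    have h2 := hD 0 0 (e + 1) one_pos hM (by linarith)
    rw [hz] at h2
    have h3 : 0 ≤ M * β := by positivity
    linarith
  have hω := hC ω (h.unitNice subset_rfl)
  have s1 : 0 ≤ α * (1 - ∫ x, ω x) := mul_nonneg hα (sub_nonneg.2 h.mass_le)
  have s2 : 0 ≤ β * (M - ∫ x, x.2 * ω x) := mul_nonneg hβ (sub_nonneg.2 h.imp_le)
  have s3 : α * (1 - ∫ x, ω x) = 0 := by simp only [e] at hcl; linarith
  have s4 : β * (M - ∫ x, x.2 * ω x) = 0 := by simp only [e] at hcl; linarith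
  refine ⟨β / -ζ, α / -ζ, by positivity, by positivity, ?_, ?_, fun η hη => ?_⟩
  · rw [div_mul_eq_mul_div, s3, zero_div]
  · rw [div_mul_eq_mul_div, s4, zero_div]
  · have h1 := hC η hη
    have h2 : (-ζ) * (pairing η ω - β / -ζ * (∫ x, x.2 * η x) - α / -ζ * ∫ x, η x) ≤
        (-ζ) * (pairing ω ω - β / -ζ * (∫ x, x.2 * ω x) - α / -ζ * ∫ x, ω x) := by
      have e1 : ∀ q P I A : ℝ, 0 < q → q * (P - β / q * I - α / q * A) = q * P - β * I - α * A := by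
        intro q P I A hq; field_simp
      rw [e1 _ _ _ _ hζ0, e1 _ _ _ _ hζ0]
      simp only [e] at hcl
      linarith
    exact le_of_mul_le_mul_left h2 hζ0

/-- The bathtub principle. -/
lemma UnitNice.eq_patch_of_max (h : UnitNice ω) {W γ : ℝ}
    (hle : ∀ η, UnitNice η → pairing η ω - W * (∫ x, x.2 * η x) - γ * ∫ x, η x ≤
        pairing ω ω - W * (∫ x, x.2 * ω x) - γ * ∫ x, ω x)
    (hnull : volume {x : ℝ × ℝ | x ∈ halfPlane ∧ stream ω x - W * x.2 - γ = 0} = 0) :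
    ∀ᵐ x : ℝ × ℝ, ω x = (patchRegion ω W γ).indicator 1 x := by
  have hn := h.nice
  set F : ℝ × ℝ → ℝ := fun x => stream ω x - W * x.2 - γ
  have hFm : Measurable F := by
    have := hn.measurable_stream
    fun_prop
  set P := patchRegion ω W γ
  have hPm : MeasurableSet P := by
    have : P = halfPlane ∩ {x | F x > 0} := rfl
    rw [this]
    exact measurableSet_halfPlane.inter (measurableSet_lt measurable_const hFm)
  have hint : ∀ η, UnitNice η → Integrable (fun x => F x * η x) ∧
      ∫ x, F x * η x = pairing η ω - W * (∫ x, x.2 * η x) - γ * ∫ x, η x := by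
    intro η hη
    have i1 := hη.nice.integrable_stream_mul hn
    have i2 := hη.nice.imp.const_mul W
    have i3 := hη.nice.int.const_mul γ
    have e : (fun x => F x * η x) = fun x => stream ω x * η x - W * (x.2 * η x) - γ * η x := by
      ext x; simp only [F]; ring
    have i12 : Integrable fun x => stream ω x * η x - W * (x.2 * η x) := i1.sub i2
    refine ⟨by rw [e]; exact i12.sub i3, ?_⟩
    rw [e, integral_sub i12 i3, integral_sub i1 i2, integral_const_mul, integral_const_mul,
      pairing_eq_integral hη.nice hn]
  -- The region P is not known to have finite measure at this stage, so the competitor equals 1_P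
  -- only inside a ball and ω outside, which keeps it integrable.
  have hball : ∀ n : ℕ, ∀ᵐ x : ℝ × ℝ, x ∈ halfPlane → ‖x‖ ≤ n → F x ≠ 0 → ω x = P.indicator 1 x := by
    intro n
    set B := halfPlane ∩ Metric.closedBall (0 : ℝ × ℝ) n
    have hBm : MeasurableSet B := measurableSet_halfPlane.inter measurableSet_closedBall
    have hBf : volume B < ⊤ :=
      (measure_mono Set.inter_subset_right).trans_lt measure_closedBall_lt_top
    have hBR : ∀ x ∈ B, x.2 ≤ n := fun x hx =>
      (le_abs_self _).trans ((norm_snd_le x).trans (mem_closedBall_zero_iff.1 hx.2))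
    have hBn := nice_indicator_one hBm hBf Set.inter_subset_left hBR
    set η : ℝ × ℝ → ℝ := fun x => B.indicator (P.indicator 1) x + Bᶜ.indicator ω x
    have e1 : ∀ x ∈ B, η x = P.indicator 1 x := fun x hx => by simp [η, hx]
    have e2 : ∀ x, x ∉ B → η x = ω x := fun x hx => by simp [η, hx]
    have hη0 : ∀ x, 0 ≤ η x := by
      intro x
      by_cases hx : x ∈ B
      · rw [e1 x hx]; exact Set.indicator_nonneg (fun _ _ => zero_le_one) x
      · rw [e2 x hx]; exact h.nonneg x
    have hη1 : ∀ x, η x ≤ 1 := by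
      intro x
      by_cases hx : x ∈ B
      · rw [e1 x hx]
        by_cases hxP : x ∈ P <;> simp [hxP]
      · rw [e2 x hx]; exact h.le_one x
    have hηU : UnitNice η := by
      refine ⟨(hBn.add hn).mono ?_ fun x => ?_, hη0, hη1⟩
      · exact ((measurable_one.indicator hPm).indicator hBm).add (hn.meas.indicator hBm.compl)
      · rw [abs_of_nonneg (hη0 x)]
        refine le_trans ?_ (le_abs_self _)
        by_cases hx : x ∈ B
        · have := hη1 x
          have := h.nonneg x
          simp only [hx, Set.indicator_of_mem]
          linarith
        · rw [e2 x hx]; simp [hx]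
    have h1 := hle η hηU
    rw [← (hint η hηU).2, ← (hint ω h).2] at h1
    have hnn : ∀ x, 0 ≤ F x * η x - F x * ω x := by
      intro x
      by_cases hx : x ∈ B
      · rw [e1 x hx, ← mul_sub]
        by_cases hxP : x ∈ P
        · simp only [hxP, Set.indicator_of_mem, Pi.one_apply]
          exact mul_nonneg (le_of_lt hxP.2) (sub_nonneg.2 (h.le_one x))
        · have hF : F x ≤ 0 := by
            by_contra hF
            exact hxP ⟨hx.1, not_le.1 hF⟩
          simp only [hxP, not_false_eq_true, Set.indicator_of_notMem]
          have := h.nonneg x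
          nlinarith
      · rw [e2 x hx, sub_self]
    have h2 : ∫ x, (F x * η x - F x * ω x) = 0 := by
      apply le_antisymm _ (integral_nonneg hnn)
      rw [integral_sub (hint η hηU).1 (hint ω h).1]
      linarith
    rw [integral_eq_zero_iff_of_nonneg hnn ((hint η hηU).1.sub (hint ω h).1)] at h2
    filter_upwards [h2] with x hx hxH hxn hFx
    have hxB : x ∈ B := ⟨hxH, mem_closedBall_zero_iff.2 hxn⟩
    simp only [e1 x hxB, ← mul_sub, Pi.zero_apply] at hx
    have := (mul_eq_zero.1 hx).resolve_left hFx
    linarith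
  have hF0 : ∀ᵐ x : ℝ × ℝ, ¬ (x ∈ halfPlane ∧ F x = 0) := by
    rw [ae_iff]
    simp only [not_not]
    exact hnull
  filter_upwards [ae_all_iff.2 hball, hF0] with x h1 h2
  by_cases hx : x ∈ halfPlane
  · obtain ⟨n, hn⟩ := exists_nat_ge ‖x‖
    exact h1 n hx hn fun h0 => h2 ⟨hx, h0⟩
  · rw [hn.zero x hx, Set.indicator_of_notMem fun hxP => hx hxP.1]

end

/-! ### Upward shifts and positivity of the multiplier W -/

section

variable {M : ℝ} {ω : ℝ × ℝ → ℝ}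

/-- Vertical translation. -/
def lift (h : ℝ) (x : ℝ × ℝ) : ℝ × ℝ := (x.1, x.2 + h)

@[simp] lemma lift_fst (h : ℝ) (x : ℝ × ℝ) : (lift h x).1 = x.1 := rfl
@[simp] lemma lift_snd (h : ℝ) (x : ℝ × ℝ) : (lift h x).2 = x.2 + h := rfl

lemma lift_neg_lift (h : ℝ) (x : ℝ × ℝ) : lift (-h) (lift h x) = x := by
  ext <;> simp

lemma lift_eq_add (h : ℝ) : lift h = fun x => x + (0, h) := by
  ext x <;> simp [lift]

lemma measurePreserving_lift (h : ℝ) : MeasurePreserving (lift h) := by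
  rw [lift_eq_add]; exact measurePreserving_add_right _ _

lemma integral_lift (h : ℝ) (f : ℝ × ℝ → ℝ) : ∫ x, f (lift h x) = ∫ x, f x := by
  rw [lift_eq_add]; exact integral_add_right_eq_self f _

lemma lift_mem_halfPlane {h : ℝ} (hh : 0 ≤ h) {x : ℝ × ℝ} (hx : x ∈ halfPlane) :
    lift h x ∈ halfPlane := by
  have : 0 < x.2 := hx
  show 0 < x.2 + h
  linarith

lemma UnitNice.lift (hω : UnitNice ω) {h : ℝ} (hh : 0 ≤ h) :
    UnitNice fun x => ω (lift (-h) x) where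
  nice :=
    { meas := hω.nice.meas.comp (measurePreserving_lift _).measurable
      bdd := by obtain ⟨C, hC⟩ := hω.nice.bdd; exact ⟨C, fun x => hC _⟩
      zero := fun x hx => hω.nice.zero _ fun hx' => hx (by
        have := lift_mem_halfPlane hh hx'
        rwa [← neg_neg h, neg_neg (-h), lift_neg_lift] at this)
      int := (measurePreserving_lift _).integrable_comp_of_integrable hω.nice.int
      imp := by
        have h1 := (measurePreserving_lift (-h)).integrable_comp_of_integrable
          (hω.nice.imp.add (hω.nice.int.const_mul h))
        refine h1.congr (Eventually.of_forall fun x => ?_)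
        simp only [Function.comp, Pi.add_apply, lift_snd]
        ring }
  nonneg x := hω.nonneg _
  le_one x := hω.le_one _

lemma ae_prod_fst_ne : ∀ᵐ p : (ℝ × ℝ) × (ℝ × ℝ), p.1.1 ≠ p.2.1 := by
  have hm : MeasurableSet {p : (ℝ × ℝ) × (ℝ × ℝ) | ¬ p.1.1 ≠ p.2.1} := by
    simp only [ne_eq, not_not]
    exact measurableSet_eq_fun (by fun_prop) (by fun_prop)
  rw [ae_iff, Measure.volume_eq_prod, Measure.measure_prod_null hm]
  refine Eventually.of_forall fun x => ?_
  have := ae_fst_ne x.1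
  rw [ae_iff] at this
  simp only [Pi.zero_apply]
  convert this using 2
  ext y
  simp [eq_comm]

/-- The log-quotient estimate behind the monotonicity of the energy under upward shifts. -/
lemma green_lift_lower {x y : ℝ × ℝ} (hx : x ∈ halfPlane) (hy : y ∈ halfPlane) (hxy : x.1 ≠ y.1)
    {h : ℝ} (h0 : 0 < h) (h1 : h ≤ 1) :
    1 / (4 * Real.pi) * (h * (4 * (x.2 + y.2) / ((x.1 - y.1) ^ 2 + (x.2 + y.2 + 1) ^ 2)) -
      2 * Real.log (1 + h ^ 2 / distSq x y)) ≤
      green (lift h x) y + green x (lift h y) - 2 * green x y := by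
  have hx0 : 0 < x.2 := hx
  have hy0 : 0 < y.2 := hy
  have hne : ∀ z w : ℝ × ℝ, z.1 = x.1 → w.1 = y.1 → z ≠ w := fun z w hz hw he => hxy (by
    rw [← hz, ← hw, he])
  have hd : 0 < (x.1 - y.1) ^ 2 := by
    have := sub_ne_zero.2 hxy
    positivity
  rw [green_eq_log_sub (lift_mem_halfPlane h0.le hx) hy (hne _ _ rfl rfl),
    green_eq_log_sub hx (lift_mem_halfPlane h0.le hy) (hne _ _ rfl rfl),
    green_eq_log_sub hx hy (hne _ _ rfl rfl)]
  have e1 : distSq (lift h x) (conjP y) = (x.1 - y.1) ^ 2 + (x.2 + y.2 + h) ^ 2 := by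
    simp only [distSq, conjP, lift]; ring
  have e2 : distSq x (conjP (lift h y)) = (x.1 - y.1) ^ 2 + (x.2 + y.2 + h) ^ 2 := by
    simp only [distSq, conjP, lift]; ring
  have e3 : distSq x (conjP y) = (x.1 - y.1) ^ 2 + (x.2 + y.2) ^ 2 := by
    simp only [distSq, conjP]; ring
  have e4 : distSq (lift h x) y = (x.1 - y.1) ^ 2 + (x.2 - y.2 + h) ^ 2 := by
    simp only [distSq, lift]; ring
  have e5 : distSq x (lift h y) = (x.1 - y.1) ^ 2 + (x.2 - y.2 - h) ^ 2 := by
    simp only [distSq, lift]; ring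
  have e6 : distSq x y = (x.1 - y.1) ^ 2 + (x.2 - y.2) ^ 2 := rfl
  rw [e1, e2, e3, e4, e5, e6]
  set d := (x.1 - y.1) ^ 2
  set s := x.2 - y.2
  have hS : 0 < x.2 + y.2 := by linarith
  set t := x.2 + y.2
  -- The mirror-image part gains at first order in h: log u ≥ 1 - 1/u, and h ≤ 1 makes the
  -- denominator independent of h.
  have i1 : h * (2 * t / (d + (t + 1) ^ 2)) ≤ Real.log (d + (t + h) ^ 2) - Real.log (d + t ^ 2) := by
    rw [← Real.log_div (by positivity) (by positivity)]
    have := Real.one_sub_inv_le_log_of_pos (x := (d + (t + h) ^ 2) / (d + t ^ 2)) (by positivity)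
    refine le_trans ?_ this
    rw [inv_div]
    have e : 1 - (d + t ^ 2) / (d + (t + h) ^ 2) = (2 * t * h + h ^ 2) / (d + (t + h) ^ 2) := by
      field_simp; ring
    rw [e]
    calc h * (2 * t / (d + (t + 1) ^ 2)) = (2 * t * h) / (d + (t + 1) ^ 2) := by ring
      _ ≤ (2 * t * h + h ^ 2) / (d + (t + h) ^ 2) := by
        apply div_le_div₀ (by positivity) (by nlinarith) (by positivity)
        gcongr
  -- Lifting x and lifting y move s in opposite directions, so the singular part enters as a
  -- symmetric second difference. The product of the two shifted squared distances is (d + s² + h²)²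
  -- - 4s²h².
  have i2 : Real.log (d + (s + h) ^ 2) + Real.log (d + (s - h) ^ 2) - 2 * Real.log (d + s ^ 2) ≤
      2 * Real.log (1 + h ^ 2 / (d + s ^ 2)) := by
    have e : 1 + h ^ 2 / (d + s ^ 2) = (d + s ^ 2 + h ^ 2) / (d + s ^ 2) := by field_simp
    rw [e, Real.log_div (by positivity) (by positivity), ← Real.log_mul (by positivity) (by positivity)]
    have : Real.log ((d + (s + h) ^ 2) * (d + (s - h) ^ 2)) ≤ Real.log ((d + s ^ 2 + h ^ 2) ^ 2) := by
      apply Real.log_le_log (by positivity)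
      nlinarith [sq_nonneg (s * h)]
    rw [Real.log_pow] at this
    push_cast at this
    linarith
  have hp : 0 < 1 / (4 * Real.pi) := by positivity
  rw [show ∀ c A B C D E F : ℝ, c * (A - D) + c * (B - E) - 2 * (c * (C - F)) =
    c * (A + B - 2 * C - (D + E - 2 * F)) by intros; ring]
  apply mul_le_mul_of_nonneg_left _ hp.le
  have e7 : h * (4 * t / (d + (t + 1) ^ 2)) = 2 * (h * (2 * t / (d + (t + 1) ^ 2))) := by ring
  linarith

lemma pairing_lift (hω : UnitNice ω) {h : ℝ} (hh : 0 ≤ h) :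
    Integrable (fun p : (ℝ × ℝ) × (ℝ × ℝ) => green (lift h p.1) p.2 * (ω p.1 * ω p.2)) ∧
    pairing (fun x => ω (lift (-h) x)) ω =
      ∫ p : (ℝ × ℝ) × (ℝ × ℝ), green (lift h p.1) p.2 * (ω p.1 * ω p.2) := by
  have hmp := (measurePreserving_lift h).prod (MeasurePreserving.id (volume : Measure (ℝ × ℝ)))
  have hemb : MeasurableEmbedding (Prod.map (lift h) (id : ℝ × ℝ → ℝ × ℝ)) := by
    have : Prod.map (lift h) (id : ℝ × ℝ → ℝ × ℝ) = fun p => p + ((0, h), 0) := by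
      ext p <;> simp [lift]
    rw [this]
    exact measurableEmbedding_addRight _
  have hi := (hω.lift hh).nice.integrable_prod hω.nice
  have e : ∀ p : (ℝ × ℝ) × (ℝ × ℝ), green (lift h p.1) p.2 * (ω p.1 * ω p.2) =
      (fun p : (ℝ × ℝ) × (ℝ × ℝ) => green p.1 p.2 * (ω (lift (-h) p.1) * ω p.2))
        (Prod.map (lift h) id p) := by
    intro p
    simp [lift_neg_lift]
  refine ⟨?_, ?_⟩
  · simp only [e]
    exact hmp.integrable_comp_of_integrable hi
  · simp only [e]
    rw [pairing]
    exact (hmp.integral_comp hemb _).symm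

/-- The kernel `4 (x₂ + y₂) / ((x₁ - y₁)² + (x₂ + y₂ + 1)²)`. -/
def shiftKernel (p : (ℝ × ℝ) × (ℝ × ℝ)) : ℝ :=
  4 * (p.1.2 + p.2.2) / ((p.1.1 - p.2.1) ^ 2 + (p.1.2 + p.2.2 + 1) ^ 2)

lemma UnitNice.integrable_shiftKernel (hω : UnitNice ω) :
    Integrable fun p : (ℝ × ℝ) × (ℝ × ℝ) => shiftKernel p * (ω p.1 * ω p.2) := by
  have hi : Integrable fun p : (ℝ × ℝ) × (ℝ × ℝ) => ω p.1 * ω p.2 :=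
    hω.nice.int.mul_prod hω.nice.int
  have hm : Measurable shiftKernel := by unfold shiftKernel; fun_prop
  refine (hi.const_mul 4).mono' (hm.aestronglyMeasurable.mul hi.aestronglyMeasurable)
    (Eventually.of_forall fun p => ?_)
  have h1 := hω.nonneg p.1
  have h2 := hω.nonneg p.2
  by_cases hp : p.1 ∈ halfPlane ∧ p.2 ∈ halfPlane
  · have hp1 : 0 < p.1.2 := hp.1
    have hp2 : 0 < p.2.2 := hp.2
    have h3 : 0 ≤ shiftKernel p := by unfold shiftKernel; positivity
    have h4 : shiftKernel p ≤ 4 := by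
      unfold shiftKernel
      rw [div_le_iff₀ (by positivity)]
      nlinarith [sq_nonneg (p.1.1 - p.2.1), sq_nonneg (p.1.2 + p.2.2)]
    rw [Real.norm_of_nonneg (by positivity)]
    gcongr
  · have : ω p.1 * ω p.2 = 0 := by
      by_cases hp1 : p.1 ∈ halfPlane
      · rw [hω.nice.zero p.2 fun h => hp ⟨hp1, h⟩, mul_zero]
      · rw [hω.nice.zero p.1 hp1, zero_mul]
    simp [this]

/-- The singular loss per unit of height vanishes with h: log (1 + t²) ≤ t gives the integrable
bound 2/‖x - y‖ independent of h, and log (1 + t) ≤ t gives a pointwise bound of order h. -/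
lemma UnitNice.tendsto_log_quotient (hω : UnitNice ω) :
    (∀ h : ℝ, 0 < h → Integrable fun p : (ℝ × ℝ) × (ℝ × ℝ) =>
      2 / h * Real.log (1 + h ^ 2 / distSq p.1 p.2) * (ω p.1 * ω p.2)) ∧
    Tendsto (fun n : ℕ => ∫ p : (ℝ × ℝ) × (ℝ × ℝ), 2 / (1 / ((n : ℝ) + 1)) *
      Real.log (1 + (1 / ((n : ℝ) + 1)) ^ 2 / distSq p.1 p.2) * (ω p.1 * ω p.2)) atTop (𝓝 0) := by
  have hm : ∀ h : ℝ, Measurable fun p : (ℝ × ℝ) × (ℝ × ℝ) =>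
      2 / h * Real.log (1 + h ^ 2 / distSq p.1 p.2) * (ω p.1 * ω p.2) := by
    intro h
    have := hω.nice.meas
    unfold distSq
    fun_prop
  have hb : ∀ h : ℝ, 0 < h → ∀ᵐ p : (ℝ × ℝ) × (ℝ × ℝ),
      ‖2 / h * Real.log (1 + h ^ 2 / distSq p.1 p.2) * (ω p.1 * ω p.2)‖ ≤
        2 * (|ω p.1| * (‖p.1 - p.2‖⁻¹ * |ω p.2|)) := by
    intro h hh
    filter_upwards [ae_prod_fst_ne] with p hp
    have hne : p.1 ≠ p.2 := fun he => hp (by rw [he])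
    have hq := distSq_pos hne
    have hr : 0 < √(distSq p.1 p.2) := Real.sqrt_pos.2 hq
    have h1 := hω.nonneg p.1
    have h2 := hω.nonneg p.2
    have hl : 0 ≤ Real.log (1 + h ^ 2 / distSq p.1 p.2) := by
      apply Real.log_nonneg
      have : 0 ≤ h ^ 2 / distSq p.1 p.2 := by positivity
      linarith
    have hl2 : Real.log (1 + h ^ 2 / distSq p.1 p.2) ≤ h / √(distSq p.1 p.2) := by
      have := log_one_add_sq_le (t := h / √(distSq p.1 p.2)) (by positivity)
      rwa [div_pow, Real.sq_sqrt hq.le] at this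
    rw [Real.norm_of_nonneg (by positivity), abs_of_nonneg h1, abs_of_nonneg h2]
    calc 2 / h * Real.log (1 + h ^ 2 / distSq p.1 p.2) * (ω p.1 * ω p.2)
        ≤ 2 / h * (h / √(distSq p.1 p.2)) * (ω p.1 * ω p.2) := by gcongr
      _ = 2 * (√(distSq p.1 p.2))⁻¹ * (ω p.1 * ω p.2) := by field_simp
      _ ≤ 2 * ‖p.1 - p.2‖⁻¹ * (ω p.1 * ω p.2) := by
        have := inv_sqrt_distSq_le hne
        gcongr
      _ = _ := by ring
  have hdom := (hω.nice.integrable_prod_pot hω.nice).const_mul 2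
  refine ⟨fun h hh => hdom.mono' (hm h).aestronglyMeasurable (hb h hh), ?_⟩
  have h0 : (0 : ℝ) = ∫ p : (ℝ × ℝ) × (ℝ × ℝ), (0 : ℝ) := by simp
  rw [h0]
  apply tendsto_integral_of_dominated_convergence _ (fun n => (hm _).aestronglyMeasurable) hdom
    (fun n => hb _ (by positivity))
  filter_upwards [ae_prod_fst_ne] with p hp
  have hne : p.1 ≠ p.2 := fun he => hp (by rw [he])
  have hq := distSq_pos hne
  have hlim : Tendsto (fun n : ℕ => 1 / ((n : ℝ) + 1) * (2 / distSq p.1 p.2 * (ω p.1 * ω p.2)))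
      atTop (𝓝 0) := by
    simpa using tendsto_one_div_add_atTop_nhds_zero_nat.mul_const (2 / distSq p.1 p.2 * (ω p.1 * ω p.2))
  have h1 := hω.nonneg p.1
  have h2 := hω.nonneg p.2
  refine squeeze_zero (fun n => ?_) (fun n => ?_) hlim
  · have hl : 0 ≤ Real.log (1 + (1 / ((n : ℝ) + 1)) ^ 2 / distSq p.1 p.2) := by
      apply Real.log_nonneg
      have : 0 ≤ (1 / ((n : ℝ) + 1)) ^ 2 / distSq p.1 p.2 := by positivity
      linarith
    positivity
  · have hh : (0 : ℝ) < 1 / ((n : ℝ) + 1) := by positivity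
    generalize (1 : ℝ) / ((n : ℝ) + 1) = h at hh ⊢
    have hl := Real.log_le_sub_one_of_pos (x := 1 + h ^ 2 / distSq p.1 p.2) (by positivity)
    rw [add_sub_cancel_left] at hl
    calc 2 / h * Real.log (1 + h ^ 2 / distSq p.1 p.2) * (ω p.1 * ω p.2)
        ≤ 2 / h * (h ^ 2 / distSq p.1 p.2) * (ω p.1 * ω p.2) := by gcongr
      _ = _ := by field_simp

/-- Small upward shifts increase the linearized energy. -/
lemma exists_pairing_lift_gt (hω : UnitNice ω) (hpos : 0 < ∫ x, ω x) :
    ∃ h : ℝ, 0 < h ∧ pairing ω ω < pairing (fun x => ω (lift (-h) x)) ω := by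
  by_contra hcon
  push Not at hcon
  obtain ⟨hli, hlt⟩ := hω.tendsto_log_quotient
  have hk := hω.integrable_shiftKernel
  -- If no shift helped, integrating the kernel inequality and dividing by h would bound the first
  -- order gain by the singular loss, which tends to 0; but the gain has a positive kernel.
  have key : ∀ h : ℝ, 0 < h → h ≤ 1 →
      ∫ p : (ℝ × ℝ) × (ℝ × ℝ), shiftKernel p * (ω p.1 * ω p.2) ≤
        ∫ p : (ℝ × ℝ) × (ℝ × ℝ),
          2 / h * Real.log (1 + h ^ 2 / distSq p.1 p.2) * (ω p.1 * ω p.2) := by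
    intro h h0 h1
    obtain ⟨i1, e1⟩ := pairing_lift hω h0.le
    have i2 : Integrable fun p : (ℝ × ℝ) × (ℝ × ℝ) => green p.1 (lift h p.2) * (ω p.1 * ω p.2) := by
      refine i1.swap.congr (Eventually.of_forall fun p => ?_)
      simp only [Function.comp, Prod.fst_swap, Prod.snd_swap]
      rw [green_comm]; ring
    have e2 : ∫ p : (ℝ × ℝ) × (ℝ × ℝ), green p.1 (lift h p.2) * (ω p.1 * ω p.2) =
        ∫ p : (ℝ × ℝ) × (ℝ × ℝ), green (lift h p.1) p.2 * (ω p.1 * ω p.2) := by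
      rw [Measure.volume_eq_prod, ← integral_prod_swap]
      congr 1; ext p
      simp only [Prod.fst_swap, Prod.snd_swap]
      rw [green_comm]; ring
    have i3 := hω.nice.integrable_prod hω.nice
    have hle := hcon h h0
    have i12 : Integrable fun p : (ℝ × ℝ) × (ℝ × ℝ) => green (lift h p.1) p.2 * (ω p.1 * ω p.2) +
      green p.1 (lift h p.2) * (ω p.1 * ω p.2) := i1.add i2
    have h2 : ∫ p : (ℝ × ℝ) × (ℝ × ℝ), (green (lift h p.1) p.2 * (ω p.1 * ω p.2) +
        green p.1 (lift h p.2) * (ω p.1 * ω p.2) - 2 * (green p.1 p.2 * (ω p.1 * ω p.2))) ≤ 0 := by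
      rw [integral_sub i12 (i3.const_mul 2), integral_add i1 i2, e2, ← e1, integral_const_mul]
      change _ - 2 * pairing ω ω ≤ 0
      linarith
    have h3 : ∫ p : (ℝ × ℝ) × (ℝ × ℝ), h / (4 * Real.pi) * (shiftKernel p * (ω p.1 * ω p.2) -
        2 / h * Real.log (1 + h ^ 2 / distSq p.1 p.2) * (ω p.1 * ω p.2)) ≤
        ∫ p : (ℝ × ℝ) × (ℝ × ℝ), (green (lift h p.1) p.2 * (ω p.1 * ω p.2) +
        green p.1 (lift h p.2) * (ω p.1 * ω p.2) - 2 * (green p.1 p.2 * (ω p.1 * ω p.2))) := by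
      apply integral_mono_ae ((hk.sub (hli h h0)).const_mul _) (i12.sub (i3.const_mul 2))
      filter_upwards [ae_prod_fst_ne] with p hp
      by_cases hpH : p.1 ∈ halfPlane ∧ p.2 ∈ halfPlane
      · have h4 := mul_le_mul_of_nonneg_right (green_lift_lower hpH.1 hpH.2 hp h0 h1)
          (mul_nonneg (hω.nonneg p.1) (hω.nonneg p.2))
        refine le_trans (le_of_eq ?_) (h4.trans (le_of_eq ?_))
        · simp only [Pi.sub_apply]; unfold shiftKernel; field_simp
        · simp only [Pi.sub_apply]; ring
      · have : ω p.1 * ω p.2 = 0 := by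
          by_cases hp1 : p.1 ∈ halfPlane
          · rw [hω.nice.zero p.2 fun h => hpH ⟨hp1, h⟩, mul_zero]
          · rw [hω.nice.zero p.1 hp1, zero_mul]
        simp [this]
    have h5 := h3.trans h2
    rw [integral_const_mul, integral_sub hk (hli h h0)] at h5
    by_contra h6
    have h7 : 0 < h / (4 * Real.pi) := by positivity
    have := mul_pos h7 (sub_pos.2 (not_le.1 h6))
    linarith
  have hle : ∫ p : (ℝ × ℝ) × (ℝ × ℝ), shiftKernel p * (ω p.1 * ω p.2) ≤ 0 := by
    apply ge_of_tendsto hlt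
    refine Eventually.of_forall fun n => key _ (by positivity) ?_
    rw [div_le_one (by positivity)]
    simp
  have hnn : ∀ p : (ℝ × ℝ) × (ℝ × ℝ), 0 ≤ shiftKernel p * (ω p.1 * ω p.2) ∧
      (shiftKernel p * (ω p.1 * ω p.2) = 0 → ω p.1 * ω p.2 = 0) := by
    intro p
    by_cases hpH : p.1 ∈ halfPlane ∧ p.2 ∈ halfPlane
    · have hp1 : 0 < p.1.2 := hpH.1
      have hp2 : 0 < p.2.2 := hpH.2
      have h3 : 0 < shiftKernel p := by unfold shiftKernel; positivity
      exact ⟨mul_nonneg h3.le (mul_nonneg (hω.nonneg _) (hω.nonneg _)),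
        fun h => (mul_eq_zero.1 h).resolve_left h3.ne'⟩
    · have : ω p.1 * ω p.2 = 0 := by
        by_cases hp1 : p.1 ∈ halfPlane
        · rw [hω.nice.zero p.2 fun h => hpH ⟨hp1, h⟩, mul_zero]
        · rw [hω.nice.zero p.1 hp1, zero_mul]
      simp [this]
  have h0 := le_antisymm hle (integral_nonneg fun p => (hnn p).1)
  rw [integral_eq_zero_iff_of_nonneg (fun p => (hnn p).1) hk] at h0
  have hz : ∫ p : (ℝ × ℝ) × (ℝ × ℝ), ω p.1 * ω p.2 = 0 := by
    apply integral_eq_zero_of_ae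
    filter_upwards [h0] with p hp
    exact (hnn p).2 hp
  rw [Measure.volume_eq_prod, integral_prod_mul ω ω] at hz
  have := mul_pos hpos hpos
  linarith

/-- If W were 0, an upward shift, which keeps the mass, would contradict the multiplier inequality.
With W > 0, complementary slackness makes the impulse constraint an equality. -/
lemma Relaxed.exists_multipliers_pos (hM : 0 < M) (h : Relaxed halfPlane M ω)
    (hmax : ∀ η, Relaxed halfPlane M η → pairing η η ≤ pairing ω ω) :
    0 < (∫ x, ω x) ∧ ∃ W γ : ℝ, 0 < W ∧ 0 ≤ γ ∧ γ * (1 - ∫ x, ω x) = 0 ∧ ∫ x, x.2 * ω x = M ∧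
      ∀ η, UnitNice η → pairing η ω - W * (∫ x, x.2 * η x) - γ * ∫ x, η x ≤
        pairing ω ω - W * (∫ x, x.2 * ω x) - γ * ∫ x, ω x := by
  have hpos : 0 < ∫ x, ω x := by
    refine lt_of_le_of_ne (integral_nonneg h.nonneg) fun he => ?_
    obtain ⟨η, hη, hη0⟩ := exists_relaxed_pos hM le_rfl
    have := hmax η (hη.mono (halfStrip_subset _))
    rw [pairing_zero_of_integral (h.nice subset_rfl) h.nonneg he.symm] at this
    linarith
  obtain ⟨W, γ, hW, hγ, h1, h2, h3⟩ := h.exists_multipliers hM hmax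
  have hW0 : 0 < W := by
    refine lt_of_le_of_ne hW fun he => ?_
    have hU := h.unitNice subset_rfl
    obtain ⟨t, ht, hlt⟩ := exists_pairing_lift_gt hU hpos
    have h4 := h3 _ (hU.lift ht.le)
    rw [← he, integral_lift] at h4
    linarith
  exact ⟨hpos, W, γ, hW0, hγ, h1, by have := (mul_eq_zero.1 h2).resolve_left hW0.ne'; linarith, h3⟩

end

variable {M W γ τ : ℝ} {ω : ℝ × ℝ → ℝ}

/-! ### Decay of the stream function -/

/-- A ball of fixed radius about a distant point meets only the tail of the mass of ω, so
`exists_pot_le` applies. -/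
lemma exists_stream_le {S : Set (ℝ × ℝ)} (h : Relaxed S M ω) (hS : S ⊆ halfPlane) {ε : ℝ}
    (hε : 0 < ε) : ∃ R, ∀ x ∈ halfPlane, R < ‖x‖ → stream ω x ≤ ε * x.2 := by
  obtain ⟨ρ, hρ, m, hm, hp⟩ := exists_pot_le hε
  have ht := tendsto_setIntegral_of_antitone (μ := volume) (f := ω)
    (s := fun n : ℕ => (Metric.closedBall (0 : ℝ × ℝ) n)ᶜ)
    (fun n => measurableSet_closedBall.compl)
    (fun a b hab => Set.compl_subset_compl.2 (Metric.closedBall_subset_closedBall (by exact_mod_cast hab)))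
    ⟨0, h.int.integrableOn⟩
  have he : ⋂ n : ℕ, (Metric.closedBall (0 : ℝ × ℝ) n)ᶜ = ∅ := by
    rw [← Set.compl_iUnion, Metric.iUnion_closedBall_nat, Set.compl_univ]
  rw [he, Measure.restrict_empty, integral_zero_measure] at ht
  obtain ⟨n, hn⟩ := ((tendsto_order.1 ht).2 m hm).exists
  refine ⟨n + ρ, fun x hx hR => ?_⟩
  have hball : Metric.ball x ρ ⊆ (Metric.closedBall (0 : ℝ × ℝ) n)ᶜ := by
    intro y hy hy'
    rw [Metric.mem_ball, dist_eq_norm] at hy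
    rw [mem_closedBall_zero_iff] at hy'
    have := norm_sub_norm_le x y
    rw [norm_sub_rev] at hy
    linarith
  have hpx := hp S M ω h x
    ((setIntegral_mono_set h.int.integrableOn (Eventually.of_forall h.nonneg)
      hball.eventuallyLE).trans hn.le)
  have h1 := (le_abs_self _).trans ((h.nice hS).abs_stream_le hx)
  have hx0 : 0 < x.2 := hx
  nlinarith

/-- Decay with ε = W makes the excess at most -γ ≤ 0 far out. -/
lemma Relaxed.isBounded_patchRegion {S : Set (ℝ × ℝ)} (h : Relaxed S M ω) (hS : S ⊆ halfPlane)
    (hW : 0 < W) (hγ : 0 ≤ γ) : Bornology.IsBounded (patchRegion ω W γ) := by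
  obtain ⟨R, hR⟩ := exists_stream_le h hS hW
  refine (Metric.isBounded_closedBall (x := (0 : ℝ × ℝ)) (r := R)).subset fun x hx => ?_
  rw [mem_closedBall_zero_iff]
  by_contra hlt
  have := hR x hx.1 (not_le.1 hlt)
  have := hx.2
  linarith

lemma Nice.continuousOn_excess (h : Nice ω) (W γ : ℝ) :
    ContinuousOn (fun x : ℝ × ℝ => stream ω x - W * x.2 - γ) halfPlane :=
  (h.continuousOn_stream.sub (by fun_prop)).sub continuousOn_const

lemma Nice.isOpen_patchRegion (h : Nice ω) (W γ : ℝ) : IsOpen (patchRegion ω W γ) :=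
  (h.continuousOn_excess W γ).isOpen_inter_preimage isOpen_halfPlane isOpen_Ioi

lemma Nice.isOpen_excess_neg (h : Nice ω) (W γ : ℝ) :
    IsOpen {x : ℝ × ℝ | x ∈ halfPlane ∧ stream ω x - W * x.2 - γ < 0} :=
  (h.continuousOn_excess W γ).isOpen_inter_preimage isOpen_halfPlane isOpen_Iio

/-! ### Uniqueness of the multipliers -/

/-- If the patch regions of two pairs of constants agree a.e., the excess of one is nowhere
positive where the excess of the other is negative. -/
lemma Nice.not_excess_neg (h : Nice ω) {W' γ' : ℝ}
    (he : (patchRegion ω W γ).indicator (1 : ℝ × ℝ → ℝ) =ᵐ[volume]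
      (patchRegion ω W' γ').indicator 1) {x : ℝ × ℝ} (hx : x ∈ patchRegion ω W γ) :
    0 ≤ stream ω x - W' * x.2 - γ' := by
  by_contra hlt
  set U := patchRegion ω W γ ∩ {x : ℝ × ℝ | x ∈ halfPlane ∧ stream ω x - W' * x.2 - γ' < 0}
  have hU : IsOpen U := (h.isOpen_patchRegion W γ).inter (h.isOpen_excess_neg W' γ')
  have hpos : 0 < volume U := hU.measure_pos volume ⟨x, hx, hx.1, not_le.1 hlt⟩
  refine hpos.ne' (measure_mono_null (fun y hy => ?_) (ae_iff.1 he))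
  rw [Set.mem_ofPred_eq]
  intro hyeq
  rw [Set.indicator_of_mem hy.1 _, Set.indicator_of_notMem _ _] at hyeq
  · simp at hyeq
  · intro h2
    have h3 := hy.2.2
    have h4 := h2.2
    linarith

/-- On each horizontal line that meets the patch there is a boundary point to the right. -/
lemma Centered.exists_boundary (hc : Centered τ ω) (h : Nice ω)
    (hdecay : ∃ R, ∀ x ∈ halfPlane, R < ‖x‖ → stream ω x ≤ W / 2 * x.2) (hW : 0 < W) (hγ : 0 ≤ γ)
    {x : ℝ × ℝ} (hx : x ∈ patchRegion ω W γ) :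
    ∃ z, τ < z ∧ stream ω (z, x.2) - W * x.2 - γ = 0 := by
  obtain ⟨R, hR⟩ := hdecay
  have ht : 0 < x.2 := hx.1
  set a := τ + |x.1 - τ|
  have ha : τ ≤ a := le_add_of_nonneg_right (abs_nonneg _)
  have hFa : 0 < stream ω (a, x.2) - W * x.2 - γ := by
    rw [hc.stream_abs h ht]; exact hx.2
  set b := max a (R + 1)
  have hFb : stream ω (b, x.2) - W * x.2 - γ < 0 := by
    have h1 : R < ‖((b, x.2) : ℝ × ℝ)‖ := by
      have h2 : R + 1 ≤ b := le_max_right _ _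
      have h3 : b ≤ ‖((b, x.2) : ℝ × ℝ)‖ := (le_abs_self b).trans (norm_fst_le ((b, x.2) : ℝ × ℝ))
      linarith
    have := hR (b, x.2) ht h1
    have : 0 < W * x.2 := mul_pos hW ht
    simp only at *
    linarith
  have hcont : ContinuousOn (fun s : ℝ => stream ω (s, x.2) - W * x.2 - γ) (Set.Icc a b) :=
    (h.continuousOn_excess W γ).comp (f := fun s : ℝ => (s, x.2)) (by fun_prop) fun s _ => ht
  obtain ⟨z, hz, hz0⟩ := intermediate_value_Icc' (le_max_left _ _) hcont ⟨hFb.le, hFa.le⟩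
  refine ⟨z, lt_of_le_of_ne (ha.trans hz.1) fun hzτ => ?_, hz0⟩
  have : z = a := le_antisymm (hzτ ▸ ha) hz.1
  rw [← this] at hFa
  exact hFa.ne' hz0

/-- The second excess must vanish at the boundary point z where the first does. If it were negative
there, points just left of z would lie in the first patch with negative second excess; if positive,
points just right of z would lie in the second patch with negative first excess. Both are excluded
by `Nice.not_excess_neg`. -/
lemma Centered.multiplier_line (hc : Centered τ ω) (h : Nice ω)
    (hdecay : ∃ R, ∀ x ∈ halfPlane, R < ‖x‖ → stream ω x ≤ W / 2 * x.2) (hW : 0 < W) (hγ : 0 ≤ γ)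
    {W' γ' : ℝ} (he : (patchRegion ω W γ).indicator (1 : ℝ × ℝ → ℝ) =ᵐ[volume]
      (patchRegion ω W' γ').indicator 1) {x : ℝ × ℝ} (hx : x ∈ patchRegion ω W γ) :
    W' * x.2 + γ' = W * x.2 + γ := by
  obtain ⟨z, hz, hz0⟩ := hc.exists_boundary h hdecay hW hγ hx
  have ht : 0 < x.2 := hx.1
  have hcont : ContinuousAt (fun s : ℝ => stream ω (s, x.2) - W' * x.2 - γ') z :=
    ContinuousAt.comp (f := fun s : ℝ => (s, x.2)) (g := fun y : ℝ × ℝ => stream ω y - W' * y.2 - γ')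
      ((h.continuousOn_excess W' γ').continuousAt
        (isOpen_halfPlane.mem_nhds (show (z, x.2) ∈ halfPlane from ht))) (by fun_prop)
  rcases lt_trichotomy (stream ω (z, x.2) - W' * x.2 - γ') 0 with h1 | h1 | h1
  · have h2 := (hcont.eventually_lt_const h1).filter_mono (nhdsWithin_le_nhds (s := Set.Iio z))
    obtain ⟨s, hs, hsz, hsτ⟩ := (h2.and ((eventually_mem_nhdsWithin (s := Set.Iio z)).and
      ((eventually_gt_nhds hz).filter_mono nhdsWithin_le_nhds))).exists
    have h3 := hc.stream_lt h ht hsτ.le hsz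
    have h4 := h.not_excess_neg he (x := (s, x.2)) ⟨ht, by simp only; linarith⟩
    simp only at h4
    linarith
  · linarith
  · have h2 := (hcont.eventually_const_lt h1).filter_mono (nhdsWithin_le_nhds (s := Set.Ioi z))
    obtain ⟨s, hs, hsz⟩ := (h2.and self_mem_nhdsWithin).exists
    have h3 := hc.stream_lt h ht hz.le hsz
    have h4 := h.not_excess_neg he.symm (x := (s, x.2)) ⟨ht, hs⟩
    simp only at h4
    linarith

/-- The patch is open, so it meets two different heights, and the affine functions W x₂ + γ and W'
x₂ + γ' agree at both. -/
lemma Centered.multiplier_unique (hc : Centered τ ω) (h : Nice ω)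
    (hdecay : ∃ R, ∀ x ∈ halfPlane, R < ‖x‖ → stream ω x ≤ W / 2 * x.2) (hW : 0 < W) (hγ : 0 ≤ γ)
    (hne : (patchRegion ω W γ).Nonempty)
    {W' γ' : ℝ} (he : (patchRegion ω W γ).indicator (1 : ℝ × ℝ → ℝ) =ᵐ[volume]
      (patchRegion ω W' γ').indicator 1) : W' = W ∧ γ' = γ := by
  obtain ⟨x, hx⟩ := hne
  have hcont : Tendsto (fun s : ℝ => (x.1, s)) (𝓝[>] x.2) (𝓝 x) := by
    have : Continuous fun s : ℝ => (x.1, s) := by fun_prop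
    exact (this.tendsto x.2).mono_left nhdsWithin_le_nhds
  obtain ⟨s, hs, hsx⟩ := ((hcont.eventually ((h.isOpen_patchRegion W γ).mem_nhds hx)).and
    self_mem_nhdsWithin).exists
  have e1 := hc.multiplier_line h hdecay hW hγ he hx
  have e2 := hc.multiplier_line h hdecay hW hγ he hs
  simp only at e2
  have hsx' : x.2 < s := hsx
  have hW' : W' = W := by
    have : (W' - W) * (s - x.2) = 0 := by linear_combination e2 - e1
    rcases mul_eq_zero.1 this with h0 | h0 <;> linarith
  subst hW'
  exact ⟨rfl, by linarith⟩

/-! ### Steiner symmetry -/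

lemma continuous_shift (τ : ℝ) : Continuous (shift τ) := by unfold shift; fun_prop

lemma isBounded_preimage_shift {A : Set (ℝ × ℝ)} (hA : Bornology.IsBounded A) (τ : ℝ) :
    Bornology.IsBounded (shift τ ⁻¹' A) := by
  obtain ⟨R, hR⟩ := hA.exists_norm_le
  refine isBounded_iff_forall_norm_le.2 ⟨R + ‖((τ, 0) : ℝ × ℝ)‖, fun x hx => ?_⟩
  have h1 := hR _ hx
  rw [shift_eq_add] at h1
  have h2 := norm_sub_le (x + (τ, 0)) ((τ, 0) : ℝ × ℝ)
  rw [add_sub_cancel_right] at h2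
  linarith

lemma Centered.steiner (hc : Centered τ ω) (h : Nice ω) (W γ : ℝ) :
    SteinerSymmetric ((shift τ ⁻¹' patchRegion ω W γ).indicator 1) := by
  constructor
  · intro x hx
    have hiff : x ∈ shift τ ⁻¹' patchRegion ω W γ ↔ (-x.1, x.2) ∈ shift τ ⁻¹' patchRegion ω W γ := by
      have hsx : shift τ x ∈ halfPlane := hx
      have e : shift τ (-x.1, x.2) = refl τ (shift τ x) := by ext <;> simp; ring
      rw [Set.mem_preimage, Set.mem_preimage, e]
      simp only [patchRegion, Set.mem_ofPred_eq, hc.stream_even h hsx, refl_snd, refl_mem_halfPlane]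
    by_cases hx' : x ∈ shift τ ⁻¹' patchRegion ω W γ
    · rw [Set.indicator_of_mem hx' _, Set.indicator_of_mem (hiff.1 hx') _]; rfl
    · rw [Set.indicator_of_notMem hx' _, Set.indicator_of_notMem (fun h' => hx' (hiff.2 h')) _]
  · intro t ht a ha b hb hab
    rcases hab.eq_or_lt with rfl | hlt
    · exact le_rfl
    have ha0 : (0 : ℝ) ≤ a := ha
    have hle := hc.stream_lt h ht (a := a + τ) (b := b + τ) (by linarith) (by linarith)
    simp only
    by_cases hb' : (b, t) ∈ shift τ ⁻¹' patchRegion ω W γ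
    · have ha' : (a, t) ∈ shift τ ⁻¹' patchRegion ω W γ := by
        have h1 : 0 < stream ω (b + τ, t) - W * t - γ := hb'.2
        exact ⟨ht, show 0 < stream ω (a + τ, t) - W * t - γ by linarith⟩
      rw [Set.indicator_of_mem hb' _, Set.indicator_of_mem ha' _]; exact le_rfl
    · rw [Set.indicator_of_notMem hb' _]
      exact Set.indicator_nonneg (fun _ _ => zero_le_one) _

/-! ### The admissible class and the relaxed class -/

lemma stream_congr {ω' : ℝ × ℝ → ℝ} (h : ω =ᵐ[volume.restrict halfPlane] ω') :
    stream ω = stream ω' := by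
  ext x
  apply integral_congr_ae
  filter_upwards [h] with y hy
  rw [hy]

lemma energy_congr {ω' : ℝ × ℝ → ℝ} (h : ω =ᵐ[volume.restrict halfPlane] ω') :
    energy ω = energy ω' := by
  unfold energy
  rw [stream_congr h]
  congr 1
  apply integral_congr_ae
  filter_upwards [h] with y hy
  rw [hy]

lemma mass_congr {ω' : ℝ × ℝ → ℝ} (h : ω =ᵐ[volume.restrict halfPlane] ω') :
    mass ω = mass ω' := by
  apply integral_congr_ae
  filter_upwards [h] with y hy
  rw [hy]

lemma impulse_congr {ω' : ℝ × ℝ → ℝ} (h : ω =ᵐ[volume.restrict halfPlane] ω') :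
    impulse ω = impulse ω' := by
  apply integral_congr_ae
  filter_upwards [h] with y hy
  rw [hy]

lemma mass_eq_integral (h0 : ∀ x, 0 ≤ ω x) (hz : ∀ x, x ∉ halfPlane → ω x = 0) :
    mass ω = ∫ x, ω x := by
  unfold mass
  simp only [abs_of_nonneg (h0 _)]
  exact setIntegral_eq_integral_of_forall_compl_eq_zero hz

lemma impulse_eq_integral (h0 : ∀ x, 0 ≤ ω x) (hz : ∀ x, x ∉ halfPlane → ω x = 0) :
    impulse ω = ∫ x : ℝ × ℝ, x.2 * ω x := by
  unfold impulse
  simp only [abs_of_nonneg (h0 _)]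
  exact setIntegral_eq_integral_of_forall_compl_eq_zero fun x hx => by rw [hz x hx, mul_zero]

/-- The representative is the indicator of A, extended by zero; `Relaxed` needs its bounds and
support condition at every point. -/
lemma exists_relaxed_of_mem_admissible (hω : ω ∈ admissible M) :
    ∃ ω', Relaxed halfPlane M ω' ∧ ω =ᵐ[volume.restrict halfPlane] ω' := by
  obtain ⟨hint, ⟨A, hA, hAH, he⟩, hi, himp, hmass⟩ := hω
  set ω' : ℝ × ℝ → ℝ := A.indicator 1
  have hz : ∀ x, x ∉ halfPlane → ω' x = 0 := fun x hx =>
    Set.indicator_of_notMem (fun h => hx (hAH h)) _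
  have h0 : ∀ x, 0 ≤ ω' x := Set.indicator_nonneg fun _ _ => zero_le_one
  rw [impulse_congr he, impulse_eq_integral h0 hz] at himp
  rw [mass_congr he, mass_eq_integral h0 hz] at hmass
  refine ⟨ω', ⟨measurable_one.indicator hA, h0, ?_, hz, ?_, hmass, ?_, himp.le⟩, he⟩
  · exact fun x => Set.indicator_le_self' (f := (1 : ℝ × ℝ → ℝ)) (fun _ _ => zero_le_one) x
  · refine (integrableOn_iff_integrable_of_support_subset fun x hx => ?_).1 (hint.congr he)
    by_contra h
    exact hx (hz x h)
  · refine (integrableOn_iff_integrable_of_support_subset (s := halfPlane) fun x hx => ?_).1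
      (hi.congr ?_)
    · by_contra h
      exact hx (by simp only; rw [hz x h, mul_zero])
    · filter_upwards [he] with x hx
      rw [hx, abs_of_nonneg (h0 x)]

/-- The structure of the relaxed maximizers. -/
lemma Relaxed.structure_of_max (hM : 0 < M) (h : Relaxed halfPlane M ω)
    (hmax : ∀ η, Relaxed halfPlane M η → pairing η η ≤ pairing ω ω) :
    ∃ τ W γ : ℝ, Centered τ ω ∧ 0 < W ∧ 0 ≤ γ ∧ γ * (1 - ∫ x, ω x) = 0 ∧
      ∫ x, x.2 * ω x = M ∧ (patchRegion ω W γ).Nonempty ∧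
      ω =ᵐ[volume] (patchRegion ω W γ).indicator 1 := by
  obtain ⟨hpos, W, γ, hW, hγ, hs, hI, hle⟩ := h.exists_multipliers_pos hM hmax
  obtain ⟨τ, hc⟩ := exists_centered h.int h.nonneg hpos
    (h.heavy_of_max subset_rfl polarStable_halfPlane hmax)
  have hn := h.nice subset_rfl
  have he : ω =ᵐ[volume] (patchRegion ω W γ).indicator 1 :=
    (h.unitNice subset_rfl).eq_patch_of_max hle (hc.volume_level hn W γ)
  refine ⟨τ, W, γ, hc, hW, hγ, hs, hI, ?_, he⟩
  by_contra hemp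
  rw [Set.not_nonempty_iff_eq_empty.1 hemp, Set.indicator_empty] at he
  rw [integral_congr_ae he, integral_zero] at hpos
  exact hpos.false

/-- The relaxation is exact: a relaxed maximizer is a patch and saturates the impulse constraint. -/
lemma Relaxed.mem_admissible_of_max (hM : 0 < M) (h : Relaxed halfPlane M ω)
    (hmax : ∀ η, Relaxed halfPlane M η → pairing η η ≤ pairing ω ω) : ω ∈ admissible M := by
  obtain ⟨τ, W, γ, -, -, -, -, hI, -, he⟩ := h.structure_of_max hM hmax
  refine ⟨h.int.integrableOn, ⟨patchRegion ω W γ,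
    ((h.nice subset_rfl).isOpen_patchRegion W γ).measurableSet, fun x hx => hx.1,
    ae_restrict_of_ae he⟩, ?_, ?_, ?_⟩
  · simp only [abs_of_nonneg (h.nonneg _)]
    exact h.imp.integrableOn
  · rw [impulse_eq_integral h.nonneg h.zero, hI]
  · rw [mass_eq_integral h.nonneg h.zero]
    exact h.mass_le

lemma Relaxed.mem_maximizers_of_max (hM : 0 < M) (h : Relaxed halfPlane M ω)
    (hmax : ∀ η, Relaxed halfPlane M η → pairing η η ≤ pairing ω ω) : ω ∈ maximizers M := by
  refine ⟨h.mem_admissible_of_max hM hmax, fun η hη => ?_⟩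
  obtain ⟨η', hη', he⟩ := exists_relaxed_of_mem_admissible hη
  change energy η ≤ energy ω
  rw [energy_congr he, energy_eq (hη'.nice subset_rfl), energy_eq (h.nice subset_rfl)]
  linarith [hmax η' hη']

/-- The relaxed supremum is attained at an admissible function, so an admissible maximizer has at
least that energy and is itself a relaxed maximizer. -/
lemma exists_relaxed_max_of_mem_maximizers (hM : 0 < M) (hω : ω ∈ maximizers M) :
    ∃ ω', Relaxed halfPlane M ω' ∧ ω =ᵐ[volume.restrict halfPlane] ω' ∧
      ∀ η, Relaxed halfPlane M η → pairing η η ≤ pairing ω' ω' := by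
  obtain ⟨ω', h, he⟩ := exists_relaxed_of_mem_admissible hω.1
  refine ⟨ω', h, he, fun η hη => ?_⟩
  obtain ⟨ω₀, h₀, hmax₀⟩ := exists_max hM
  have h1 : energy ω₀ ≤ energy ω := hω.2 (h₀.mem_admissible_of_max hM hmax₀)
  rw [energy_congr he, energy_eq (h.nice subset_rfl), energy_eq (h₀.nice subset_rfl)] at h1
  linarith [hmax₀ η hη]

lemma patchRegion_congr {ω' : ℝ × ℝ → ℝ} (h : ω =ᵐ[volume.restrict halfPlane] ω') :
    patchRegion ω = patchRegion ω' := by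
  unfold patchRegion
  rw [stream_congr h]

lemma patchRegion_indicator_ae_eq {ω' : ℝ × ℝ → ℝ} {W' γ' : ℝ}
    (h : (patchRegion ω W γ).indicator (1 : ℝ × ℝ → ℝ) =ᵐ[volume.restrict halfPlane]
      (patchRegion ω' W' γ').indicator 1) :
    (patchRegion ω W γ).indicator (1 : ℝ × ℝ → ℝ) =ᵐ[volume]
      (patchRegion ω' W' γ').indicator 1 := by
  filter_upwards [(ae_restrict_iff' measurableSet_halfPlane).1 h] with x hx
  by_cases hxH : x ∈ halfPlane
  · exact hx hxH
  · rw [Set.indicator_of_notMem (fun h => hxH h.1) _, Set.indicator_of_notMem (fun h => hxH h.1) _]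

end VortexPatch

end

theorem mainTheorem3 (M : ℝ) (hM : 0 < M) :
    (VortexPatch.maximizers M).Nonempty ∧
    ∀ ω ∈ VortexPatch.maximizers M,
      (∃ W γ : ℝ, 0 < W ∧ 0 ≤ γ ∧
        ω =ᵐ[volume.restrict VortexPatch.halfPlane]
          (VortexPatch.patchRegion ω W γ).indicator 1 ∧
        (∀ W' γ' : ℝ, 0 < W' → 0 ≤ γ' →
          ω =ᵐ[volume.restrict VortexPatch.halfPlane]
            (VortexPatch.patchRegion ω W' γ').indicator 1 →
          W' = W ∧ γ' = γ) ∧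
        (VortexPatch.mass ω < 1 → γ = 0)) ∧
      (∃ (τ : ℝ) (A : Set (ℝ × ℝ)),
        IsOpen A ∧ Bornology.IsBounded A ∧ A ⊆ VortexPatch.halfPlane ∧
        VortexPatch.SteinerSymmetric (A.indicator 1) ∧
        (fun x : ℝ × ℝ => ω (x.1 + τ, x.2))
          =ᵐ[volume.restrict VortexPatch.halfPlane] A.indicator 1) := by
  obtain ⟨ω₀, h₀, hmax₀⟩ := VortexPatch.exists_max hM
  refine ⟨⟨ω₀, VortexPatch.Relaxed.mem_maximizers_of_max hM h₀ hmax₀⟩, fun ω hω => ?_⟩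
  obtain ⟨ω', h, heω, hmax⟩ := VortexPatch.exists_relaxed_max_of_mem_maximizers hM hω
  obtain ⟨τ, W, γ, hc, hW, hγ, hs, -, hne, he⟩ := h.structure_of_max hM hmax
  have hn := h.nice subset_rfl
  have her := heω.trans (ae_restrict_of_ae he)
  -- The stream function, patch region and mass depend only on the a.e. class on the half plane, so
  -- ω may be replaced by its representative.
  rw [VortexPatch.patchRegion_congr heω, VortexPatch.mass_congr heω,
    VortexPatch.mass_eq_integral h.nonneg h.zero]
  refine ⟨⟨W, γ, hW, hγ, her, fun W' γ' _ _ h' => ?_, fun hlt => ?_⟩,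
    τ, VortexPatch.shift τ ⁻¹' VortexPatch.patchRegion ω' W γ,
    (hn.isOpen_patchRegion W γ).preimage (VortexPatch.continuous_shift τ),
    VortexPatch.isBounded_preimage_shift (h.isBounded_patchRegion subset_rfl hW hγ) τ,
    fun x hx => hx.1, hc.steiner hn W γ, ?_⟩
  · exact hc.multiplier_unique hn (VortexPatch.exists_stream_le h subset_rfl (half_pos hW)) hW hγ hne
      (VortexPatch.patchRegion_indicator_ae_eq (her.symm.trans h'))
  -- Complementary slackness for the mass constraint: γ (1 - mass) = 0.
  · rcases mul_eq_zero.1 hs with h0 | h0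
    · exact h0
    · linarith
  · have h1 := (ae_restrict_iff' VortexPatch.measurableSet_halfPlane).1 her
    refine (ae_restrict_iff' VortexPatch.measurableSet_halfPlane).2 ?_
    filter_upwards [VortexPatch.ae_shift h1 τ] with x hx hxH
    exact hx hxH
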